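/- Let $C=(c_{ij})_{i,j\in I}$ ($I$ finite) be a symmetrizable generalized Cartan matrix with symmetrizer $(\epsilon_i)_{i\in I}$, $\epsilon_i\in\mathbb Z_{\ge1}$ (so $\epsilon_ic_{ij}=\epsilon_jc_{ji}$), and let $\tau$ be a permutation of $I$ with $\tau^2=\mathrm{Id}$, $c_{\tau i,\tau j}=c_{ij}$ and $\epsilon_{\tau i}=\epsilon_i$ for all $i,j$. Let $\mathbb K$ be a field of characteristic $0$, $q$ an indeterminate, $q_i=q^{\epsilon_i}$, $[n]_t=\frac{t^n-t^{-n}}{t-t^{-1}}$, $[m]_t^!=\prod_{j=1}^m[j]_t$, and for an element $x_i$ attached to $i\in I$ put $x_i^{(m)}=x_i^m/[m]^!_{q_i}$. Let $\widetilde{\mathbf U}$ be the $\mathbb K(q)$-algebra generated by $E_i,F_i,\widetilde K_i^{\pm1},\widetilde K_i'^{\pm1}$ ($i\in I$), where all $\widetilde K_i,\widetilde K_j'$ commute with each other, subject to $$\widetilde K_iE_j=q_i^{c_{ij}}E_j\widetilde K_i,\quad \widetilde K_iF_j=q_i^{-c_{ij}}F_j\widetilde K_i,\quad \widetilde K_i'E_j=q_i^{-c_{ij}}E_j\widetilde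 K_i',\quad \widetilde K_i'F_j=q_i^{c_{ij}}F_j\widetilde K_i',$$ $$[E_i,F_j]=\delta_{ij}\frac{\widetilde K_i-\widetilde K_i'}{q_i-q_i^{-1}},\qquad \sum_{n=0}^{1-c_{ij}}(-1)^nE_i^{(n)}E_jE_i^{(1-c_{ij}-n)}=0=\sum_{n=0}^{1-c_{ij}}(-1)^nF_i^{(n)}F_jF_i^{(1-c_{ij}-n)}\quad(i\ne j).$$ Let $\widetilde{\mathbf U}^\imath$ be the $\mathbb K(q)$-subalgebra of $\widetilde{\mathbf U}$ generated by $B_i=F_i+E_{\tau i}\widetilde K_i'$ and $\widetilde k_i=\widetilde K_i\widetilde K_{\tau i}'$ ($i\in I$). There is a unique $\mathbb K(q)$-linear anti-involution $\sigma$ of $\widetilde{\mathbf U}^\imath$ with $\sigma(B_i)=B_i$ and $\sigma(\widetilde k_i)=\widetilde k_{\tau i}$ for all $i\in I$. Let $i\in I$ with $\tau i\ne i$, write $c=c_{i,\tau i}$, and for $m\in\mathbb N$ and $e=\pm1$ define in $\widetilde{\mathbf U}^\imath$ $$\begin{aligned}\widetilde y_{i,\tau i;1,m,e}=&\sum_{r+s=m}(-1)^{r+c}q_i^{er(1-c-m)}B_i^{(r)}B_{\tau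 i}B_i^{(s)}-\frac{[1-c]^!_{q_i}}{[m]_{q_i}}(q_i-q_i^{-1})^{-c-1}\\ &\times\Big\{\prod_{j=0}^{c+m-2}\big(-q_i^{e(2j-c-2m+2)}+q_i^{c-2}\big)\,q_i^{\frac{-c^2+3c}{2}}B_i^{(m-1)}\widetilde k_i\\ &\qquad-(-1)^{c}\prod_{j=0}^{c+m-2}\big(-q_i^{e(2j-c-2m+2)}+q_i^{2-c}\big)\,q_i^{\frac{c^2-c}{2}}B_i^{(m-1)}\widetilde k_{\tau i}\Big\},\end{aligned}$$ where a product $\prod_{j=0}^{c+m-2}$ with $c+m-2<0$ is $1$ and, for $m=0$, the terms with $B_i^{(m-1)}$ are omitted; put $\widetilde y'_{i,\tau i;1,m,e}=\sigma(\widetilde y_{i,\tau i;1,m,e})$. Then for all $m\ge 1-c$ and $e=\pm1$, $$\widetilde y_{i,\tau i;1,m,e}=0\quad\text{and}\quad \widetilde y'_{i,\tau i;1,m,e}=0.$$ Moreover, for all $m>1-c$ these relations take the form $$\sum_{r+s=m}(-1)^{r+c}q_i^{r(1-c-m)}B_i^{(r)}B_{\tau i}B_i^{(s)}=(-1)^{1-c}[m-1]^!_{q_i}(q_i-q_i^{-1})^{m-2}q_i^{\frac{(1-m)(m-2+2c)}{2}}B_i^{(m-1)}\widetilde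 k_{\tau i},$$ $$\sum_{r+s=m}(-1)^{r+c}q_i^{-r(1-c-m)}B_i^{(r)}B_{\tau i}B_i^{(s)}=(-1)^{m+c+1}[m-1]^!_{q_i}(q_i-q_i^{-1})^{m-2}q_i^{\frac{(m-1)(m-2+2c)}{2}+c}B_i^{(m-1)}\widetilde k_i.$$ -/

import Mathlib

/-- A symmetrizable generalized Cartan matrix `c`, together with a symmetrizer: positive integers
`ε i` such that `diag(ε) * c` is symmetric. -/
structure CartanDatum (I : Type*) [Fintype I] [DecidableEq I] where
  c : Matrix I I ℤ
  diag : ∀ i, c i i = 2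
  off_diag : ∀ i j, i ≠ j → c i j ≤ 0
  zero_symm : ∀ i j, c i j = 0 → c j i = 0
  ε : I → ℕ
  ε_pos : ∀ i, 1 ≤ ε i
  symm : (Matrix.diagonal (fun i => (ε i : ℤ)) * c).IsSymm

/-- An involution of a Cartan datum: an involutive permutation `τ` of the index set that preserves
the Cartan matrix and the symmetrizer. The identity is allowed. -/
structure DiagramInvolution {I : Type*} [Fintype I] [DecidableEq I] (D : CartanDatum I) where
  τ : Equiv.Perm I
  invol : ∀ i, τ (τ i) = i
  c_map : ∀ i j, D.c (τ i) (τ j) = D.c i j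
  ε_map : ∀ i, D.ε (τ i) = D.ε i

noncomputable section

/-! ### Quantum integers -/

/-- The quantum integer `[n]_t`. -/
def qInt {k : Type*} [Field k] (t : k) (n : ℤ) : k := (t ^ n - t ^ (-n)) / (t - t⁻¹)

/-- The quantum factorial `[m]_t^!`. -/
def qFact {k : Type*} [Field k] (t : k) (m : ℕ) : k := ∏ j ∈ Finset.Icc 1 m, qInt t (j : ℤ)

/-- The divided power `x ^ m / [m]_t^!`. -/
def divPow {k A : Type*} [Field k] [Ring A] [Algebra k A] (t : k) (x : A) (m : ℕ) : A :=
  (qFact t m)⁻¹ • x ^ m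

/-- `q_i = q ^ ε_i` in the field `𝕂(q)`. -/
def CartanDatum.qi (𝕂 : Type*) [Field 𝕂] {I : Type*} [Fintype I] [DecidableEq I]
    (D : CartanDatum I) (i : I) : RatFunc 𝕂 := RatFunc.X ^ D.ε i

/-! ### The Drinfeld double quantum group -/

/-- Generators of the Drinfeld double: `E i`, `F i`, `K i`, `K' i` and the inverses of the
last two. -/
inductive DoubleGen (I : Type*) where
  | E (i : I)
  | F (i : I)
  | K (i : I)
  | K' (i : I)
  | Kinv (i : I)
  | K'inv (i : I)

/-- The free algebra on the generators. -/
abbrev DoubleFree (𝕂 : Type*) [Field 𝕂] (I : Type*) : Type _ :=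
  FreeAlgebra (RatFunc 𝕂) (DoubleGen I)

namespace DoubleFree

variable (𝕂 : Type*) [Field 𝕂] {I : Type*}

def E (i : I) : DoubleFree 𝕂 I := FreeAlgebra.ι (RatFunc 𝕂) (DoubleGen.E i)
def F (i : I) : DoubleFree 𝕂 I := FreeAlgebra.ι (RatFunc 𝕂) (DoubleGen.F i)
def K (i : I) : DoubleFree 𝕂 I := FreeAlgebra.ι (RatFunc 𝕂) (DoubleGen.K i)
def K' (i : I) : DoubleFree 𝕂 I := FreeAlgebra.ι (RatFunc 𝕂) (DoubleGen.K' i)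
def Kinv (i : I) : DoubleFree 𝕂 I := FreeAlgebra.ι (RatFunc 𝕂) (DoubleGen.Kinv i)
def K'inv (i : I) : DoubleFree 𝕂 I := FreeAlgebra.ι (RatFunc 𝕂) (DoubleGen.K'inv i)

end DoubleFree

/-- The quantum Serre element
`∑_{n=0}^{1-c_ij} (-1)^n x_i^{(n)} x_j x_i^{(1-c_ij-n)}`. -/
def serreElt (𝕂 : Type*) [Field 𝕂] {I : Type*} [Fintype I] [DecidableEq I] (D : CartanDatum I)
    {A : Type*} [Ring A] [Algebra (RatFunc 𝕂) A] (x : I → A) (i j : I) : A :=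
  ∑ p ∈ Finset.HasAntidiagonal.antidiagonal (1 - D.c i j).toNat,
    (-1 : RatFunc 𝕂) ^ p.1 •
      (divPow (D.qi 𝕂 i) (x i) p.1 * x j * divPow (D.qi 𝕂 i) (x i) p.2)

section
open DoubleFree

/-- The defining relations of the Drinfeld double quantum group. -/
inductive DoubleRel (𝕂 : Type*) [Field 𝕂] {I : Type*} [Fintype I] [DecidableEq I]
    (D : CartanDatum I) : DoubleFree 𝕂 I → DoubleFree 𝕂 I → Prop
  | K_Kinv (i : I) : DoubleRel 𝕂 D (K 𝕂 i * Kinv 𝕂 i) 1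
  | Kinv_K (i : I) : DoubleRel 𝕂 D (Kinv 𝕂 i * K 𝕂 i) 1
  | K'_K'inv (i : I) : DoubleRel 𝕂 D (K' 𝕂 i * K'inv 𝕂 i) 1
  | K'inv_K' (i : I) : DoubleRel 𝕂 D (K'inv 𝕂 i * K' 𝕂 i) 1
  | K_K (i j : I) : DoubleRel 𝕂 D (K 𝕂 i * K 𝕂 j) (K 𝕂 j * K 𝕂 i)
  | K_K' (i j : I) : DoubleRel 𝕂 D (K 𝕂 i * K' 𝕂 j) (K' 𝕂 j * K 𝕂 i)
  | K'_K' (i j : I) : DoubleRel 𝕂 D (K' 𝕂 i * K' 𝕂 j) (K' 𝕂 j * K' 𝕂 i)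
  | K_E (i j : I) : DoubleRel 𝕂 D (K 𝕂 i * E 𝕂 j)
      (D.qi 𝕂 i ^ D.c i j • (E 𝕂 j * K 𝕂 i))
  | K_F (i j : I) : DoubleRel 𝕂 D (K 𝕂 i * F 𝕂 j)
      (D.qi 𝕂 i ^ (-D.c i j) • (F 𝕂 j * K 𝕂 i))
  | K'_E (i j : I) : DoubleRel 𝕂 D (K' 𝕂 i * E 𝕂 j)
      (D.qi 𝕂 i ^ (-D.c i j) • (E 𝕂 j * K' 𝕂 i))
  | K'_F (i j : I) : DoubleRel 𝕂 D (K' 𝕂 i * F 𝕂 j)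
      (D.qi 𝕂 i ^ D.c i j • (F 𝕂 j * K' 𝕂 i))
  | E_F_same (i : I) : DoubleRel 𝕂 D (E 𝕂 i * F 𝕂 i - F 𝕂 i * E 𝕂 i)
      ((D.qi 𝕂 i - (D.qi 𝕂 i)⁻¹)⁻¹ • (K 𝕂 i - K' 𝕂 i))
  | E_F_ne (i j : I) : i ≠ j → DoubleRel 𝕂 D (E 𝕂 i * F 𝕂 j - F 𝕂 j * E 𝕂 i) 0
  | serre_E (i j : I) : i ≠ j → DoubleRel 𝕂 D (serreElt 𝕂 D (E 𝕂) i j) 0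
  | serre_F (i j : I) : i ≠ j → DoubleRel 𝕂 D (serreElt 𝕂 D (F 𝕂) i j) 0

end

/-- The Drinfeld double quantum group, as a `𝕂(q)`-algebra by generators and relations. -/
abbrev QDouble (𝕂 : Type*) [Field 𝕂] {I : Type*} [Fintype I] [DecidableEq I]
    (D : CartanDatum I) : Type _ := RingQuot (DoubleRel 𝕂 D)

namespace QDouble

variable (𝕂 : Type*) [Field 𝕂] {I : Type*} [Fintype I] [DecidableEq I] (D : CartanDatum I)

def E (i : I) : QDouble 𝕂 D := RingQuot.mkAlgHom (RatFunc 𝕂) (DoubleRel 𝕂 D) (DoubleFree.E 𝕂 i)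
def F (i : I) : QDouble 𝕂 D := RingQuot.mkAlgHom (RatFunc 𝕂) (DoubleRel 𝕂 D) (DoubleFree.F 𝕂 i)
def K (i : I) : QDouble 𝕂 D := RingQuot.mkAlgHom (RatFunc 𝕂) (DoubleRel 𝕂 D) (DoubleFree.K 𝕂 i)
def K' (i : I) : QDouble 𝕂 D := RingQuot.mkAlgHom (RatFunc 𝕂) (DoubleRel 𝕂 D) (DoubleFree.K' 𝕂 i)

end QDouble

/-! ### The universal quasi-split ıquantum group -/

namespace DiagramInvolution

variable (𝕂 : Type*) [Field 𝕂] {I : Type*} [Fintype I] [DecidableEq I] {D : CartanDatum I}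
  (T : DiagramInvolution D)

/-- `B_i = F_i + E_{τ i} K'_i` in the Drinfeld double. -/
def BDouble (i : I) : QDouble 𝕂 D :=
  QDouble.F 𝕂 D i + QDouble.E 𝕂 D (T.τ i) * QDouble.K' 𝕂 D i

/-- `k_i = K_i K'_{τ i}` in the Drinfeld double. -/
def kDouble (i : I) : QDouble 𝕂 D :=
  QDouble.K 𝕂 D i * QDouble.K' 𝕂 D (T.τ i)

/-- The universal quasi-split ıquantum group: the `𝕂(q)`-subalgebra of the Drinfeld double
generated by all `B_i` and all `k_i`. -/
def Ui : Subalgebra (RatFunc 𝕂) (QDouble 𝕂 D) :=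
  Algebra.adjoin (RatFunc 𝕂) (Set.range (T.BDouble 𝕂) ∪ Set.range (T.kDouble 𝕂))

/-- `B_i` as an element of the ıquantum group. -/
def B (i : I) : T.Ui 𝕂 :=
  ⟨T.BDouble 𝕂 i, Algebra.subset_adjoin (Or.inl ⟨i, rfl⟩)⟩

/-- `k_i` as an element of the ıquantum group. -/
def k (i : I) : T.Ui 𝕂 :=
  ⟨T.kDouble 𝕂 i, Algebra.subset_adjoin (Or.inr ⟨i, rfl⟩)⟩

/-- The divided power `B_i^{(m)} = B_i^m / [m]_{q_i}^!` (used for `τ i ≠ i`). -/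
def Bdiv (i : I) (m : ℕ) : T.Ui 𝕂 := divPow (D.qi 𝕂 i) (T.B 𝕂 i) m

/-- `σ` is the `𝕂(q)`-linear anti-involution of the ıquantum group that fixes every `B_i` and maps
`k_i` to `k_{τ i}`. An anti-homomorphism is a homomorphism to the opposite algebra. -/
structure IsSigma (σ : T.Ui 𝕂 →ₐ[RatFunc 𝕂] (T.Ui 𝕂)ᵐᵒᵖ) : Prop where
  invol : ∀ x, (σ (σ x).unop).unop = x
  map_B : ∀ i, (σ (T.B 𝕂 i)).unop = T.B 𝕂 i
  map_k : ∀ i, (σ (T.k 𝕂 i)).unop = T.k 𝕂 (T.τ i)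

/-- The twisted Serre sum
`∑_{r+s=m} (-1)^{r+c} q_i^{e r (1-c-m)} B_i^{(r)} B_{τ i} B_i^{(s)}`, where `c = c_{i,τ i}`. -/
def serreSum (i : I) (m : ℕ) (e : ℤ) : T.Ui 𝕂 :=
  ∑ p ∈ Finset.HasAntidiagonal.antidiagonal m,
    ((-1 : RatFunc 𝕂) ^ ((p.1 : ℤ) + D.c i (T.τ i)) *
        D.qi 𝕂 i ^ (e * (p.1 : ℤ) * (1 - D.c i (T.τ i) - (m : ℤ)))) •
      (T.Bdiv 𝕂 i p.1 * T.B 𝕂 (T.τ i) * T.Bdiv 𝕂 i p.2)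

/-- The element `ỹ_{i,τ i;1,m,e}`, with `c = c_{i,τ i}` and `Q = q_i`. A product over
`0 ≤ j ≤ c + m - 2` has `c + m - 1` factors, and is `1` if that number is not positive. The
exponents divided by `2` are even. For `m = 0` the coefficient `1 / [0] = 0` removes the terms with
`B_i^{(m-1)}`. -/
def yElt (i : I) (m : ℕ) (e : ℤ) : T.Ui 𝕂 :=
  let c : ℤ := D.c i (T.τ i)
  let Q : RatFunc 𝕂 := D.qi 𝕂 i
  T.serreSum 𝕂 i m e -
    (qFact Q (1 - c).toNat / qInt Q m * (Q - Q⁻¹) ^ (-c - 1)) •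
      (((∏ j ∈ Finset.range (c + m - 1).toNat,
            (-Q ^ (e * (2 * (j : ℤ) - c - 2 * m + 2)) + Q ^ (c - 2))) *
          Q ^ ((-c ^ 2 + 3 * c) / 2)) • (T.Bdiv 𝕂 i (m - 1) * T.k 𝕂 i) -
        ((-1 : RatFunc 𝕂) ^ c *
          (∏ j ∈ Finset.range (c + m - 1).toNat,
            (-Q ^ (e * (2 * (j : ℤ) - c - 2 * m + 2)) + Q ^ (2 - c))) *
          Q ^ ((c ^ 2 - c) / 2)) • (T.Bdiv 𝕂 i (m - 1) * T.k 𝕂 (T.τ i)))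

/-- The element `ỹ'_{i,τ i;1,m,e} = σ(ỹ_{i,τ i;1,m,e})`. -/
def yElt' (σ : T.Ui 𝕂 →ₐ[RatFunc 𝕂] (T.Ui 𝕂)ᵐᵒᵖ) (i : I) (m : ℕ) (e : ℤ) : T.Ui 𝕂 :=
  (σ (T.yElt 𝕂 i m e)).unop

end DiagramInvolution

end

/-! Put N = -c, p = q_i^c, Q = q_i². Up to a nonzero scalar, the Serre sum over r + s = m with
weights q_i^{r(1-c-m)} is the composite of the commutators x ↦ bx - q_i^{c+2l} xb, l < m, with b =
B_i (`qSerre_eq_qAdIter`). For m = N + 1 the scalars q_i^{-N}, ..., q_i^N form a list stable under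
inversion. Commutators with the same b commute, so the order of the list is immaterial.

The base relation m = 1 - c (`serreRelation_tau`). Write B_i = X + Y with X = F_i, Y = E_{τi}K'_i,
so that YX = Q XY. On F_{τi}, Y acts by p-commutation up to an error κ + Z, where κ is a multiple of
k_{τi} and Z one of K'_iK'_{τi}. By `qAdIter_add_of_qCommute` the iterated commutator is the Serre
element in X, which vanishes, plus a multiple of X^N Z, plus a multiple of B_i^N κ. The middle
coefficient contains 1 - p²Q^N = 0. The summand E_iK'_{τi} of B_{τi} is treated with X and Y
exchanged and all parameters inverted; it contributes k_i.

Higher m (`qSerre_higher`). The Serre sum for m + 1 is a q-commutator of the one for m with B_i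
(`qSerre_succ`). Since k_i and k_{τi} q-commute with B_i, the sum remains a combination of
B_i^{(m-1)}k_i and B_i^{(m-1)}k_{τi}, and each step multiplies a coefficient by u - q_i^{-c-2m},
where u is the commutation scalar. The first step kills one of the two terms; the other coefficient
accumulates to a quantum factorial. The case e = -1 is the same recursion in q_i⁻¹.

The anti-involution (`existsUnique_isSigma`). It is determined on generators. For existence, take in
the product of the algebra and its opposite the subalgebra generated by the pairs (B_i, B_i) and
(k_i, k_{τi}). If the first projection is injective on it, then σ is the second projection after the
inverse of the first. The relations among the B_i, including the inhomogeneous Serre relation for τi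
= i (`serreRelation_fixed`), are invariant under reversal, so the pairs satisfy them too. Filter the
subalgebra by the number of B's. On Verma modules of highest weight (χ, 1), a word in the B_i sends
the vacuum to the same word in the F_i plus shorter ones, and a polynomial in the k_i acts on the
vacuum by its value at χ. If the first component vanishes, then, χ being arbitrary, the leading
coefficients lie in the Serre ideal up to shorter words; the Serre relations for pairs then push the
element down the filtration, ultimately to 0 (`eq_zero_of_mem_filtLT`). -/

/-! ### Continuants with commuting entries -/

section Continuant

variable {M : Type*} [Ring M]

/-- The continuant: the determinant of the tridiagonal matrix with diagonal entries `a l`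
(`l < n`), where `b l` is the product of the two off-diagonal entries coupling `l - 1` and `l`. -/
def continuant (a b : ℕ → M) : ℕ → M
  | 0 => 1
  | 1 => a 0
  | n + 2 => a (n + 1) * continuant a b (n + 1) - b (n + 1) * continuant a b n

theorem continuant_zero_succ (a : ℕ → M) (n : ℕ) :
    continuant a 0 (n + 1) = a n * continuant a 0 n := by
  cases n <;> simp [continuant]

theorem continuant_congr {a b a' b' : ℕ → M} (n : ℕ) (ha : ∀ l < n, a l = a' l)
    (hb : ∀ l, 1 ≤ l → l < n → b l = b' l) : continuant a b n = continuant a' b' n := by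
  induction n using Nat.strong_induction_on with
  | _ n ih =>
    match n with
    | 0 => rfl
    | 1 => exact ha 0 (by omega)
    | n + 2 =>
      simp only [continuant]
      rw [ha _ (by omega), hb _ (by omega) (by omega),
        ih (n + 1) (by omega) (fun l hl => ha l (by omega)) (fun l h hl => hb l h (by omega)),
        ih n (by omega) (fun l hl => ha l (by omega)) (fun l h hl => hb l h (by omega))]

/-- Expansion of the tridiagonal determinant along its first row, where the definition expands along
the last one. Both expansions together give the reversal symmetry. -/
theorem continuant_succ_left {a b : ℕ → M} (haa : ∀ l m, Commute (a l) (a m))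
    (hab : ∀ l m, Commute (a l) (b m)) (hbb : ∀ l m, Commute (b l) (b m)) (n : ℕ) :
    continuant a b (n + 2) =
      a 0 * continuant (fun l => a (l + 1)) (fun l => b (l + 1)) (n + 1) -
        b 1 * continuant (fun l => a (l + 2)) (fun l => b (l + 2)) n := by
  induction n using Nat.strong_induction_on with
  | _ n ih =>
    match n with
    | 0 => simp [continuant, (haa 1 0).eq]
    | 1 =>
      simp only [continuant]
      rw [(haa 1 0).eq]
      have h1 := (haa 2 0).eq
      have h2 := (hab 2 1).eq
      have h3 := (hab 0 2).eq
      simp only [mul_sub, mul_one, ← mul_assoc, zero_add, Nat.reduceAdd]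
      rw [h1, h2, h3]
      abel
    | n + 2 =>
      rw [continuant, ih (n + 1) (by omega), ih n (by omega)]
      rw [continuant.eq_3 (fun l => a (l + 1)) _ (n + 1), continuant.eq_3 (fun l => a (l + 2)) _ n]
      simp only [mul_sub, ← mul_assoc]
      rw [(haa (n + 2 + 1) 0).eq, (hab (n + 2 + 1) 1).eq, ((hab 0 (n + 2 + 1)).eq).symm,
        (hbb (n + 2 + 1) 1).eq]
      abel

/-- Reversing the order of the basis does not change a determinant: the first-row expansion of one
side is the last-row expansion of the other. -/
theorem continuant_reverse {a b : ℕ → M} (haa : ∀ l m, Commute (a l) (a m))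
    (hab : ∀ l m, Commute (a l) (b m)) (hbb : ∀ l m, Commute (b l) (b m)) (n : ℕ) :
    continuant (fun l => a (n - 1 - l)) (fun l => b (n - l)) n = continuant a b n := by
  induction n using Nat.strong_induction_on generalizing a b with
  | _ n ih =>
    match n with
    | 0 => rfl
    | 1 => rfl
    | n + 2 =>
      rw [continuant_succ_left haa hab hbb, continuant,
        ← ih (n + 1) (by omega) (a := fun l => a (l + 1)) (b := fun l => b (l + 1))
          (fun _ _ => haa _ _) (fun _ _ => hab _ _) (fun _ _ => hbb _ _),
        ← ih n (by omega) (a := fun l => a (l + 2)) (b := fun l => b (l + 2))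
          (fun _ _ => haa _ _) (fun _ _ => hab _ _) (fun _ _ => hbb _ _)]
      congr 2
      · congr 1; omega
      · apply continuant_congr <;> intros <;> congr 1 <;> omega
      · congr 1; omega
      · apply continuant_congr <;> intros <;> congr 1 <;> omega

end Continuant

/-! ### Iterated q-commutators -/

section QAd

variable {k A : Type*} [Field k] [Ring A] [Algebra k A]

/-- The `z`-commutator with `b`, `x ↦ b x - z x b`. -/
def qAd (b : A) (z : k) : Module.End k A := LinearMap.mulLeft k b - z • LinearMap.mulRight k b

theorem qAd_apply (b : A) (z : k) (x : A) : qAd b z x = b * x - z • (x * b) := rfl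

theorem qAd_commute (b : A) (z w : k) : Commute (qAd b z) (qAd b w) := by
  ext x
  simp only [Module.End.mul_apply, qAd_apply, mul_sub, sub_mul, smul_sub, mul_assoc,
    mul_smul_comm, smul_mul_assoc, smul_smul, mul_comm z w]
  abel

/-- The iterated `z`-commutator of `x` with `b`. -/
def qAdIter (b : A) (z : ℕ → k) (n : ℕ) (x : A) : A := continuant (fun l => qAd b (z l)) 0 n x

theorem qAdIter_zero (b : A) (z : ℕ → k) (x : A) : qAdIter b z 0 x = x := rfl

theorem qAdIter_succ (b : A) (z : ℕ → k) (n : ℕ) (x : A) :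
    qAdIter b z (n + 1) x = b * qAdIter b z n x - z n • (qAdIter b z n x * b) := by
  rw [qAdIter, continuant_zero_succ]; rfl

/-- Commutators with the same element commute whatever their scalars, so this is the reversal of a
continuant without off-diagonal terms. -/
theorem qAdIter_reverse (b : A) (z : ℕ → k) (n : ℕ) (x : A) :
    qAdIter b (fun l => z (n - 1 - l)) n x = qAdIter b z n x :=
  congrArg (fun f : Module.End k A => f x) (continuant_reverse (b := 0)
    (fun l m => qAd_commute b (z l) (z m)) (fun _ _ => Commute.zero_right _)
    (fun _ _ => Commute.zero_right _) n)

theorem qAdIter_add (b : A) (z : ℕ → k) (n : ℕ) (x y : A) :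
    qAdIter b z n (x + y) = qAdIter b z n x + qAdIter b z n y := map_add _ _ _

theorem qAdIter_sub (b : A) (z : ℕ → k) (n : ℕ) (x y : A) :
    qAdIter b z n (x - y) = qAdIter b z n x - qAdIter b z n y := map_sub _ _ _

theorem qAdIter_smul (b : A) (z : ℕ → k) (n : ℕ) (s : k) (x : A) :
    qAdIter b z n (s • x) = s • qAdIter b z n x := map_smul _ _ _

theorem qAdIter_congr (b : A) {z w : ℕ → k} (n : ℕ) (h : ∀ l < n, z l = w l) (x : A) :
    qAdIter b z n x = qAdIter b w n x := by
  unfold qAdIter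
  rw [continuant_congr n (fun l hl => by rw [h l hl]) (fun _ _ _ => rfl)]

theorem map_qAdIter {A' : Type*} [Ring A'] [Algebra k A'] (φ : A →ₐ[k] A') (b : A) (z : ℕ → k)
    (n : ℕ) (x : A) : φ (qAdIter b z n x) = qAdIter (φ b) z n (φ x) := by
  induction n with
  | zero => rfl
  | succ n ih => rw [qAdIter_succ, qAdIter_succ, map_sub, map_smul, map_mul, map_mul, ih]

end QAd

/-! ### Expansion of iterated commutators with a sum of two elements -/

section IteratedCommutators

variable {k A : Type*} [Field k] [Ring A] [Algebra k A]

theorem qAdIter_succ_left (b : A) (z : ℕ → k) (n : ℕ) (x : A) :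
    qAdIter b z (n + 1) x = qAdIter b (fun l => z (l + 1)) n (b * x - z 0 • (x * b)) := by
  induction n with
  | zero => rfl
  | succ n ih => rw [qAdIter_succ, ih, qAdIter_succ]

theorem qAdIter_map_zero (b : A) (z : ℕ → k) (n : ℕ) : qAdIter b z n 0 = 0 := map_zero _

/-- An element that `q`-commutes with `b` and `x` also does so with the iterated commutators. -/
theorem mul_qAdIter {b x h : A} {u v : k} (hb : h * b = v • (b * h)) (hx : h * x = u • (x * h))
    (z : ℕ → k) (n : ℕ) : h * qAdIter b z n x = (u * v ^ n) • (qAdIter b z n x * h) := by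
  induction n with
  | zero => simpa [qAdIter_zero] using hx
  | succ n ih =>
    set y := qAdIter b z n x
    have e1 : h * (b * y) = (u * v ^ (n + 1)) • (b * y * h) := by
      rw [← mul_assoc, hb, smul_mul_assoc, mul_assoc, ih, mul_smul_comm, smul_smul, mul_assoc]
      congr 1; ring
    have e2 : h * (y * b) = (u * v ^ (n + 1)) • (y * b * h) := by
      rw [← mul_assoc, ih, smul_mul_assoc, mul_assoc, hb, mul_smul_comm, smul_smul, ← mul_assoc]
      congr 1; ring
    rw [qAdIter_succ, mul_sub, mul_smul_comm, e1, e2, sub_mul, smul_mul_assoc]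
    module

/-- Iterated commutators of elements twisted by `q`-commuting factors. -/
theorem qAdIter_twist {e f h h' : A} {u v : k} (hhe : h * e = v • (e * h))
    (hhf : h * f = u • (f * h)) (h'e : h' * e = u • (e * h')) (hh : h * h' = h' * h)
    (z : ℕ → k) (n : ℕ) :
    qAdIter (e * h) z n (f * h') =
      (∏ l ∈ Finset.range n, u * v ^ l) • (qAdIter e z n f * (h ^ n * h')) := by
  have hpow : ∀ n : ℕ, h ^ n * e = v ^ n • (e * h ^ n) := by
    intro n
    induction n with
    | zero => simp
    | succ n ih =>
      rw [pow_succ' h, mul_assoc, ih, mul_smul_comm, ← mul_assoc, hhe, smul_mul_assoc, smul_smul,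
        mul_assoc, pow_succ v]
  induction n with
  | zero => simp [qAdIter_zero]
  | succ n ih =>
    rw [qAdIter_succ, ih, qAdIter_succ, Finset.prod_range_succ]
    set y := qAdIter e z n f with hy
    have hhy : h * y = (u * v ^ n) • (y * h) := mul_qAdIter hhe hhf z n
    have e1 : e * h * (y * (h ^ n * h')) = (u * v ^ n) • (e * y * (h ^ (n + 1) * h')) := by
      rw [mul_assoc, ← mul_assoc h, hhy, smul_mul_assoc, mul_smul_comm, pow_succ' h]
      simp only [mul_assoc]
    have e2 : y * (h ^ n * h') * (e * h) = (u * v ^ n) • (y * e * (h ^ (n + 1) * h')) := by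
      have : h ^ n * h' * e = (u * v ^ n) • (e * (h ^ n * h')) := by
        rw [mul_assoc, h'e, mul_smul_comm, ← mul_assoc, hpow, smul_mul_assoc, smul_smul,
          mul_assoc]
      rw [mul_assoc, ← mul_assoc _ e h, this, smul_mul_assoc, mul_smul_comm, pow_succ h]
      simp only [mul_assoc, hh]
    rw [mul_smul_comm, smul_mul_assoc, e1, e2, sub_mul, smul_mul_assoc]
    module

/-- The expansion of iterated commutators with a sum of two `Q`-commuting elements. -/
theorem qAdIter_add_of_qCommute {X Y f κ Z : A} {Q p : k}
    (hYX : Y * X = Q • (X * Y)) (hYf : Y * f = p • (f * Y) + κ + Z)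
    (hZX : Z * X = (p * Q) • (X * Z)) (hYZ : Y * Z = (p * Q) • (Z * Y))
    (hκX : p • (κ * X) = Q • (X * κ)) (hκY : p • (κ * Y) = Q • (Y * κ)) (n : ℕ) :
    qAdIter (X + Y) (fun l => p * Q ^ l) (n + 1) f =
      qAdIter X (fun l => p * Q ^ l) (n + 1) f +
      ((∑ l ∈ Finset.range (n + 1), Q ^ l) *
        ∏ l ∈ Finset.range n, (1 - p ^ 2 * Q ^ (l + 1))) • (X ^ n * Z) +
      (∏ l ∈ Finset.range n, (1 - Q ^ (l + 2))) • ((X + Y) ^ n * κ) := by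
  have hY0 : ∀ n : ℕ, Y * X ^ n = Q ^ n • (X ^ n * Y) := by
    intro n
    induction n with
    | zero => simp
    | succ n ih =>
      rw [pow_succ X, ← mul_assoc, ih, smul_mul_assoc, mul_assoc, hYX, mul_smul_comm, smul_smul,
        mul_assoc, pow_succ Q]
  -- After one commutator κ no longer contributes: the terms Q Xκ and p κX agree by `hκX`, so only Z
  -- enters the error.
  have hcomm : ∀ n : ℕ, Y * qAdIter X (fun l => p * Q ^ l) (n + 1) f =
      (p * Q ^ (n + 1)) • (qAdIter X (fun l => p * Q ^ l) (n + 1) f * Y) +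
        (∏ l ∈ Finset.range (n + 1), Q * (1 - p ^ 2 * Q ^ l)) • (X ^ (n + 1) * Z) := by
    intro n
    induction n with
    | zero =>
      simp only [qAdIter_succ, qAdIter_zero, pow_zero, mul_one, zero_add, pow_one,
        Finset.prod_range_one]
      have e1 : Y * (X * f) = (Q * p) • (X * f * Y) + Q • (X * κ) + Q • (X * Z) := by
        rw [← mul_assoc, hYX, smul_mul_assoc, mul_assoc, hYf]
        simp only [mul_add, mul_smul_comm, smul_add, smul_smul, mul_assoc]
      have e2 : Y * (f * X) = (Q * p) • (f * X * Y) + κ * X + (p * Q) • (X * Z) := by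
        rw [← mul_assoc, hYf]
        simp only [add_mul, smul_mul_assoc, mul_assoc, hYX, hZX, mul_smul_comm, smul_smul]
        module
      rw [mul_sub, mul_smul_comm, e1, e2, smul_add, smul_add, hκX, sub_mul, smul_mul_assoc]
      module
    | succ n ih =>
      rw [qAdIter_succ, Finset.prod_range_succ]
      set y := qAdIter X (fun l => p * Q ^ l) (n + 1) f
      set g := ∏ l ∈ Finset.range (n + 1), Q * (1 - p ^ 2 * Q ^ l)
      have e1 : Y * (X * y) = (Q * (p * Q ^ (n + 1))) • (X * y * Y) +
          (Q * g) • (X ^ (n + 2) * Z) := by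
        rw [← mul_assoc, hYX, smul_mul_assoc, mul_assoc, ih, pow_succ' X (n + 1)]
        simp only [mul_add, mul_smul_comm, smul_add, smul_smul, mul_assoc]
      have e2 : Y * (y * X) = (Q * (p * Q ^ (n + 1))) • (y * X * Y) +
          (g * (p * Q)) • (X ^ (n + 2) * Z) := by
        rw [← mul_assoc, ih, pow_succ X (n + 1)]
        simp only [add_mul, smul_mul_assoc, mul_assoc, hYX, hZX, mul_smul_comm, smul_smul]
        module
      rw [mul_sub, mul_smul_comm, e1, e2, sub_mul, smul_mul_assoc]
      match_scalars <;> ring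
  induction n with
  | zero =>
    simp only [qAdIter_succ, qAdIter_zero, pow_zero, mul_one, zero_add, Finset.prod_range_zero,
      Finset.sum_range_one, one_smul, one_mul, add_mul, mul_add, hYf]
    module
  | succ n ih =>
    rw [qAdIter_succ, ih, qAdIter_succ X _ (n + 1), Finset.prod_range_succ,
      Finset.prod_range_succ, Finset.sum_range_succ _ (n + 1)]
    have hg : ∏ l ∈ Finset.range (n + 1), Q * (1 - p ^ 2 * Q ^ l) =
        Q ^ (n + 1) * (1 - p ^ 2) * ∏ l ∈ Finset.range n, (1 - p ^ 2 * Q ^ (l + 1)) := by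
      rw [Finset.prod_mul_distrib, Finset.prod_const, Finset.card_range, Finset.prod_range_succ']
      simp only [pow_zero, mul_one]
      ring
    have hc := hcomm n
    rw [hg] at hc
    have hs : (1 - Q) * ∑ l ∈ Finset.range (n + 1), Q ^ l = 1 - Q ^ (n + 1) :=
      mul_neg_geom_sum Q (n + 1)
    set y := qAdIter X (fun l => p * Q ^ l) (n + 1) f
    set g := ∏ l ∈ Finset.range n, (1 - p ^ 2 * Q ^ (l + 1))
    set v := ∏ l ∈ Finset.range n, (1 - Q ^ (l + 2))
    set s := ∑ l ∈ Finset.range (n + 1), Q ^ l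
    have hZ1 : (X + Y) * (X ^ n * Z) = X ^ (n + 1) * Z + (Q ^ n * (p * Q)) • (X ^ n * (Z * Y)) := by
      rw [add_mul, ← mul_assoc, ← pow_succ', ← mul_assoc, hY0, smul_mul_assoc, mul_assoc, hYZ,
        mul_smul_comm, smul_smul]
    have hZ2 : X ^ n * Z * (X + Y) = (p * Q) • (X ^ (n + 1) * Z) + X ^ n * (Z * Y) := by
      rw [mul_add, mul_assoc, hZX, mul_smul_comm, ← mul_assoc, ← pow_succ, mul_assoc]
    -- κ q-commutes with X + Y as a whole, so a further commutator just multiplies (X + Y)^n κ on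
    -- the left by X + Y, with the factor 1 - Q^{n+2}.
    have hK : (p * Q ^ (n + 1)) • ((X + Y) ^ n * κ * (X + Y)) =
        Q ^ (n + 2) • ((X + Y) ^ (n + 1) * κ) := by
      have : p • (κ * (X + Y)) = Q • ((X + Y) * κ) := by
        rw [mul_add, smul_add, hκX, hκY, add_mul, smul_add]
      rw [mul_comm p, mul_smul, mul_assoc, ← mul_smul_comm, this, mul_smul_comm, ← mul_assoc,
        ← pow_succ, smul_smul, ← pow_succ]
    have hK' : (X + Y) * ((X + Y) ^ n * κ) = (X + Y) ^ (n + 1) * κ := by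
      rw [← mul_assoc, ← pow_succ']
    have hy : (X + Y) * y = X * y + ((p * Q ^ (n + 1)) • (y * Y) +
        (Q ^ (n + 1) * (1 - p ^ 2) * g) • (X ^ (n + 1) * Z)) := by rw [add_mul, hc]
    -- The Z-terms from X, and from commuting Y past the leading term, combine into the next
    -- coefficient because (1 - Q)s = 1 - Q^{n+1}.
    have hcoef : s * g * (1 - p ^ 2 * Q ^ (n + 2)) + Q ^ (n + 1) * (1 - p ^ 2) * g =
        (s + Q ^ (n + 1)) * (g * (1 - p ^ 2 * Q ^ (n + 1))) := by
      linear_combination (p ^ 2 * Q ^ (n + 1) * g) * hs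
    rw [← hcoef]
    simp only [mul_add (X + Y), add_mul _ _ (X + Y), smul_add, mul_smul_comm, smul_mul_assoc, hy,
      hZ1, hZ2, hK', smul_comm (p * Q ^ (n + 1)) v, hK]
    rw [mul_add y]
    match_scalars <;> ring

/-- The diagonal case: the iterated commutators with `X` are continuants in the
commutators with `X + Y`. -/
theorem continuant_qAd_add {X Y f κ Z : A} {Q p : k}
    (hYX : Y * X = Q • (X * Y) + κ - Z) (hYf : Y * f = p • (f * Y))
    (hZX : Z * X = Q ^ 2 • (X * Z)) (hZf : Z * f = p ^ 2 • (f * Z))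
    (hκX : κ * X = X * κ) (hκf : κ * f = f * κ) (n : ℕ) :
    continuant (fun l => qAd (X + Y) (p * Q ^ l))
      (fun l => ((∑ j ∈ Finset.range l, Q ^ j) * (1 - p ^ 2 * Q ^ (l - 1))) •
        LinearMap.mulRight k κ) n f = qAdIter X (fun l => p * Q ^ l) n f := by
  set x := fun n => qAdIter X (fun l => p * Q ^ l) n f with hx
  have hxs : ∀ n, x (n + 1) = X * x n - (p * Q ^ n) • (x n * X) := fun n => qAdIter_succ _ _ _ _
  have hκx : ∀ n, κ * x n = x n * κ := fun n => by
    simpa using mul_qAdIter (h := κ) (b := X) (x := f) (u := (1 : k)) (v := 1)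
      (by simpa using hκX) (by simpa using hκf)
      (fun l => p * Q ^ l) n
  have hZx : ∀ n, Z * x n = (p ^ 2 * (Q ^ 2) ^ n) • (x n * Z) := fun n =>
    mul_qAdIter hZX hZf (fun l => p * Q ^ l) n
  -- Z cancels, since it commutes past x n with exactly the square of the scalar p Q^n. What remains
  -- involves κ two steps down, which is the off-diagonal entry of the continuant.
  have hY : ∀ n, Y * x (n + 1) = (p * Q ^ (n + 1)) • (x (n + 1) * Y) +
      ((∑ j ∈ Finset.range (n + 1), Q ^ j) * (1 - p ^ 2 * Q ^ n)) • (x n * κ) := by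
    have step : ∀ n, Y * (X * x n) - (p * Q ^ n) • (Y * x n * X) =
        Q • (X * (Y * x n)) + (x n * κ) - (p ^ 2 * (Q ^ 2) ^ n) • (x n * Z) -
          (p * Q ^ n) • (Y * x n * X) := by
      intro n
      rw [← mul_assoc, hYX, sub_mul, add_mul, smul_mul_assoc, hκx, hZx, mul_assoc X]
    intro n
    induction n with
    | zero =>
      have h0 : Y * x 0 = p • (x 0 * Y) := hYf
      rw [hxs, mul_sub, mul_smul_comm, ← mul_assoc Y (x _), step, h0]
      simp only [mul_smul_comm, smul_mul_assoc, mul_assoc, hYX, mul_add, mul_sub, sub_mul]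
      simp only [zero_add, Finset.sum_range_one, pow_zero]
      match_scalars <;> ring
    | succ n ih =>
      have hXx : X * x n = x (n + 1) + (p * Q ^ n) • (x n * X) := by rw [hxs n]; abel
      have hs : (1 - Q) * ∑ l ∈ Finset.range (n + 1), Q ^ l = 1 - Q ^ (n + 1) :=
        mul_neg_geom_sum Q (n + 1)
      rw [hxs (n + 1), mul_sub, mul_smul_comm, ← mul_assoc Y (x _), step, ih,
        Finset.sum_range_succ _ (n + 1)]
      set s := ∑ l ∈ Finset.range (n + 1), Q ^ l
      simp only [mul_smul_comm, smul_mul_assoc, mul_assoc, hYX, hκX, mul_add, mul_sub, sub_mul,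
        add_mul, smul_add, smul_sub]
      rw [← mul_assoc X (x n) κ, hXx, add_mul, smul_mul_assoc, mul_assoc (x n) X κ]
      match_scalars
      · ring
      · linear_combination -hs
      all_goals ring
  induction n using Nat.strong_induction_on with
  | _ n ih =>
    match n with
    | 0 => rfl
    | 1 =>
      simp only [continuant, qAd_apply, qAdIter_succ, qAdIter_zero, add_mul, mul_add, hYf]
      module
    | n + 2 =>
      simp only [continuant, LinearMap.sub_apply, Module.End.mul_apply]
      rw [ih (n + 1) (by omega), ih n (by omega)]
      rw [LinearMap.smul_apply, LinearMap.mulRight_apply, Nat.add_sub_cancel, qAd_apply]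
      change (X + Y) * x (n + 1) - (p * Q ^ (n + 1)) • (x (n + 1) * (X + Y)) - _ • (x n * κ) =
        x (n + 2)
      rw [add_mul, mul_add, hY, hxs (n + 1)]
      module

/-- Commutation of iterated commutators in `F` with `E`, in the presence of a rank one
relation `[E, F] = s (K - K')`. -/
theorem mul_qAdIter_of_rankOne {E F K K' f : A} {Q p s : k} (hp : p ≠ 0) (hQ : Q ≠ 0)
    (hEF : E * F = F * E + s • (K - K')) (hKF : K * F = Q⁻¹ • (F * K)) (hK'F : K' * F = Q • (F * K'))
    (hEf : E * f = f * E) (hKf : K * f = p⁻¹ • (f * K)) (hK'f : K' * f = p • (f * K')) (n : ℕ) :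
    E * qAdIter F (fun l => p * Q ^ l) (n + 1) f = qAdIter F (fun l => p * Q ^ l) (n + 1) f * E +
      (s * ∑ l ∈ Finset.range (n + 1), ((p * Q ^ l)⁻¹ - p * Q ^ l)) •
        (qAdIter F (fun l => p * Q ^ l) n f * K) := by
  set x := fun n => qAdIter F (fun l => p * Q ^ l) n f with hx
  have hxs : ∀ n, x (n + 1) = F * x n - (p * Q ^ n) • (x n * F) := fun n => qAdIter_succ _ _ _ _
  have hKx : ∀ n, K * x n = (p * Q ^ n)⁻¹ • (x n * K) := fun n => by
    rw [mul_inv, ← inv_pow]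
    exact mul_qAdIter hKF hKf _ n
  have hK'x : ∀ n, K' * x n = (p * Q ^ n) • (x n * K') := fun n => mul_qAdIter hK'F hK'f _ n
  change E * x (n + 1) = x (n + 1) * E + _ • (x n * K)
  -- In E(F x) - z E(x F) the two contributions of K' have the same coefficient and cancel; only
  -- those of K add up.
  induction n with
  | zero =>
    have h0 : E * x 0 = x 0 * E := hEf
    have e1 : E * (F * x 0) = F * x 0 * E + s • ((p * Q ^ 0)⁻¹ • (x 0 * K) -
        (p * Q ^ 0) • (x 0 * K')) := by
      rw [← mul_assoc, hEF, add_mul, smul_mul_assoc, sub_mul, hKx, hK'x, mul_assoc, h0, mul_assoc]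
    have e2 : E * (x 0 * F) = x 0 * F * E + s • (x 0 * K - x 0 * K') := by
      rw [← mul_assoc, h0, mul_assoc, hEF, mul_add, mul_smul_comm, mul_sub, mul_assoc]
    rw [hxs, mul_sub, mul_smul_comm, e1, e2, sub_mul, smul_mul_assoc, zero_add,
      Finset.sum_range_one]
    module
  | succ n ih =>
    rw [Finset.sum_range_succ]
    set γ := s * ∑ l ∈ Finset.range (n + 1), ((p * Q ^ l)⁻¹ - p * Q ^ l) with hγ
    have e1 : E * (F * x (n + 1)) = F * x (n + 1) * E + γ • (F * x n * K) +
        s • ((p * Q ^ (n + 1))⁻¹ • (x (n + 1) * K) - (p * Q ^ (n + 1)) • (x (n + 1) * K')) := by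
      rw [← mul_assoc, hEF, add_mul, smul_mul_assoc, sub_mul, hKx, hK'x, mul_assoc, ih, mul_add,
        mul_smul_comm]
      simp only [mul_assoc]
    have e2 : E * (x (n + 1) * F) = x (n + 1) * F * E + s • (x (n + 1) * K - x (n + 1) * K') +
        (γ * Q⁻¹) • (x n * F * K) := by
      rw [← mul_assoc, ih, add_mul, mul_assoc, hEF, mul_add, mul_smul_comm, mul_sub,
        smul_mul_assoc, mul_assoc _ K, hKF, mul_smul_comm, smul_smul]
      simp only [mul_assoc]
    have hFx : F * x n = x (n + 1) + (p * Q ^ n) • (x n * F) := by rw [hxs n]; abel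
    rw [hxs (n + 1), mul_sub, mul_smul_comm, e1, e2, sub_mul, smul_mul_assoc, hFx, add_mul,
      smul_mul_assoc]
    have : p * Q ^ (n + 1) * (γ * Q⁻¹) = γ * (p * Q ^ n) := by
      rw [pow_succ]; field_simp
    simp only [smul_add, smul_sub, smul_smul, this]
    match_scalars <;> ring

/-- An element commuting with `b` commutes with the iteration up to a commutator. -/
theorem mul_qAdIter_sub {b h : A} (hb : h * b = b * h) (z : ℕ → k) (n : ℕ) (x : A) :
    h * qAdIter b z n x - qAdIter b z n x * h = qAdIter b z n (h * x - x * h) := by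
  induction n with
  | zero => rfl
  | succ n ih =>
    rw [qAdIter_succ, qAdIter_succ, ← ih]
    simp only [mul_sub, sub_mul, mul_smul_comm, smul_mul_assoc, smul_sub]
    simp only [← mul_assoc, hb]
    simp only [mul_assoc, hb]
    abel

theorem qAdIter_eq_zero_of_first {b x : A} {z : ℕ → k} (h : b * x = z 0 • (x * b)) (n : ℕ) :
    qAdIter b z (n + 1) x = 0 := by
  rw [qAdIter_succ_left, h, sub_self, qAdIter_map_zero]

/-- The last commutator may be applied first, by `qAdIter_reverse`. -/
theorem qAdIter_eq_zero_of_last {b x : A} {z : ℕ → k} {n : ℕ} (h : b * x = z n • (x * b)) :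
    qAdIter b z (n + 1) x = 0 := by
  rw [← qAdIter_reverse]
  exact qAdIter_eq_zero_of_first (by simpa using h) n

end IteratedCommutators

/-! ### Continuants in commutators, with lower order terms -/

section TriIter

variable {k A : Type*} [Field k] [Ring A] [Algebra k A]

/-- The continuant in the `z l`-commutators with `b` and the multiples `β l • κ`, applied to an
element. -/
def triIter (b κ : A) (z β : ℕ → k) (n : ℕ) (x : A) : A :=
  continuant (fun l => qAd b (z l)) (fun l => β l • LinearMap.mulRight k κ) n x

theorem triIter_zero (b κ : A) (z β : ℕ → k) (x : A) : triIter b κ z β 0 x = x := rfl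

theorem triIter_one (b κ : A) (z β : ℕ → k) (x : A) :
    triIter b κ z β 1 x = b * x - z 0 • (x * b) := rfl

theorem triIter_add_two (b κ : A) (z β : ℕ → k) (n : ℕ) (x : A) :
    triIter b κ z β (n + 2) x = b * triIter b κ z β (n + 1) x -
      z (n + 1) • (triIter b κ z β (n + 1) x * b) - β (n + 1) • (triIter b κ z β n x * κ) := rfl

theorem triIter_add (b κ : A) (z β : ℕ → k) (n : ℕ) (x y : A) :
    triIter b κ z β n (x + y) = triIter b κ z β n x + triIter b κ z β n y := map_add _ _ _

theorem triIter_congr (b κ : A) {z β z' β' : ℕ → k} (n : ℕ) (hz : ∀ l < n, z l = z' l)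
    (hβ : ∀ l, 1 ≤ l → l < n → β l = β' l) (x : A) :
    triIter b κ z β n x = triIter b κ z' β' n x := by
  unfold triIter
  rw [continuant_congr n (fun l hl => by rw [hz l hl]) (fun l h1 hl => by rw [hβ l h1 hl])]

theorem triIter_smul (b κ : A) (z β : ℕ → k) (s : k) (n : ℕ) (x : A) :
    triIter b (s • κ) z β n x = triIter b κ z (fun l => β l * s) n x := by
  unfold triIter
  congr 2
  ext l y
  simp [smul_smul]

/-- As κ commutes with b, right multiplication by κ commutes with all commutators with b, and the
reversal of continuants applies. -/
theorem triIter_reverse {b κ : A} (h : κ * b = b * κ) (z β : ℕ → k) (n : ℕ) (x : A) :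
    triIter b κ (fun l => z (n - 1 - l)) (fun l => β (n - l)) n x = triIter b κ z β n x := by
  refine congrArg (fun f : Module.End k A => f x) (continuant_reverse
    (a := fun l => qAd b (z l)) (b := fun l => β l • LinearMap.mulRight k κ)
    (fun l m => qAd_commute b (z l) (z m)) (fun l m => ?_) (fun l m => ?_) n)
  · refine Commute.smul_right ?_ _
    ext x
    simp only [Module.End.mul_apply, qAd_apply, LinearMap.mulRight_apply, sub_mul, mul_assoc,
      smul_mul_assoc, h]
  · exact ((Commute.refl _).smul_left _).smul_right _

theorem mul_triIter {b κ x : A} (hb : κ * b = b * κ) (hx : κ * x = x * κ) (z β : ℕ → k) (n : ℕ) :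
    κ * triIter b κ z β n x = triIter b κ z β n x * κ := by
  have key : ∀ y : A, κ * y = y * κ → ∀ s : k, κ * (b * y - s • (y * b)) =
      (b * y - s • (y * b)) * κ := by
    intro y hy s
    simp only [mul_sub, sub_mul, mul_smul_comm, smul_mul_assoc]
    rw [← mul_assoc, hb, mul_assoc, hy, ← mul_assoc κ, hy, mul_assoc y, hb]
    simp only [mul_assoc]
  induction n using Nat.strong_induction_on with
  | _ n ih =>
    match n with
    | 0 => exact hx
    | 1 => exact key x hx _
    | n + 2 =>
      rw [triIter_add_two, mul_sub, sub_mul, key _ (ih (n + 1) (by omega)), mul_smul_comm,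
        smul_mul_assoc, ← mul_assoc, ih n (by omega)]

theorem map_triIter {A' : Type*} [Ring A'] [Algebra k A'] (φ : A →ₐ[k] A') (b κ : A)
    (z β : ℕ → k) (n : ℕ) (x : A) :
    φ (triIter b κ z β n x) = triIter (φ b) (φ κ) z β n (φ x) := by
  induction n using Nat.strong_induction_on with
  | _ n ih =>
    match n with
    | 0 => rfl
    | 1 => simp [triIter_one]
    | n + 2 =>
      rw [triIter_add_two, triIter_add_two]
      simp only [map_sub, map_smul, map_mul, ih (n + 1) (by omega), ih n (by omega)]

open MulOpposite in
/-- Continuants of commutators in the opposite algebra. -/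
theorem triIter_op {b κ x : A} (hb : κ * b = b * κ) (hx : κ * x = x * κ) {z : ℕ → k}
    (hz : ∀ l, z l ≠ 0) (β : ℕ → k) (n : ℕ) :
    triIter (op b) (op κ) z β n (op x) = op ((∏ l ∈ Finset.range n, -z l) •
      triIter b κ (fun l => (z l)⁻¹) (fun l => β l * (z l * z (l - 1))⁻¹) n x) := by
  induction n using Nat.strong_induction_on with
  | _ n ih =>
    match n with
    | 0 => simp [triIter_zero]
    | 1 =>
      simp only [triIter_one, Finset.prod_range_one, smul_sub, smul_smul, ← op_mul, ← op_smul,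
        ← op_sub, neg_mul, mul_inv_cancel₀ (hz 0)]
      congr 1
      module
    | n + 2 =>
      rw [triIter_add_two, triIter_add_two, ih (n + 1) (by omega), ih n (by omega)]
      simp only [← op_mul, ← op_smul, ← op_sub]
      congr 1
      have h1 := hz (n + 1)
      have h0 := hz n
      rw [mul_smul_comm _ κ, mul_triIter hb hx, Finset.prod_range_succ _ (n + 1),
        Finset.prod_range_succ _ n]
      simp only [smul_mul_assoc, mul_smul_comm, smul_sub, smul_smul, Nat.add_sub_cancel]
      match_scalars <;> field_simp

open MulOpposite in
/-- Iterated commutators in the opposite algebra. -/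
theorem qAdIter_op (b x : A) {z : ℕ → k} (hz : ∀ l, z l ≠ 0) (n : ℕ) :
    qAdIter (op b) z n (op x) = op ((∏ l ∈ Finset.range n, -z l) •
      qAdIter b (fun l => (z l)⁻¹) n x) := by
  induction n with
  | zero => simp [qAdIter_zero]
  | succ n ih =>
    rw [qAdIter_succ, qAdIter_succ, ih, Finset.prod_range_succ]
    simp only [← op_mul, ← op_smul, ← op_sub]
    congr 1
    have h0 := hz n
    simp only [smul_mul_assoc, mul_smul_comm, smul_sub, smul_smul]
    match_scalars <;> field_simp

end TriIter

/-! ### Quantum integers and twisted Serre sums -/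

section QuantumNumbers

variable {k : Type*} [Field k]

theorem qInt_inv (q : k) (n : ℤ) : qInt q⁻¹ n = qInt q n := by
  unfold qInt
  rw [inv_zpow', inv_zpow', neg_neg, inv_inv, ← neg_sub (q ^ n), ← neg_sub q, neg_div_neg_eq]

theorem qFact_inv (q : k) (n : ℕ) : qFact q⁻¹ n = qFact q n := by
  simp only [qFact, qInt_inv]

theorem qFact_succ (q : k) (n : ℕ) : qFact q (n + 1) = qFact q n * qInt q (n + 1 : ℕ) := by
  rw [qFact, Finset.prod_Icc_succ_top (by omega)]; rfl

theorem qFact_zero (q : k) : qFact q 0 = 1 := by simp [qFact]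

/-- The element `q` is non-zero and not a root of unity. -/
structure QGeneric (q : k) : Prop where
  ne_zero : q ≠ 0
  pow_ne_one : ∀ n : ℕ, 0 < n → q ^ n ≠ 1

theorem QGeneric.inv {q : k} (h : QGeneric q) : QGeneric q⁻¹ where
  ne_zero := inv_ne_zero h.ne_zero
  pow_ne_one n hn := by rw [inv_pow, ne_eq, inv_eq_one]; exact h.pow_ne_one n hn

theorem QGeneric.sub_inv_ne_zero {q : k} (h : QGeneric q) {n : ℕ} (hn : 0 < n) :
    q ^ n - (q ^ n)⁻¹ ≠ 0 := by
  intro h0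
  apply h.pow_ne_one (n + n) (by omega)
  have hne : q ^ n ≠ 0 := pow_ne_zero _ h.ne_zero
  rw [sub_eq_zero] at h0
  rw [pow_add]
  nth_rw 2 [h0]
  exact mul_inv_cancel₀ hne

theorem QGeneric.sub_inv_ne_zero' {q : k} (h : QGeneric q) : q - q⁻¹ ≠ 0 := by
  simpa using h.sub_inv_ne_zero one_pos

theorem QGeneric.qInt_ne_zero {q : k} (h : QGeneric q) {n : ℕ} (hn : 0 < n) :
    qInt q (n : ℤ) ≠ 0 := by
  rw [qInt, zpow_neg, zpow_natCast]
  exact div_ne_zero (h.sub_inv_ne_zero hn) h.sub_inv_ne_zero'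

theorem QGeneric.qFact_ne_zero {q : k} (h : QGeneric q) (n : ℕ) : qFact q n ≠ 0 :=
  Finset.prod_ne_zero_iff.mpr fun _ hj => h.qInt_ne_zero (Finset.mem_Icc.mp hj).1

theorem qInt_zero (q : k) : qInt q 0 = 0 := by simp [qInt]

theorem qInt_one {q : k} (h : QGeneric q) : qInt q 1 = 1 := by
  simp [qInt, div_self h.sub_inv_ne_zero']

variable {A : Type*} [Ring A] [Algebra k A]

theorem divPow_inv (q : k) (x : A) (n : ℕ) : divPow q⁻¹ x n = divPow q x n := by
  rw [divPow, qFact_inv]; rfl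

theorem divPow_succ {q : k} (h : QGeneric q) (x : A) (n : ℕ) :
    qInt q (n + 1 : ℕ) • divPow q x (n + 1) = divPow q x n * x := by
  have := h.qInt_ne_zero n.succ_pos
  rw [divPow, divPow, qFact_succ, smul_mul_assoc, pow_succ, smul_smul]
  congr 1
  field_simp

theorem divPow_succ' {q : k} (h : QGeneric q) (x : A) (n : ℕ) :
    qInt q (n + 1 : ℕ) • divPow q x (n + 1) = x * divPow q x n := by
  rw [divPow_succ h, divPow, smul_mul_assoc, mul_smul_comm, ← pow_succ, ← pow_succ']

theorem map_divPow {A' : Type*} [Ring A'] [Algebra k A'] (φ : A →ₐ[k] A') (q : k) (x : A) (n : ℕ) :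
    φ (divPow q x n) = divPow q (φ x) n := by
  simp [divPow]

/-- The alternating sum `∑ (-w)^r b^{(r)} x b^{(s)}` over `r + s = m`. -/
def qSerre (q : k) (b x : A) (w : k) (m : ℕ) : A :=
  ∑ p ∈ Finset.HasAntidiagonal.antidiagonal m,
    (-w) ^ p.1 • (divPow q b p.1 * x * divPow q b p.2)

/-- Only divided powers involve q, and they are invariant under q ↦ q⁻¹. This lets e = -1 be handled
by inverting q with w kept as an independent parameter. -/
theorem qSerre_inv (q : k) (b x : A) (w : k) (m : ℕ) : qSerre q⁻¹ b x w m = qSerre q b x w m := by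
  simp only [qSerre, divPow_inv]

/-- The engine of the induction on m: [m+1] splits so that [s] is absorbed by the right divided
power and [r] by the left one. Taking w = q^{1-c-(m+1)} turns w q into q^{1-c-m}, so the twisted
sums are closed under the recursion. -/
theorem qSerre_succ {q : k} (h : QGeneric q) (b x : A) (w : k) (m : ℕ) :
    qInt q (m + 1 : ℕ) • qSerre q b x w (m + 1) =
      qSerre q b x (w * q) m * b - (w * q ^ (-m : ℤ)) • (b * qSerre q b x (w * q) m) := by
  have hq := h.ne_zero
  have split : ∀ p ∈ Finset.HasAntidiagonal.antidiagonal (m + 1),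
      qInt q (m + 1 : ℕ) • ((-w) ^ p.1 • (divPow q b p.1 * x * divPow q b p.2)) =
      (-(w * q)) ^ p.1 • (divPow q b p.1 * x * (qInt q p.2 • divPow q b p.2)) +
      ((-w) ^ p.1 * q ^ (-p.2 : ℤ)) • ((qInt q p.1 • divPow q b p.1) * x * divPow q b p.2) := by
    rintro ⟨r, s⟩ hp
    rw [Finset.HasAntidiagonal.mem_antidiagonal] at hp
    simp only at hp ⊢
    have key : qInt q (m + 1 : ℕ) = q ^ r * qInt q s + q ^ (-s : ℤ) * qInt q r := by
      rw [← hp]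
      have := h.sub_inv_ne_zero'
      unfold qInt
      rw [mul_div_assoc', mul_div_assoc', ← add_div]
      congr 1
      push_cast
      rw [neg_add, zpow_add₀ hq, zpow_add₀ hq]
      simp only [zpow_neg, zpow_natCast]
      have : q ^ r ≠ 0 := pow_ne_zero _ hq
      have : q ^ s ≠ 0 := pow_ne_zero _ hq
      field_simp
      ring
    rw [key]
    simp only [mul_smul_comm, smul_mul_assoc, smul_smul, ← add_smul]
    congr 1
    rw [← neg_mul, mul_pow]
    ring
  rw [qSerre, Finset.smul_sum, Finset.sum_congr rfl split, Finset.sum_add_distrib,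
    Finset.Nat.sum_antidiagonal_succ', Finset.Nat.sum_antidiagonal_succ]
  simp only [Nat.cast_zero, qInt_zero, zero_smul, mul_zero, zero_mul, smul_zero,
    zero_add, divPow_succ h]
  rw [sub_eq_add_neg, qSerre, Finset.sum_mul, Finset.mul_sum, ← smul_neg, ← Finset.sum_neg_distrib,
    Finset.smul_sum]
  congr 1
  · exact Finset.sum_congr rfl fun p _ => by rw [smul_mul_assoc]; simp only [mul_assoc]
  · refine Finset.sum_congr rfl ?_
    rintro ⟨r, s⟩ hp
    rw [Finset.HasAntidiagonal.mem_antidiagonal] at hp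
    simp only at hp ⊢
    rw [← divPow_succ h, divPow_succ' h, mul_smul_comm, ← neg_smul, smul_smul]
    simp only [mul_assoc]
    congr 1
    rw [← hp]
    push_cast
    simp only [neg_add, zpow_add₀ hq, zpow_neg, zpow_natCast]
    have : q ^ r ≠ 0 := pow_ne_zero _ hq
    rw [← neg_mul, mul_pow, pow_succ]
    field_simp

/-- The alternating sum as an iterated commutator. -/
theorem qSerre_eq_qAdIter {q : k} (h : QGeneric q) (b x : A) (c : ℤ) (m : ℕ) :
    qSerre q b x (q ^ (1 - c - m)) m =
      ((qFact q m)⁻¹ * ∏ l ∈ Finset.range m, -q ^ (-c - 2 * l : ℤ)) •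
        qAdIter b (fun l => q ^ (c + 2 * l : ℤ)) m x := by
  have hq := h.ne_zero
  induction m with
  | zero => simp [qSerre, divPow, qFact, qAdIter_zero]
  | succ m ih =>
    have h1 := h.qInt_ne_zero m.succ_pos
    have hw : q ^ (1 - c - (m + 1 : ℕ)) * q = q ^ (1 - c - m) := by
      rw [← zpow_add_one₀ hq]; congr 1; push_cast; ring
    have hrec := qSerre_succ h b x (q ^ (1 - c - (m + 1 : ℕ))) m
    rw [hw, ih, ← zpow_add₀ hq] at hrec
    rw [← inv_smul_smul₀ h1 (qSerre _ _ _ _ _), hrec, qAdIter_succ, qFact_succ,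
      Finset.prod_range_succ]
    have e1 : q ^ (1 - c - (m + 1 : ℕ) + -m : ℤ) = q ^ (-c - 2 * m : ℤ) := by
      congr 1; push_cast; ring
    have e2 : q ^ (-c - 2 * m : ℤ) * q ^ (c + 2 * m : ℤ) = 1 := by
      rw [← zpow_add₀ hq]; simp
    rw [e1]
    simp only [smul_mul_assoc, mul_smul_comm, smul_smul, smul_sub]
    match_scalars
    · linear_combination (-(qInt q (m + 1 : ℤ))⁻¹ * (qFact q m)⁻¹ *
        ∏ l ∈ Finset.range m, -q ^ (-c - 2 * l : ℤ)) * e2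
    · rw [mul_inv]; ring

end QuantumNumbers

/-! ### Commutation up to a scalar -/

section QComm

variable {k A : Type*} [Field k] [Ring A] [Algebra k A]

/-- The elements `h` and `x` commute up to the scalar `a`. -/
def QComm (a : k) (h x : A) : Prop := h * x = a • (x * h)

theorem QComm.mul_left {a b : k} {h g x : A} (hh : QComm a h x) (hg : QComm b g x) :
    QComm (a * b) (h * g) x := by
  unfold QComm at *
  rw [mul_assoc, hg, mul_smul_comm, ← mul_assoc, hh, smul_mul_assoc, smul_smul, mul_assoc,
    mul_comm b]

theorem QComm.mul_right {a b : k} {h x y : A} (hx : QComm a h x) (hy : QComm b h y) :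
    QComm (a * b) h (x * y) := by
  unfold QComm at *
  rw [← mul_assoc, hx, smul_mul_assoc, mul_assoc, hy, mul_smul_comm, smul_smul, mul_assoc]

theorem QComm.add_right {a : k} {h x y : A} (hx : QComm a h x) (hy : QComm a h y) :
    QComm a h (x + y) := by
  unfold QComm at *
  rw [mul_add, hx, hy, add_mul, smul_add]

theorem QComm.symm {a : k} {h x : A} (ha : a ≠ 0) (hx : QComm a h x) : QComm a⁻¹ x h := by
  unfold QComm at *
  rw [hx, inv_smul_smul₀ ha]

theorem QComm.smul_left {a : k} {h x : A} (s : k) (hx : QComm a h x) : QComm a (s • h) x := by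
  unfold QComm at *
  rw [smul_mul_assoc, hx, mul_smul_comm, smul_comm]

theorem QComm.of_eq {h x : A} (hx : h * x = x * h) : QComm (1 : k) h x := by
  rw [QComm, one_smul, hx]

theorem QComm.eq {h x : A} (hx : QComm (1 : k) h x) : h * x = x * h := by
  rw [hx, one_smul]

theorem QComm.congr {a b : k} {h x : A} (hx : QComm a h x) (hab : a = b) : QComm b h x :=
  hab ▸ hx

end QComm

/-! ### The scalars in the Serre relations -/

section CartanDatum

variable {k : Type*} [Field k] {I : Type*} [Fintype I] [DecidableEq I] {D : CartanDatum I}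
  {q : I → k}

/-- Generic scalars `q i` compatible with the Cartan matrix, like `q_i = q ^ ε_i`. -/
structure CartanDatum.IsParam (D : CartanDatum I) (q : I → k) : Prop where
  generic : ∀ i, QGeneric (q i)
  symm : ∀ i j, q i ^ D.c i j = q j ^ D.c j i

theorem CartanDatum.IsParam.ne_zero (hq : D.IsParam q) (i : I) : q i ≠ 0 :=
  (hq.generic i).ne_zero

theorem CartanDatum.exists_c_eq_neg {i j : I} (h : i ≠ j) : ∃ N : ℕ, D.c i j = -N :=
  ⟨(-D.c i j).toNat, by have := D.off_diag i j h; omega⟩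

theorem CartanDatum.zpow_diag (D : CartanDatum I) (q : I → k) (i : I) :
    q i ^ D.c i i = q i ^ 2 := by
  rw [D.diag]; norm_cast

/-- The exponents `q_i ^ (c_ij + 2 l)` of the iterated commutators in the Serre relations. -/
def CartanDatum.serreExp (D : CartanDatum I) (q : I → k) (i j : I) (l : ℕ) : k :=
  q i ^ D.c i j * (q i ^ 2) ^ l

namespace CartanDatum.IsParam

/-- The identity p²Q^N = 1 that makes unwanted terms in the Serre relations for the B_i vanish. -/
theorem sq_mul_pow (hq : D.IsParam q) {N : ℕ} {i j : I} (h : D.c i j = -N) :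
    (q i ^ D.c i j) ^ 2 * (q i ^ 2) ^ N = 1 := by
  have := hq.ne_zero i
  rw [h, ← pow_mul, ← zpow_natCast, ← zpow_natCast (q i), ← zpow_mul, ← zpow_add₀ this]
  convert zpow_zero _
  push_cast
  ring

theorem serreExp_eq (hq : D.IsParam q) (i j : I) (l : ℕ) :
    D.serreExp q i j l = q i ^ (D.c i j + 2 * l) := by
  rw [CartanDatum.serreExp, ← pow_mul, zpow_add₀ (hq.ne_zero i)]
  norm_cast

theorem serreExp_ne_zero (hq : D.IsParam q) (i j : I) (l : ℕ) : D.serreExp q i j l ≠ 0 := by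
  rw [hq.serreExp_eq]
  exact zpow_ne_zero _ (hq.ne_zero i)

/-- The exponents c + 2l, 0 ≤ l ≤ N = -c, run symmetrically from -N to N. This symmetry underlies
both the exchange of F-parts with E-parts and the passage to the opposite algebra. -/
theorem serreExp_reverse (hq : D.IsParam q) {i j : I} {N : ℕ} (h : D.c i j = -N) {l : ℕ}
    (hl : l ≤ N) : D.serreExp q i j (N - l) = (D.serreExp q i j l)⁻¹ := by
  rw [hq.serreExp_eq, hq.serreExp_eq, ← zpow_neg, h]
  congr 1
  push_cast [hl]
  ring

theorem prod_serreExp (hq : D.IsParam q) {i j : I} {N : ℕ} (h : D.c i j = -N) :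
    ∏ l ∈ Finset.range (N + 1), D.serreExp q i j l = 1 := by
  simp only [CartanDatum.serreExp]
  rw [Finset.prod_mul_distrib, Finset.prod_const, Finset.card_range, Finset.prod_pow_eq_pow_sum]
  have hs := Finset.sum_range_id_mul_two (N + 1)
  rw [← pow_mul, mul_comm 2, hs, Nat.add_sub_cancel, h, mul_comm (N + 1) N, pow_mul, ← mul_pow,
    zpow_neg, zpow_natCast, inv_mul_cancel₀ (pow_ne_zero _ (hq.ne_zero i)), one_pow]

/-- The reflection l ↦ N - l exchanges the two sums. The expression is the coefficient of K in the
commutator of E_i with the Serre element. -/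
theorem sum_serreExp (hq : D.IsParam q) {i j : I} {N : ℕ} (h : D.c i j = -N) :
    ∑ l ∈ Finset.range (N + 1), ((D.serreExp q i j l)⁻¹ - D.serreExp q i j l) = 0 := by
  rw [Finset.sum_sub_distrib, sub_eq_zero, ← Finset.sum_range_reflect]
  refine Finset.sum_congr rfl fun l hl => ?_
  rw [Finset.mem_range] at hl
  rw [Nat.add_sub_cancel, hq.serreExp_reverse h (by omega), inv_inv]

/-- Inverting the scalars reverses their list, and the order of the commutators is immaterial. -/
theorem qAdIter_serreExp_inv (hq : D.IsParam q) {i j : I} {N : ℕ} (hN : D.c i j = -N)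
    {A : Type*} [Ring A] [Algebra k A] (b x : A) :
    qAdIter b (fun l => (D.serreExp q i j l)⁻¹) (N + 1) x =
      qAdIter b (D.serreExp q i j) (N + 1) x := by
  rw [← qAdIter_reverse b (D.serreExp q i j)]
  refine qAdIter_congr _ _ (fun l hl => ?_) _
  rw [Nat.add_sub_cancel, hq.serreExp_reverse hN (by omega)]

/-- The quantum Serre sum as a multiple of an iterated commutator. -/
theorem qSerre_one (hq : D.IsParam q) {i j : I} {N : ℕ} (h : D.c i j = -N) {A : Type*} [Ring A]
    [Algebra k A] (b x : A) :
    qSerre (q i) b x 1 (N + 1) = ((-1) ^ (N + 1) / qFact (q i) (N + 1)) •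
      qAdIter b (D.serreExp q i j) (N + 1) x := by
  have key := qSerre_eq_qAdIter (hq.generic i) b x (D.c i j) (N + 1)
  have h0 : (1 : ℤ) - D.c i j - (N + 1 : ℕ) = 0 := by rw [h]; push_cast; ring
  rw [h0, zpow_zero] at key
  have hprod : ∏ l ∈ Finset.range (N + 1), -q i ^ (-D.c i j - 2 * l : ℤ) = (-1) ^ (N + 1) := by
    have : ∀ l ∈ Finset.range (N + 1), -q i ^ (-D.c i j - 2 * l : ℤ) =
        -1 * (D.serreExp q i j l)⁻¹ := by
      intro l _
      rw [hq.serreExp_eq, ← zpow_neg, neg_one_mul]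
      congr 2
      ring
    rw [Finset.prod_congr rfl this, Finset.prod_mul_distrib, Finset.prod_const,
      Finset.card_range, Finset.prod_inv_distrib, hq.prod_serreExp h, inv_one, mul_one]
  rw [hprod, inv_mul_eq_div] at key
  have hexp : D.serreExp q i j = fun l : ℕ => q i ^ (D.c i j + 2 * l : ℤ) :=
    funext fun l => hq.serreExp_eq i j l
  rw [key, hexp]

theorem qSerre_one_eq_zero_iff (hq : D.IsParam q) {i j : I} {N : ℕ} (h : D.c i j = -N)
    {A : Type*} [Ring A] [Algebra k A] (b x : A) :
    qSerre (q i) b x 1 (N + 1) = 0 ↔ qAdIter b (D.serreExp q i j) (N + 1) x = 0 := by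
  rw [hq.qSerre_one h, smul_eq_zero_iff_right]
  exact div_ne_zero (pow_ne_zero _ (by simp)) ((hq.generic i).qFact_ne_zero _)

end CartanDatum.IsParam

end CartanDatum

/-! ### Relations of the Drinfeld double in commutator form -/

section DoubleRelations

variable {k : Type*} [Field k] {I : Type*} [Fintype I] [DecidableEq I] {D : CartanDatum I}
  {q : I → k} {A : Type*} [Ring A] [Algebra k A]

/-- The relations of the Drinfeld double other than the Serre relations and those among the
Cartan elements. -/
structure PreDouble (D : CartanDatum I) (q : I → k) (E F K K' : I → A) : Prop where
  K_E : ∀ i j, QComm (q i ^ D.c i j) (K i) (E j)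
  K_F : ∀ i j, QComm (q i ^ D.c i j)⁻¹ (K i) (F j)
  K'_E : ∀ i j, QComm (q i ^ D.c i j)⁻¹ (K' i) (E j)
  K'_F : ∀ i j, QComm (q i ^ D.c i j) (K' i) (F j)
  E_F_same : ∀ i, E i * F i = F i * E i + (q i - (q i)⁻¹)⁻¹ • (K i - K' i)
  E_F_ne : ∀ i j, i ≠ j → E i * F j = F j * E i

/-- The symmetry E ↔ F, K ↔ K', by which statements on Serre elements in the F_i also serve for the
E_i. -/
theorem PreDouble.swap {E F K K' : I → A} (h : PreDouble D q E F K K') :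
    PreDouble D q F E K' K where
  K_E := h.K'_F
  K_F := h.K'_E
  K'_E := h.K_F
  K'_F := h.K_E
  E_F_same i := by rw [h.E_F_same]; module
  E_F_ne i j hij := (h.E_F_ne j i hij.symm).symm

/-- The quantum Serre elements in the `F i` commute with all `E l`. -/
theorem PreDouble.E_mul_serre {E F K K' : I → A} (h : PreDouble D q E F K K') (hq : D.IsParam q)
    {i j : I} (hij : i ≠ j) {N : ℕ} (hN : D.c i j = -N) (l : I) :
    E l * qAdIter (F i) (D.serreExp q i j) (N + 1) (F j) =
      qAdIter (F i) (D.serreExp q i j) (N + 1) (F j) * E l := by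
  have hqi := hq.ne_zero i
  by_cases hli : l = i
  · subst hli
    have := mul_qAdIter_of_rankOne (p := q l ^ D.c l j) (Q := q l ^ 2)
      (zpow_ne_zero _ hqi) (pow_ne_zero _ hqi) (h.E_F_same l)
      ((h.K_F l l).congr (by rw [D.zpow_diag])) ((h.K'_F l l).congr (by rw [D.zpow_diag]))
      (h.E_F_ne l j hij) (h.K_F l j) (h.K'_F l j) N
    have hs := hq.sum_serreExp hN
    simp only [CartanDatum.serreExp] at hs
    rw [hs, mul_zero, zero_smul, add_zero] at this
    exact this
  -- E_l commutes with F_i, so it passes through the iteration and acts on F_j only.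
  · rw [← sub_eq_zero, mul_qAdIter_sub (h.E_F_ne l i hli)]
    by_cases hlj : l = j
    · subst hlj
      rw [h.E_F_same, add_sub_cancel_left, qAdIter_smul, qAdIter_sub]
      have hp := zpow_ne_zero (D.c i l) hqi
      -- K_l is annihilated by the commutator with the first scalar; K'_l, below, by the one with
      -- the last, which is the inverse of the first.
      have e0 : qAdIter (F i) (D.serreExp q i l) (N + 1) (K l) = 0 := by
        apply qAdIter_eq_zero_of_first
        rw [h.K_F, hq.serreExp_eq, ← hq.symm i l, smul_smul]
        simp [mul_inv_cancel₀ hp]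
      have e1 : qAdIter (F i) (D.serreExp q i l) (N + 1) (K' l) = 0 := by
        apply qAdIter_eq_zero_of_last
        have := hq.serreExp_reverse hN (Nat.zero_le N)
        rw [Nat.sub_zero] at this
        rw [h.K'_F, this, hq.serreExp_eq, ← hq.symm i l, smul_smul]
        simp [inv_mul_cancel₀ hp]
      rw [e0, e1, sub_zero, smul_zero]
    · rw [h.E_F_ne l j hlj, sub_self, qAdIter_map_zero]

/-- The defining relations of the Drinfeld double, with the Serre relations in terms of iterated
commutators. -/
structure DoubleRelations (D : CartanDatum I) (q : I → k) (E F K K' : I → A) : Prop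
    extends PreDouble D q E F K K' where
  K_K : ∀ i j, QComm (1 : k) (K i) (K j)
  K_K' : ∀ i j, QComm (1 : k) (K i) (K' j)
  K'_K' : ∀ i j, QComm (1 : k) (K' i) (K' j)
  serre_E : ∀ i j, i ≠ j → ∀ N : ℕ, D.c i j = -N →
    qAdIter (E i) (D.serreExp q i j) (N + 1) (E j) = 0
  serre_F : ∀ i j, i ≠ j → ∀ N : ℕ, D.c i j = -N →
    qAdIter (F i) (D.serreExp q i j) (N + 1) (F j) = 0

end DoubleRelations

/-! ### The presented algebra satisfies these relations -/

section Double

variable (𝕂 : Type*) [Field 𝕂] {I : Type*} [Fintype I] [DecidableEq I] (D : CartanDatum I)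

theorem CartanDatum.isParam_qi : D.IsParam (D.qi 𝕂) where
  generic i :=
    { ne_zero := pow_ne_zero _ RatFunc.X_ne_zero
      pow_ne_one := fun n hn h => by
        rw [CartanDatum.qi, ← pow_mul, ← RatFunc.algebraMap_X, ← map_pow,
          ← map_one (algebraMap (Polynomial 𝕂) (RatFunc 𝕂))] at h
        -- The power q_i^n = X^{ε_i n} has positive degree, unlike 1.
        have h' := congrArg Polynomial.natDegree (RatFunc.algebraMap_injective 𝕂 h)
        rw [Polynomial.natDegree_X_pow, Polynomial.natDegree_one] at h'
        have := Nat.mul_pos (D.ε_pos i) hn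
        omega }
  symm i j := by
    have h := congrFun (congrFun D.symm j) i
    simp only [Matrix.transpose_apply, Matrix.diagonal_mul] at h
    simp only [CartanDatum.qi, ← zpow_natCast, ← zpow_mul]
    rw [h]

theorem serreElt_eq_qSerre {A : Type*} [Ring A] [Algebra (RatFunc 𝕂) A] (x : I → A) {i j : I}
    {N : ℕ} (h : D.c i j = -N) :
    serreElt 𝕂 D x i j = qSerre (D.qi 𝕂 i) (x i) (x j) 1 (N + 1) := by
  rw [serreElt, qSerre, show (1 - D.c i j).toNat = N + 1 by omega]

theorem map_serreElt {A A' : Type*} [Ring A] [Algebra (RatFunc 𝕂) A] [Ring A']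
    [Algebra (RatFunc 𝕂) A'] (φ : A →ₐ[RatFunc 𝕂] A') (x : I → A) (i j : I) :
    φ (serreElt 𝕂 D x i j) = serreElt 𝕂 D (fun l => φ (x l)) i j := by
  simp only [serreElt, map_sum, map_smul, map_mul, map_divPow]

theorem serreElt_eq_zero_iff {A : Type*} [Ring A] [Algebra (RatFunc 𝕂) A] (x : I → A) {i j : I}
    {N : ℕ} (h : D.c i j = -N) : serreElt 𝕂 D x i j = 0 ↔
      qAdIter (x i) (D.serreExp (D.qi 𝕂) i j) (N + 1) (x j) = 0 := by
  rw [serreElt_eq_qSerre 𝕂 D x h, (D.isParam_qi 𝕂).qSerre_one_eq_zero_iff h]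

theorem QDouble.preDouble : PreDouble D (D.qi 𝕂) (QDouble.E 𝕂 D) (QDouble.F 𝕂 D) (QDouble.K 𝕂 D)
    (QDouble.K' 𝕂 D) where
  K_E i j := by
    have := RingQuot.mkAlgHom_rel (RatFunc 𝕂) (DoubleRel.K_E (𝕂 := 𝕂) (D := D) i j)
    simp only [map_mul, map_smul] at this
    exact this
  K_F i j := by
    have := RingQuot.mkAlgHom_rel (RatFunc 𝕂) (DoubleRel.K_F (𝕂 := 𝕂) (D := D) i j)
    simp only [map_mul, map_smul] at this
    rw [← zpow_neg]
    exact this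
  K'_E i j := by
    have := RingQuot.mkAlgHom_rel (RatFunc 𝕂) (DoubleRel.K'_E (𝕂 := 𝕂) (D := D) i j)
    simp only [map_mul, map_smul] at this
    rw [← zpow_neg]
    exact this
  K'_F i j := by
    have := RingQuot.mkAlgHom_rel (RatFunc 𝕂) (DoubleRel.K'_F (𝕂 := 𝕂) (D := D) i j)
    simp only [map_mul, map_smul] at this
    exact this
  E_F_same i := by
    have := RingQuot.mkAlgHom_rel (RatFunc 𝕂) (DoubleRel.E_F_same (𝕂 := 𝕂) (D := D) i)
    simp only [map_sub, map_mul, map_smul] at this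
    rw [← sub_eq_iff_eq_add']
    exact this
  E_F_ne i j hij := by
    have := RingQuot.mkAlgHom_rel (RatFunc 𝕂) (DoubleRel.E_F_ne (𝕂 := 𝕂) (D := D) i j hij)
    simp only [map_sub, map_mul, map_zero] at this
    exact sub_eq_zero.mp this

theorem QDouble.doubleRelations : DoubleRelations D (D.qi 𝕂) (QDouble.E 𝕂 D) (QDouble.F 𝕂 D)
    (QDouble.K 𝕂 D) (QDouble.K' 𝕂 D) where
  toPreDouble := QDouble.preDouble 𝕂 D
  K_K i j := by
    have := RingQuot.mkAlgHom_rel (RatFunc 𝕂) (DoubleRel.K_K (𝕂 := 𝕂) (D := D) i j)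
    simp only [map_mul] at this
    exact .of_eq this
  K_K' i j := by
    have := RingQuot.mkAlgHom_rel (RatFunc 𝕂) (DoubleRel.K_K' (𝕂 := 𝕂) (D := D) i j)
    simp only [map_mul] at this
    exact .of_eq this
  K'_K' i j := by
    have := RingQuot.mkAlgHom_rel (RatFunc 𝕂) (DoubleRel.K'_K' (𝕂 := 𝕂) (D := D) i j)
    simp only [map_mul] at this
    exact .of_eq this
  serre_E i j hij N hN := by
    have := RingQuot.mkAlgHom_rel (RatFunc 𝕂) (DoubleRel.serre_E (𝕂 := 𝕂) (D := D) i j hij)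
    rw [map_serreElt, map_zero] at this
    exact (serreElt_eq_zero_iff 𝕂 D _ hN).mp this
  serre_F i j hij N hN := by
    have := RingQuot.mkAlgHom_rel (RatFunc 𝕂) (DoubleRel.serre_F (𝕂 := 𝕂) (D := D) i j hij)
    rw [map_serreElt, map_zero] at this
    exact (serreElt_eq_zero_iff 𝕂 D _ hN).mp this

end Double

/-! ### Serre-type relations among the B_i -/

section Relations

variable {k : Type*} [Field k] {I : Type*} [Fintype I] [DecidableEq I] {D : CartanDatum I}
  {q : I → k} {A : Type*} [Ring A] [Algebra k A] {E F K K' : I → A}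

theorem CartanDatum.serreExp_inv (D : CartanDatum I) (q : I → k) (i j : I) :
    (fun l => (D.serreExp q i j l)⁻¹) = fun l => (q i ^ D.c i j)⁻¹ * ((q i ^ 2)⁻¹) ^ l := by
  ext l
  rw [CartanDatum.serreExp, mul_inv, inv_pow]

namespace DiagramInvolution

variable (T : DiagramInvolution D)

/-- Generic scalars compatible with the Cartan matrix and the involution. -/
structure IsParam (T : DiagramInvolution D) (q : I → k) : Prop extends D.IsParam q where
  map : ∀ i, q (T.τ i) = q i

/-- The elements `F_i + E_{τ i} K'_i`. -/
def iB (E F K' : I → A) (i : I) : A := F i + E (T.τ i) * K' i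

/-- The elements `K_i K'_{τ i}`. -/
def ik (K K' : I → A) (i : I) : A := K i * K' (T.τ i)

theorem c_map_left (i j : I) : D.c (T.τ i) j = D.c i (T.τ j) := by
  rw [← T.c_map, T.invol]

theorem serreExp_map (hq : T.IsParam q) (i j : I) :
    D.serreExp q (T.τ i) (T.τ j) = D.serreExp q i j := by
  ext l
  simp only [CartanDatum.serreExp, hq.map, T.c_map]

/-- The scalar by which `k_i` and `B_j` commute. -/
def kWeight (q : I → k) (i j : I) : k := (q i ^ D.c i j)⁻¹ * q i ^ D.c i (T.τ j)

theorem ik_iB (h : DoubleRelations D q E F K K') (hq : T.IsParam q) (i j : I) :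
    QComm (T.kWeight q i j) (T.ik K K' i) (T.iB E F K' j) := by
  refine QComm.add_right ?_ ?_
  · refine ((h.K_F i j).mul_left (h.K'_F (T.τ i) j)).congr ?_
    rw [hq.map, T.c_map_left, kWeight]
  · refine (((h.K_E i (T.τ j)).mul_left (h.K'_E (T.τ i) (T.τ j))).mul_right
      ((h.K_K' i j).mul_left (h.K'_K' (T.τ i) j))).congr ?_
    rw [hq.map, T.c_map, kWeight]
    ring

theorem ik_ik (h : DoubleRelations D q E F K K') (i j : I) :
    T.ik K K' i * T.ik K K' j = T.ik K K' j * T.ik K K' i :=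
  QComm.eq (k := k) <| ((((h.K_K i j).mul_left
    (((h.K_K' j (T.τ i)).symm one_ne_zero).congr inv_one)).mul_right
    ((h.K_K' i (T.τ j)).mul_left (h.K'_K' (T.τ i) (T.τ j))))).congr (by ring)

theorem kWeight_map (hq : T.IsParam q) (i j : I) :
    T.kWeight q (T.τ i) j = (T.kWeight q i j)⁻¹ := by
  rw [kWeight, kWeight, hq.map, T.c_map, T.c_map_left, mul_inv, inv_inv, mul_comm]

theorem kWeight_ne_zero (hq : T.IsParam q) (i j : I) : T.kWeight q i j ≠ 0 :=
  mul_ne_zero (inv_ne_zero (zpow_ne_zero _ (hq.ne_zero i))) (zpow_ne_zero _ (hq.ne_zero i))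

theorem kWeight_of_fixed (hq : T.IsParam q) {i : I} (h : T.τ i = i) (j : I) :
    T.kWeight q i j = 1 := by
  rw [kWeight, ← T.c_map_left, h, inv_mul_cancel₀ (zpow_ne_zero _ (hq.ne_zero i))]

/-- The factors K' q-commute with the E's, so `qAdIter_twist` moves them to the right and leaves the
Serre element in E_{τi} and E_{τj}. -/
theorem serre_EK' (h : DoubleRelations D q E F K K') (hq : T.IsParam q) {i j : I} (hij : i ≠ j)
    {N : ℕ} (hN : D.c i j = -N) :
    qAdIter (E (T.τ i) * K' i) (D.serreExp q i j) (N + 1) (E (T.τ j) * K' j) = 0 := by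
  have h0 : qAdIter (E (T.τ i)) (D.serreExp q i j) (N + 1) (E (T.τ j)) = 0 := by
    rw [← T.serreExp_map hq]
    exact h.serre_E _ _ (T.τ.injective.ne hij) _ (by rw [T.c_map, hN])
  have h' : QComm (q i ^ D.c i (T.τ j))⁻¹ (K' j) (E (T.τ i)) := by
    refine (h.K'_E j (T.τ i)).congr ?_
    rw [← T.c_map_left, ← hq.map j, hq.symm (T.τ j) i]
  rw [qAdIter_twist (h.K'_E i (T.τ i)) (h.K'_E i (T.τ j)) h' (h.K'_K' i j).eq, h0, zero_mul,
    smul_zero]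

/-- Commutation of `E_{τ i} K'_i` and `F_j` for `j ≠ τ i`. -/
theorem EK'_F (h : DoubleRelations D q E F K K') {i j : I} (hij : T.τ i ≠ j) :
    QComm (q i ^ D.c i j) (E (T.τ i) * K' i) (F j) :=
  ((QComm.of_eq (h.E_F_ne _ _ hij)).mul_left (h.K'_F i j)).congr (one_mul _)

/-- Here F_i and E_{τi}K'_i q-commute with both summands of B_j without errors κ or Z, except each
with its own partner of the same type. The iterated commutator therefore reduces to the pure F and
pure E Serre elements, both zero. -/
theorem serreRelation_of_ne (h : DoubleRelations D q E F K K') (hq : T.IsParam q)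
    {i j : I} (hij : i ≠ j) (hi : T.τ i ≠ i) (hj : T.τ i ≠ j) {N : ℕ}
    (hN : D.c i j = -N) :
    qAdIter (T.iB E F K' i) (D.serreExp q i j) (N + 1) (T.iB E F K' j) = 0 := by
  have hqi := hq.ne_zero i
  have hp := zpow_ne_zero (D.c i j) hqi
  have hYX := (T.EK'_F h hi).congr (D.zpow_diag q i)
  have hYf := T.EK'_F h hj
  have hj' : T.τ j ≠ i := fun h' => hj (by rw [← h', T.invol])
  have hXg : QComm (q i ^ D.c i j)⁻¹ (F i) (E (T.τ j) * K' j) :=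
    (((T.EK'_F h hj').congr (hq.symm j i)).symm hp)
  have e1 := qAdIter_add_of_qCommute (κ := 0) (Z := 0) (p := q i ^ D.c i j) hYX
    (hYf.trans (by simp)) (by simp) (by simp) (by simp) (by simp) N
  have e2 := qAdIter_add_of_qCommute (κ := 0) (Z := 0)
    (p := (q i ^ D.c i j)⁻¹) (hYX.symm (pow_ne_zero _ hqi))
    (hXg.trans (by simp)) (by simp) (by simp) (by simp) (by simp) N
  simp only [mul_zero, smul_zero, add_zero] at e1 e2
  rw [← D.serreExp_inv, hq.qAdIter_serreExp_inv hN, hq.qAdIter_serreExp_inv hN, T.serre_EK' h hq hij hN,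
    add_comm (_ * _)] at e2
  rw [iB, iB, qAdIter_add, e2, add_zero]
  exact e1.trans (h.serre_F _ _ hij _ hN)

/-- The relation between `B_i` and `B_{τ i}` for `τ i ≠ i`. -/
theorem serreRelation_tau (h : DoubleRelations D q E F K K') (hq : T.IsParam q)
    {i : I} (hi : T.τ i ≠ i) {N : ℕ} (hN : D.c i (T.τ i) = -N) :
    qAdIter (T.iB E F K' i) (D.serreExp q i (T.τ i)) (N + 1) (T.iB E F K' (T.τ i)) =
      (q i - (q i)⁻¹)⁻¹ •
      ((q i ^ D.c i (T.τ i) * ∏ l ∈ Finset.range N, (1 - (q i ^ 2) ^ (l + 2))) •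
          (T.iB E F K' i ^ N * T.ik K K' (T.τ i)) -
        (∏ l ∈ Finset.range N, (1 - ((q i ^ 2)⁻¹) ^ (l + 2))) •
          (T.iB E F K' i ^ N * T.ik K K' i)) := by
  have hqi := hq.ne_zero i
  have hpQ := hq.sq_mul_pow hN
  have hYX := (T.EK'_F h hi).congr (D.zpow_diag q i)
  have hsF := h.serre_F _ _ hi.symm _ hN
  have hsE := T.serre_EK' h hq hi.symm hN
  have hexp := D.serreExp_inv q i (T.τ i)
  have hinv := fun b x : A => hq.qAdIter_serreExp_inv hN b x
  obtain ⟨j, hj⟩ : ∃ j, T.τ i = j := ⟨_, rfl⟩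
  have hji : T.τ j = i := by rw [← hj, T.invol]
  have hqj : q j = q i := by rw [← hj, hq.map]
  have hcj : D.c j i = D.c i j := by rw [← hj, T.c_map_left]
  have hserre : D.serreExp q i j = fun l => q i ^ D.c i j * (q i ^ 2) ^ l := rfl
  rw [hj] at hi hN hpQ hYX hsF hsE hexp hinv ⊢
  rw [hji] at hsE
  have hEFj := h.E_F_same j
  have hEFi := h.E_F_same i
  rw [hqj] at hEFj
  have hp := zpow_ne_zero (D.c i j) hqi
  have hQ : q i ^ 2 ≠ 0 := pow_ne_zero 2 hqi
  have K'jFi : QComm (q i ^ D.c i j) (K' j) (F i) :=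
    (h.K'_F j i).congr (by rw [hqj, hcj])
  have K'iFi : QComm (q i ^ 2) (K' i) (F i) := (h.K'_F i i).congr (D.zpow_diag q i)
  have K'jEj : QComm (q i ^ 2)⁻¹ (K' j) (E j) :=
    (h.K'_E j j).congr (by rw [D.zpow_diag, hqj])
  have hkjF : QComm ((q i ^ D.c i j)⁻¹ * q i ^ 2) (T.ik K K' j) (F i) := by
    rw [ik, hji]
    exact ((h.K_F j i).congr (by rw [hqj, hcj])).mul_left K'iFi
  have hkjY : QComm ((q i ^ D.c i j)⁻¹ * q i ^ 2) (T.ik K K' j)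
      (E j * K' i) := by
    rw [ik, hji]
    refine ((((h.K_E j j).congr (D.zpow_diag q j)).mul_left (h.K'_E i j)).mul_right
      ((h.K_K' j i).mul_left (h.K'_K' i i))).congr ?_
    rw [hqj]
    ring
  have hkiF : QComm ((q i ^ 2)⁻¹ * q i ^ D.c i j) (T.ik K K' i) (F i) := by
    rw [ik, hj]
    exact ((h.K_F i i).congr (by rw [D.zpow_diag])).mul_left K'jFi
  have hkiY : QComm ((q i ^ 2)⁻¹ * q i ^ D.c i j) (T.ik K K' i)
      (E j * K' i) := by
    rw [ik, hj]
    refine (((h.K_E i j).mul_left K'jEj).mul_right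
      ((h.K_K' i i).mul_left (h.K'_K' j i))).congr ?_
    ring
  have hZF : QComm (q i ^ D.c i j * q i ^ 2) (K' j * K' i) (F i) :=
    K'jFi.mul_left K'iFi
  have hZY : QComm ((q i ^ D.c i j)⁻¹ * (q i ^ 2)⁻¹) (K' j * K' i)
      (E j * K' i) := by
    refine ((K'jEj.mul_left (h.K'_E i j)).mul_right
      ((h.K'_K' j i).mul_left (h.K'_K' i i))).congr ?_
    ring
  set t := q i with htdef
  set p := t ^ D.c i j with hpdef
  set s := (t - t⁻¹)⁻¹ with hs
  have hYf : E j * K' i * F j = p • (F j * (E j * K' i)) +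
      (p * s) • T.ik K K' j + (-(p * s)) • (K' j * K' i) := by
    have : K' i * F j = p • (F j * K' i) := h.K'_F i j
    rw [mul_assoc, this, mul_smul_comm, ← mul_assoc, hEFj, add_mul, smul_mul_assoc, sub_mul,
      ik, hji, mul_assoc]
    module
  have hXg : F i * (E i * K' j) = p⁻¹ • (E i * K' j * F i) +
      (-s) • T.ik K K' i + s • (K' j * K' i) := by
    have h1 : K' j * F i = p • (F i * K' j) := K'jFi
    rw [mul_assoc (E i), h1, mul_smul_comm, smul_smul, inv_mul_cancel₀ hp, one_smul,
      ← mul_assoc (E i), hEFi, add_mul, smul_mul_assoc, sub_mul, ik, hj,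
      (h.K'_K' j i).eq, mul_assoc]
    module
  -- The summand F_j of B_j, with X = F_i and Y = E_jK'_i (here j = τ i); κ is a multiple of k_j.
  have e1 := qAdIter_add_of_qCommute hYX hYf (hZF.smul_left _)
    (by
      refine ((hZY.smul_left _).symm (mul_ne_zero (inv_ne_zero hp) (inv_ne_zero hQ))).congr ?_
      rw [mul_inv, inv_inv, inv_inv])
    (by
      rw [hkjF.smul_left (p * s), smul_smul, ← mul_assoc, mul_inv_cancel₀ hp, one_mul])
    (by
      rw [hkjY.smul_left (p * s), smul_smul, ← mul_assoc, mul_inv_cancel₀ hp, one_mul]) N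
  -- The summand E_iK'_j, with the roles of F_i and E_jK'_i exchanged. This inverts p and Q, and
  -- inverting the list of scalars is harmless. Now κ is a multiple of k_i.
  have e2 := qAdIter_add_of_qCommute (hYX.symm hQ) hXg (hZY.smul_left _)
    (by
      refine ((hZF.smul_left _).symm (mul_ne_zero hp hQ)).congr ?_
      rw [mul_inv])
    (by
      rw [hkiY.smul_left (-s), smul_smul]
      congr 1
      field_simp)
    (by
      rw [hkiF.smul_left (-s), smul_smul]
      congr 1
      field_simp) N
  have hB : T.iB E F K' i = F i + E j * K' i := by rw [iB, hj]
  have hBj : T.iB E F K' j = F j + E i * K' j := by rw [iB, hji]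
  rw [← hserre, hsF, zero_add, ← hB] at e1
  rw [← hexp, hinv, hinv, hsE, zero_add, add_comm (E j * _), ← hB] at e2
  rw [hBj, qAdIter_add, e1, e2]
  -- For N = 0 the product is empty, p = 1, and the Z-terms of `e1` and `e2` cancel each other. For
  -- N > 0 each vanishes on its own, by the factor with p²Q^N = 1.
  rcases Nat.eq_zero_or_pos N with rfl | hNpos
  · have hp1 : p = 1 := by rw [hpdef, hN]; simp
    simp only [zero_add, Finset.sum_range_one, Finset.prod_range_zero, pow_zero, one_mul, one_smul,
      hp1, mul_one]
    module
  · obtain ⟨M, rfl⟩ : ∃ M, N = M + 1 := ⟨N - 1, by omega⟩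
    have z1 : ∏ l ∈ Finset.range (M + 1), (1 - p ^ 2 * (t ^ 2) ^ (l + 1)) = 0 := by
      rw [Finset.prod_range_succ, hpQ, sub_self, mul_zero]
    have z2 : ∏ l ∈ Finset.range (M + 1), (1 - p⁻¹ ^ 2 * ((t ^ 2)⁻¹) ^ (l + 1)) = 0 := by
      rw [Finset.prod_range_succ, inv_pow, inv_pow, ← mul_inv, hpQ, inv_one, sub_self, mul_zero]
    rw [z1, z2]
    simp only [mul_zero, zero_smul, zero_add, mul_smul_comm]
    module

/-- The coefficients of the lower order terms in the relation between `B_i` and `B_j` for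
`τ i = i`. -/
def _root_.CartanDatum.diagCoeff (D : CartanDatum I) (q : I → k) (i j : I) (l : ℕ) : k :=
  (∑ m ∈ Finset.range l, (q i ^ 2) ^ m) *
    (1 - (q i ^ D.c i j) ^ 2 * (q i ^ 2) ^ (l - 1)) *
    (q i ^ 2 * (q i - (q i)⁻¹)⁻¹)

theorem geom_sum_inv' {k : Type*} [Field k] {Q : k} (hQ : Q ≠ 0) (l : ℕ) :
    ∑ m ∈ Finset.range (l + 1), Q⁻¹ ^ m = (Q ^ l)⁻¹ * ∑ m ∈ Finset.range (l + 1), Q ^ m := by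
  rw [← Finset.sum_range_reflect, Finset.mul_sum]
  refine Finset.sum_congr rfl fun m hm => ?_
  rw [Finset.mem_range] at hm
  obtain ⟨r, rfl⟩ : ∃ r, l = m + r := ⟨l - m, by omega⟩
  rw [show m + r + 1 - 1 - m = r by omega, pow_add, inv_pow]
  field_simp

/-- The rescaling caused by inverting the scalars of a continuant turns these coefficients into the
ones that arise when F_i and E_iK'_i change roles: p and Q inverted, and the factor q_i²/(q_i -
q_i⁻¹) of k_i replaced by -1/(q_i - q_i⁻¹). -/
theorem diagCoeff_mul_inv (hq : D.IsParam q) (i j : I) {l : ℕ} (hl : 1 ≤ l) :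
    D.diagCoeff q i j l * (D.serreExp q i j l * D.serreExp q i j (l - 1))⁻¹ =
      (∑ m ∈ Finset.range l, (q i ^ 2)⁻¹ ^ m) *
        (1 - (q i ^ D.c i j)⁻¹ ^ 2 * (q i ^ 2)⁻¹ ^ (l - 1)) *
          -(q i - (q i)⁻¹)⁻¹ := by
  obtain ⟨m, rfl⟩ : ∃ m, l = m + 1 := ⟨l - 1, by omega⟩
  have hqi := hq.ne_zero i
  have hp := zpow_ne_zero (D.c i j) hqi
  have hQ : q i ^ 2 ≠ 0 := pow_ne_zero 2 hqi
  rw [geom_sum_inv' hQ, CartanDatum.diagCoeff, CartanDatum.serreExp, CartanDatum.serreExp, Nat.add_sub_cancel]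
  generalize ∑ l ∈ Finset.range (m + 1), (q i ^ 2) ^ l = S
  generalize q i ^ D.c i j = p at *
  generalize (q i - (q i)⁻¹)⁻¹ = s
  generalize q i ^ 2 = Q at *
  rw [pow_succ, inv_pow, inv_pow]
  field_simp
  ring

/-- With the geometric sums in closed form, p²Q^N = 1 matches the two sides. Hence the tridiagonal
matrix of the relation for τ i = i, read backwards, is the one with inverted scalars. -/
theorem diagCoeff_reverse (hq : D.IsParam q) {i j : I} {N : ℕ} (hN : D.c i j = -N) {l : ℕ} (hl : 1 ≤ l)
    (hlN : l ≤ N) :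
    D.diagCoeff q i j (N + 1 - l) =
      D.diagCoeff q i j l * (D.serreExp q i j l * D.serreExp q i j (l - 1))⁻¹ := by
  have hg := hq.generic i
  have hqi := hq.ne_zero i
  have hp := zpow_ne_zero (D.c i j) hqi
  have hQ : q i ^ 2 ≠ 0 := pow_ne_zero 2 hqi
  have hpQ := hq.sq_mul_pow hN
  obtain ⟨m, rfl⟩ : ∃ m, l = m + 1 := ⟨l - 1, by omega⟩
  obtain ⟨r, rfl⟩ : ∃ r, N = m + 1 + r := ⟨N - (m + 1), by omega⟩
  have h1Q : q i ^ 2 - 1 ≠ 0 := sub_ne_zero.mpr (hg.pow_ne_one 2 two_pos)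
  rw [show m + 1 + r + 1 - (m + 1) = r + 1 by omega, CartanDatum.diagCoeff,
    CartanDatum.diagCoeff, CartanDatum.serreExp, CartanDatum.serreExp, Nat.add_sub_cancel, Nat.add_sub_cancel, geom_sum_eq (sub_ne_zero.mp h1Q),
    geom_sum_eq (sub_ne_zero.mp h1Q)]
  generalize q i ^ D.c i j = p at *
  generalize (q i - (q i)⁻¹)⁻¹ = s
  generalize q i ^ 2 = Q at *
  have hp2 : p ^ 2 = (Q ^ m * Q * Q ^ r)⁻¹ := by
    apply eq_inv_of_mul_eq_one_left
    rw [← hpQ, pow_add Q (m + 1), pow_succ Q]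
  have e : ∀ a b : k, (p * a * (p * b))⁻¹ = (p ^ 2 * (a * b))⁻¹ := fun a b => by ring
  rw [e, hp2]
  simp only [pow_succ]
  field_simp

theorem triIter_serreExp_inv (hq : D.IsParam q) {i j : I} {N : ℕ} (hN : D.c i j = -N) {A : Type*} [Ring A]
    [Algebra k A] {b κ : A} (h : κ * b = b * κ) (x : A) :
    triIter b κ (fun l => (D.serreExp q i j l)⁻¹) (fun l => D.diagCoeff q i j l *
      (D.serreExp q i j l * D.serreExp q i j (l - 1))⁻¹) (N + 1) x =
      triIter b κ (D.serreExp q i j) (D.diagCoeff q i j) (N + 1) x := by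
  rw [← triIter_reverse h (D.serreExp q i j)]
  refine triIter_congr _ _ _ (fun l hl => ?_) (fun l h1 hl => ?_) _
  · rw [Nat.add_sub_cancel, hq.serreExp_reverse hN (by omega)]
  · rw [diagCoeff_reverse hq hN h1 (by omega)]

/-- The relation between `B_i` and `B_j` for `τ i = i`. -/
theorem serreRelation_fixed (h : DoubleRelations D q E F K K') (hq : T.IsParam q)
    {i j : I} (hij : i ≠ j) (hi : T.τ i = i) {N : ℕ}
    (hN : D.c i j = -N) :
    triIter (T.iB E F K' i) (T.ik K K' i) (D.serreExp q i j) (D.diagCoeff q i j) (N + 1)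
      (T.iB E F K' j) = 0 := by
  have hqi := hq.ne_zero i
  have hp := zpow_ne_zero (D.c i j) hqi
  have hQ : q i ^ 2 ≠ 0 := pow_ne_zero 2 hqi
  have hkB := ((T.ik_iB h hq i i).congr (T.kWeight_of_fixed hq hi i)).eq
  have hj' : T.τ j ≠ i := fun h' => hij (by rw [← T.invol j, h', hi])
  have hYf : QComm (q i ^ D.c i j) (E i * K' i) (F j) := by
    have := T.EK'_F h (i := i) (j := j) (by rw [hi]; exact hij)
    rwa [hi] at this
  have hXg : QComm (q i ^ D.c i j)⁻¹ (F i) (E (T.τ j) * K' j) :=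
    (((T.EK'_F h hj').congr (hq.symm j i)).symm hp)
  have hsF := h.serre_F _ _ hij _ hN
  have hsE := T.serre_EK' h hq hij hN
  have hcτ : D.c i (T.τ j) = D.c i j := by rw [← T.c_map_left, hi]
  have hB : T.iB E F K' i = F i + E i * K' i := by rw [iB, hi]
  have hk : T.ik K K' i = K i * K' i := by rw [ik, hi]
  rw [hi] at hsE
  have hEF := h.E_F_same i
  have K'F : QComm (q i ^ 2) (K' i) (F i) := (h.K'_F i i).congr (D.zpow_diag q i)
  have K'E : QComm (q i ^ 2)⁻¹ (K' i) (E i) :=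
    (h.K'_E i i).congr (by rw [D.zpow_diag])
  have KF : QComm (q i ^ 2)⁻¹ (K i) (F i) :=
    (h.K_F i i).congr (by rw [D.zpow_diag])
  have KE : QComm (q i ^ 2) (K i) (E i) := (h.K_E i i).congr (D.zpow_diag q i)
  have K'f := h.K'_F i j
  have Kf := h.K_F i j
  have K'g : QComm (q i ^ D.c i j)⁻¹ (K' i) (E (T.τ j) * K' j) := by
    refine ((h.K'_E i (T.τ j)).mul_right (h.K'_K' i j)).congr ?_
    rw [hcτ, mul_one]
  have Kg : QComm (q i ^ D.c i j) (K i) (E (T.τ j) * K' j) := by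
    refine ((h.K_E i (T.τ j)).mul_right (h.K_K' i j)).congr ?_
    rw [hcτ, mul_one]
  have hserre : D.serreExp q i j = fun l => q i ^ D.c i j * (q i ^ 2) ^ l := rfl
  have hexp := D.serreExp_inv q i j
  have hinv := fun b x : A => hq.qAdIter_serreExp_inv hN b x
  have hrev := fun x => triIter_serreExp_inv hq.toIsParam hN hkB x
  have hdiag : ∀ l, 1 ≤ l → _ := fun l hl => diagCoeff_mul_inv hq.toIsParam i j (l := l) hl
  have hYX : E i * K' i * F i = q i ^ 2 • (F i * (E i * K' i)) +
      (q i ^ 2 * (q i - (q i)⁻¹)⁻¹) • T.ik K K' i -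
      (q i ^ 2 * (q i - (q i)⁻¹)⁻¹) • (K' i * K' i) := by
    have h1 : K' i * F i = q i ^ 2 • (F i * K' i) := K'F
    rw [mul_assoc, h1, mul_smul_comm, ← mul_assoc, hEF, add_mul, smul_mul_assoc, sub_mul, hk,
      mul_assoc]
    module
  have hXY : F i * (E i * K' i) =
      (q i ^ 2)⁻¹ • (E i * K' i * F i) +
      (-(q i - (q i)⁻¹)⁻¹) • T.ik K K' i -
      (-(q i - (q i)⁻¹)⁻¹) • (K' i * K' i) := by
    rw [hYX, smul_sub, smul_add, smul_smul, smul_smul, smul_smul,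
      inv_mul_cancel_left₀ hQ, inv_mul_cancel₀ hQ]
    module
  have hkF : QComm (1 : k) (T.ik K K' i) (F i) := by
    rw [hk]; exact (KF.mul_left K'F).congr (inv_mul_cancel₀ hQ)
  have hkY : QComm (1 : k) (T.ik K K' i) (E i * K' i) := by
    rw [hk]
    refine ((KE.mul_left K'E).mul_right ((h.K_K' i i).mul_left (h.K'_K' i i))).congr ?_
    rw [mul_inv_cancel₀ hQ]; ring
  have hkf : QComm (1 : k) (T.ik K K' i) (F j) := by
    rw [hk]; exact (Kf.mul_left K'f).congr (inv_mul_cancel₀ hp)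
  have hkg : QComm (1 : k) (T.ik K K' i) (E (T.τ j) * K' j) := by
    rw [hk]; exact (Kg.mul_left K'g).congr (mul_inv_cancel₀ hp)
  have e1 := continuant_qAd_add hYX hYf
    (((K'F.mul_left K'F).congr (sq _).symm).smul_left _)
    (((K'f.mul_left K'f).congr (sq _).symm).smul_left _)
    (hkF.smul_left _).eq (hkf.smul_left _).eq (N + 1)
  have K'Y : QComm (q i ^ 2)⁻¹ (K' i) (E i * K' i) :=
    (K'E.mul_right (h.K'_K' i i)).congr (mul_one _)
  -- Exchanging F_i and E_iK'_i inverts p and Q; `hdiag` and `hrev` identify the resulting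
  -- continuant with the one for F_j.
  have e2 := continuant_qAd_add hXY hXg
    (((K'Y.mul_left K'Y).congr (sq _).symm).smul_left _)
    (((K'g.mul_left K'g).congr (sq _).symm).smul_left _)
    (hkY.smul_left _).eq (hkg.smul_left _).eq (N + 1)
  change triIter _ _ _ _ _ _ = _ at e1 e2
  rw [← hserre, hsF, ← hB, triIter_smul] at e1
  rw [← hexp, hinv, hsE, add_comm (E i * _), ← hB, triIter_smul] at e2
  rw [iB.eq_1 T E F K' j, triIter_add]
  have e1' : triIter (T.iB E F K' i) (T.ik K K' i) (D.serreExp q i j) (D.diagCoeff q i j) (N + 1)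
      (F j) = 0 := e1
  rw [e1', zero_add, ← hrev, ← e2]
  exact triIter_congr _ _ _ (fun _ _ => rfl) (fun l hl _ => hdiag l hl) _

end DiagramInvolution

end Relations

/-! ### The same relations for pairs in an algebra and its opposite -/

section OppositeRelations

open MulOpposite

variable {k : Type*} [Field k] {I : Type*} [Fintype I] [DecidableEq I] {D : CartanDatum I}
  {q : I → k} {A : Type*} [Ring A] [Algebra k A] {E F K K' : I → A}

theorem QComm.pow_right {a : k} {h x : A} (hx : QComm a h x) (n : ℕ) :
    QComm (a ^ n) h (x ^ n) := by
  induction n with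
  | zero => simp [QComm]
  | succ n ih => rw [pow_succ, pow_succ]; exact ih.mul_right hx

theorem QComm.op {a : k} {h x : A} (hx : QComm a h x) (ha : a ≠ 0) :
    QComm a⁻¹ (op h) (op x) := by
  unfold QComm at *
  rw [← op_mul, ← op_mul, ← op_smul, hx, inv_smul_smul₀ ha]

theorem CartanDatum.IsParam.prod_neg_serreExp (hq : D.IsParam q) {i j : I} {N : ℕ}
    (h : D.c i j = -N) :
    ∏ l ∈ Finset.range (N + 1), -D.serreExp q i j l = (-1) ^ (N + 1) := by
  rw [Finset.prod_neg, hq.prod_serreExp h, mul_one, Finset.card_range]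

namespace DiagramInvolution

variable (T : DiagramInvolution D)

/-- The pair of `B_i` in an algebra and `B_i` in the opposite algebra. -/
def pairB (E F K' : I → A) (i : I) : A × Aᵐᵒᵖ := (T.iB E F K' i, op (T.iB E F K' i))

/-- The pair of `k_i` in an algebra and `k_{τ i}` in the opposite algebra. -/
def pairK (K K' : I → A) (i : I) : A × Aᵐᵒᵖ := (T.ik K K' i, op (T.ik K K' (T.τ i)))

/-- Passing to the opposite algebra inverts a commutation scalar, and so does replacing k_i by
k_{τi}. This is why the second component must carry k_{τi}. -/
theorem pairK_pairB (h : DoubleRelations D q E F K K') (hq : T.IsParam q) (i j : I) :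
    QComm (T.kWeight q i j) (T.pairK K K' i) (T.pairB E F K' j) := by
  refine Prod.ext (T.ik_iB h hq i j) ?_
  refine ((T.ik_iB h hq (T.τ i) j).op (T.kWeight_ne_zero hq _ _)).congr ?_
  rw [T.kWeight_map hq, inv_inv]

theorem pairK_pairK (h : DoubleRelations D q E F K K') (i j : I) :
    T.pairK K K' i * T.pairK K K' j = T.pairK K K' j * T.pairK K K' i :=
  Prod.ext (T.ik_ik h i j) (congrArg op (T.ik_ik h (T.τ j) (T.τ i)))

theorem fst_qAdIter {A' : Type*} [Ring A'] [Algebra k A'] (b x : A × A') (z : ℕ → k) (n : ℕ) :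
    (qAdIter b z n x).1 = qAdIter b.1 z n x.1 := map_qAdIter (AlgHom.fst k A A') b z n x

theorem snd_qAdIter {A' : Type*} [Ring A'] [Algebra k A'] (b x : A × A') (z : ℕ → k) (n : ℕ) :
    (qAdIter b z n x).2 = qAdIter b.2 z n x.2 := map_qAdIter (AlgHom.snd k A A') b z n x

theorem pair_serreRelation_of_ne (h : DoubleRelations D q E F K K') (hq : T.IsParam q)
    {i j : I} (hij : i ≠ j) (hi : T.τ i ≠ i) (hj : T.τ i ≠ j) {N : ℕ} (hN : D.c i j = -N) :
    qAdIter (T.pairB E F K' i) (D.serreExp q i j) (N + 1) (T.pairB E F K' j) = 0 := by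
  have h0 := T.serreRelation_of_ne h hq hij hi hj hN
  refine Prod.ext ?_ ?_
  · rw [fst_qAdIter]; exact h0
  · rw [snd_qAdIter, pairB, pairB, qAdIter_op _ _ (hq.serreExp_ne_zero i j),
      hq.qAdIter_serreExp_inv hN, h0, smul_zero]
    rfl

theorem pair_serreRelation_fixed (h : DoubleRelations D q E F K K') (hq : T.IsParam q)
    {i j : I} (hij : i ≠ j) (hi : T.τ i = i) {N : ℕ} (hN : D.c i j = -N) :
    triIter (T.pairB E F K' i) (T.pairK K K' i) (D.serreExp q i j) (D.diagCoeff q i j) (N + 1)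
      (T.pairB E F K' j) = 0 := by
  have h0 := T.serreRelation_fixed h hq hij hi hN
  have hb := ((T.ik_iB h hq i i).congr (T.kWeight_of_fixed hq hi i)).eq
  have hx := ((T.ik_iB h hq i j).congr (T.kWeight_of_fixed hq hi j)).eq
  refine Prod.ext ?_ ?_
  · exact (map_triIter (AlgHom.fst k A Aᵐᵒᵖ) _ _ _ _ _ _).trans h0
  · refine (map_triIter (AlgHom.snd k A Aᵐᵒᵖ) _ _ _ _ _ _).trans ?_
    simp only [AlgHom.snd_apply, pairB, pairK, hi]
    rw [triIter_op hb hx (hq.serreExp_ne_zero i j),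
      triIter_serreExp_inv hq.toIsParam hN hb, h0, smul_zero]
    rfl

/-- The symmetry of the coefficients in the relation between `B_i` and `B_{τ i}`. -/
theorem tauCoeff_symm (hq : T.IsParam q) {i : I} {N : ℕ} (hN : D.c i (T.τ i) = -N) :
    (-1) ^ N * ∏ l ∈ Finset.range N, (1 - ((q i ^ 2)⁻¹) ^ (l + 2)) =
      T.kWeight q i i ^ N *
        (q i ^ D.c i (T.τ i) * ∏ l ∈ Finset.range N, (1 - (q i ^ 2) ^ (l + 2))) := by
  have hQ : q i ^ 2 ≠ 0 := pow_ne_zero 2 (hq.ne_zero i)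
  have h1 : ∏ l ∈ Finset.range N, (1 - (q i ^ 2) ^ (l + 2)) =
      (∏ l ∈ Finset.range N, (q i ^ 2) ^ (l + 2)) * ((-1) ^ N *
        ∏ l ∈ Finset.range N, (1 - ((q i ^ 2)⁻¹) ^ (l + 2))) := by
    rw [← Finset.card_range N, ← Finset.prod_const, Finset.card_range, ← Finset.prod_mul_distrib,
      ← Finset.prod_mul_distrib]
    refine Finset.prod_congr rfl fun l _ => ?_
    have := pow_ne_zero (l + 2) hQ
    rw [inv_pow]
    field_simp
    ring
  have hqi := hq.ne_zero i
  have h2 := hq.prod_serreExp hN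
  simp only [CartanDatum.serreExp] at h2
  rw [Finset.prod_range_succ'] at h2
  have h3 : T.kWeight q i i ^ N * q i ^ D.c i (T.τ i) *
      (∏ l ∈ Finset.range N, (q i ^ 2) ^ (l + 2)) = 1 := by
    rw [← h2, kWeight, D.zpow_diag, pow_zero, mul_one]
    nth_rw 1 [← Finset.card_range N]
    rw [← Finset.prod_const, mul_right_comm, ← Finset.prod_mul_distrib]
    congr 1
    refine Finset.prod_congr rfl fun l _ => ?_
    rw [pow_succ _ (l + 1)]
    field_simp
  rw [h1, ← mul_assoc, ← mul_assoc, h3, one_mul]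

theorem pair_serreRelation_tau (h : DoubleRelations D q E F K K') (hq : T.IsParam q)
    {i : I} (hi : T.τ i ≠ i) {N : ℕ} (hN : D.c i (T.τ i) = -N) :
    qAdIter (T.pairB E F K' i) (D.serreExp q i (T.τ i)) (N + 1) (T.pairB E F K' (T.τ i)) =
      (q i - (q i)⁻¹)⁻¹ •
      ((q i ^ D.c i (T.τ i) * ∏ l ∈ Finset.range N, (1 - (q i ^ 2) ^ (l + 2))) •
          (T.pairB E F K' i ^ N * T.pairK K K' (T.τ i)) -
        (∏ l ∈ Finset.range N, (1 - ((q i ^ 2)⁻¹) ^ (l + 2))) •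
          (T.pairB E F K' i ^ N * T.pairK K K' i)) := by
  have h0 := T.serreRelation_tau h hq hi hN
  refine Prod.ext ?_ ?_
  · rw [fst_qAdIter]; exact h0
  · rw [snd_qAdIter, pairB, pairB, qAdIter_op _ _ (hq.serreExp_ne_zero i (T.τ i)),
      hq.qAdIter_serreExp_inv hN, h0, hq.prod_neg_serreExp hN]
    have hw := T.kWeight_ne_zero hq i i
    -- In the opposite algebra the Cartan element ends up to the left of B_i^N. Moving it back costs
    -- a power of `kWeight`, which is balanced by `tauCoeff_symm`.
    have e1 : T.ik K K' i * T.iB E F K' i ^ N =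
        T.kWeight q i i ^ N • (T.iB E F K' i ^ N * T.ik K K' i) := (T.ik_iB h hq i i).pow_right N
    have e2 : T.ik K K' (T.τ i) * T.iB E F K' i ^ N =
        (T.kWeight q i i ^ N)⁻¹ • (T.iB E F K' i ^ N * T.ik K K' (T.τ i)) := by
      rw [← inv_pow, ← T.kWeight_map hq]
      exact (T.ik_iB h hq (T.τ i) i).pow_right N
    have hc := T.tauCoeff_symm hq hN
    set c2 := q i ^ D.c i (T.τ i) * ∏ l ∈ Finset.range N, (1 - (q i ^ 2) ^ (l + 2))
    set c1 := ∏ l ∈ Finset.range N, (1 - ((q i ^ 2)⁻¹) ^ (l + 2))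
    set s := (q i - (q i)⁻¹)⁻¹
    set w := T.kWeight q i i ^ N
    have hw : w ≠ 0 := pow_ne_zero N hw
    have hpm : ((-1 : k) ^ N) * (-1) ^ N = 1 := by rw [← mul_pow]; simp
    change _ = op (s • (c2 • (T.ik K K' (T.τ (T.τ i)) * T.iB E F K' i ^ N) -
      c1 • (T.ik K K' (T.τ i) * T.iB E F K' i ^ N)))
    rw [T.invol, e1, e2]
    congr 1
    rw [pow_succ]
    match_scalars
    · field_simp
      linear_combination (s * (-1) ^ N) * hc - (s * c1) * hpm
    · linear_combination s * hc

end DiagramInvolution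

end OppositeRelations

/-! ### Universal property of the double -/

section Lift

variable (𝕂 : Type*) [Field 𝕂] {I : Type*} [Fintype I] [DecidableEq I] {D : CartanDatum I}
  {A : Type*} [Ring A] [Algebra (RatFunc 𝕂) A]

/-- The universal property of the Drinfeld double. -/
theorem QDouble.exists_lift {E F K K' Ki K'i : I → A}
    (h : DoubleRelations D (D.qi 𝕂) E F K K') (hK : ∀ i, K i * Ki i = 1) (hK' : ∀ i, K' i * K'i i = 1)
    (hKi : ∀ i, Ki i * K i = 1) (hK'i : ∀ i, K'i i * K' i = 1) :
    ∃ φ : QDouble 𝕂 D →ₐ[RatFunc 𝕂] A, (∀ i, φ (QDouble.E 𝕂 D i) = E i) ∧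
      (∀ i, φ (QDouble.F 𝕂 D i) = F i) ∧ (∀ i, φ (QDouble.K 𝕂 D i) = K i) ∧
      ∀ i, φ (QDouble.K' 𝕂 D i) = K' i := by
  let g : DoubleGen I → A := fun x => match x with
    | .E i => E i
    | .F i => F i
    | .K i => K i
    | .K' i => K' i
    | .Kinv i => Ki i
    | .K'inv i => K'i i
  let f : DoubleFree 𝕂 I →ₐ[RatFunc 𝕂] A := FreeAlgebra.lift (RatFunc 𝕂) g
  have fE : ∀ i, f (DoubleFree.E 𝕂 i) = E i := fun i => FreeAlgebra.lift_ι_apply g _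
  have fF : ∀ i, f (DoubleFree.F 𝕂 i) = F i := fun i => FreeAlgebra.lift_ι_apply g _
  have fK : ∀ i, f (DoubleFree.K 𝕂 i) = K i := fun i => FreeAlgebra.lift_ι_apply g _
  have fK' : ∀ i, f (DoubleFree.K' 𝕂 i) = K' i := fun i => FreeAlgebra.lift_ι_apply g _
  have fKi : ∀ i, f (DoubleFree.Kinv 𝕂 i) = Ki i := fun i => FreeAlgebra.lift_ι_apply g _
  have fK'i : ∀ i, f (DoubleFree.K'inv 𝕂 i) = K'i i := fun i => FreeAlgebra.lift_ι_apply g _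
  have hf : ∀ ⦃x y : DoubleFree 𝕂 I⦄, DoubleRel 𝕂 D x y → f x = f y := by
    intro x y hxy
    induction hxy with
    | K_Kinv i => rw [map_mul, fK, fKi, hK, map_one]
    | Kinv_K i => rw [map_mul, fK, fKi, hKi, map_one]
    | K'_K'inv i => rw [map_mul, fK', fK'i, hK', map_one]
    | K'inv_K' i => rw [map_mul, fK', fK'i, hK'i, map_one]
    | K_K i j => rw [map_mul, map_mul, fK, fK, (h.K_K i j).eq]
    | K_K' i j => rw [map_mul, map_mul, fK, fK', (h.K_K' i j).eq]
    | K'_K' i j => rw [map_mul, map_mul, fK', fK', (h.K'_K' i j).eq]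
    | K_E i j => rw [map_smul, map_mul, map_mul, fK, fE, h.K_E]
    | K_F i j => rw [map_smul, map_mul, map_mul, fK, fF, h.K_F, zpow_neg]
    | K'_E i j => rw [map_smul, map_mul, map_mul, fK', fE, h.K'_E, zpow_neg]
    | K'_F i j => rw [map_smul, map_mul, map_mul, fK', fF, h.K'_F]
    | E_F_same i =>
      rw [map_smul, map_sub, map_sub, map_mul, map_mul, fK, fK', fE, fF, h.E_F_same,
        add_sub_cancel_left]
    | E_F_ne i j hij => rw [map_sub, map_mul, map_mul, fE, fF, h.E_F_ne i j hij, sub_self, map_zero]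
    | serre_E i j hij =>
      obtain ⟨N, hN⟩ := D.exists_c_eq_neg hij
      rw [map_serreElt, map_zero, serreElt_eq_zero_iff 𝕂 D _ hN, fE, fE]
      exact h.serre_E i j hij N hN
    | serre_F i j hij =>
      obtain ⟨N, hN⟩ := D.exists_c_eq_neg hij
      rw [map_serreElt, map_zero, serreElt_eq_zero_iff 𝕂 D _ hN, fF, fF]
      exact h.serre_F i j hij N hN
  refine ⟨RingQuot.liftAlgHom (RatFunc 𝕂) ⟨f, hf⟩, fun i => ?_, fun i => ?_, fun i => ?_,
    fun i => ?_⟩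
  · exact (RingQuot.liftAlgHom_mkAlgHom_apply (RatFunc 𝕂) f hf _).trans (fE i)
  · exact (RingQuot.liftAlgHom_mkAlgHom_apply (RatFunc 𝕂) f hf _).trans (fF i)
  · exact (RingQuot.liftAlgHom_mkAlgHom_apply (RatFunc 𝕂) f hf _).trans (fK i)
  · exact (RingQuot.liftAlgHom_mkAlgHom_apply (RatFunc 𝕂) f hf _).trans (fK' i)

end Lift

/-! ### Operators on quotients -/

section Stabilizer

variable {k W : Type*} [Field k] [AddCommGroup W] [Module k W]

/-- The algebra of endomorphisms stabilizing a subspace. -/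
def stabilizingEnd (J : Submodule k W) : Subalgebra k (Module.End k W) where
  carrier := {f | ∀ x ∈ J, f x ∈ J}
  mul_mem' hf hg _ hx := hf _ (hg _ hx)
  add_mem' hf hg _ hx := J.add_mem (hf _ hx) (hg _ hx)
  algebraMap_mem' r _ hx := J.smul_mem r hx

/-- The action on the quotient of the endomorphisms stabilizing a subspace. -/
def stabilizingEnd.quot (J : Submodule k W) : stabilizingEnd J →ₐ[k] Module.End k (W ⧸ J) where
  toFun f := J.mapQ J f.1 f.2
  map_one' := by ext x; rfl
  map_mul' f g := by ext x; rfl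
  map_zero' := by ext x; rfl
  map_add' f g := by ext x; rfl
  commutes' r := by ext x; rfl

theorem stabilizingEnd.quot_mk (J : Submodule k W) (f : stabilizingEnd J) (x : W) :
    stabilizingEnd.quot J f (Submodule.Quotient.mk x) = Submodule.Quotient.mk (f.1 x) := rfl

end Stabilizer

/-! ### Transport of relations along homomorphisms -/

section MapPreDouble

variable {k : Type*} [Field k] {I : Type*} [Fintype I] [DecidableEq I] {D : CartanDatum I}
  {q : I → k} {A A' : Type*} [Ring A] [Algebra k A] [Ring A'] [Algebra k A']

theorem QComm.map (φ : A →ₐ[k] A') {a : k} {h x : A} (hx : QComm a h x) : QComm a (φ h) (φ x) := by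
  unfold QComm at *
  rw [← map_mul, hx, map_smul, map_mul]

theorem QComm.of_map {φ : A →ₐ[k] A'} (hφ : Function.Injective φ) {a : k} {h x : A}
    (hx : QComm a (φ h) (φ x)) : QComm a h x := by
  unfold QComm at *
  apply hφ
  rw [map_mul, hx, map_smul, map_mul]

theorem PreDouble.map (φ : A →ₐ[k] A') {E F K K' : I → A} (h : PreDouble D q E F K K') :
    PreDouble D q (fun i => φ (E i)) (fun i => φ (F i)) (fun i => φ (K i)) (fun i => φ (K' i)) where
  K_E i j := (h.K_E i j).map φ
  K_F i j := (h.K_F i j).map φ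
  K'_E i j := (h.K'_E i j).map φ
  K'_F i j := (h.K'_F i j).map φ
  E_F_same i := by rw [← map_mul, h.E_F_same, map_add, map_mul, map_smul, map_sub]
  E_F_ne i j hij := by rw [← map_mul, h.E_F_ne i j hij, map_mul]

theorem PreDouble.of_map {φ : A →ₐ[k] A'} (hφ : Function.Injective φ) {E F K K' : I → A}
    (h : PreDouble D q (fun i => φ (E i)) (fun i => φ (F i)) (fun i => φ (K i))
      (fun i => φ (K' i))) : PreDouble D q E F K K' where
  K_E i j := .of_map hφ (h.K_E i j)
  K_F i j := .of_map hφ (h.K_F i j)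
  K'_E i j := .of_map hφ (h.K'_E i j)
  K'_F i j := .of_map hφ (h.K'_F i j)
  E_F_same i := hφ (by rw [map_mul, h.E_F_same, map_add, map_mul, map_smul, map_sub])
  E_F_ne i j hij := hφ (by rw [map_mul, h.E_F_ne i j hij, map_mul])

/-- Meant for z diagonal, f creating a letter, e annihilating one and r = [e, f]: the defect of z
and e q-commutes with f if st = 1 wherever r is nonzero. This is the inductive step for proving the
K–E relations on words. -/
theorem sub_smul_mul_of_intertwine {s t : k} {z e f r : A} (h₁ : z * f = t • (f * z))
    (h₂ : e * f = f * e + r) (hr : z * r = r * z) (hs : (s * t) • (r * z) = r * z) :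
    (z * e - s • (e * z)) * f = t • (f * (z * e - s • (e * z))) := by
  have e₁ : z * e * f = t • (f * (z * e)) + r * z := by
    rw [mul_assoc, h₂, mul_add, ← mul_assoc, h₁, smul_mul_assoc, hr, mul_assoc]
  have e₂ : e * z * f = t • (f * (e * z)) + t • (r * z) := by
    rw [mul_assoc, h₁, mul_smul_comm, ← mul_assoc, h₂, add_mul, smul_add, mul_assoc]
  rw [sub_mul, smul_mul_assoc, e₁, e₂, mul_sub, mul_smul_comm]
  nth_rw 1 [← hs]
  module

theorem mul_smul_sub_comm (s : k) {z x y : A} (hx : z * x = x * z) (hy : z * y = y * z) :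
    z * (s • (x - y)) = s • (x - y) * z := by
  rw [mul_smul_comm, smul_mul_assoc, mul_sub, sub_mul, hx, hy]

end MapPreDouble

/-! ### Verma modules on words -/

section Verma

variable {k : Type*} [Field k] {I : Type*}

/-- Left multiplication by a letter on the span of words. -/
noncomputable def wordF (k : Type*) [Field k] (i : I) : Module.End k (List I →₀ k) :=
  Finsupp.lmapDomain k k (List.cons i)

/-- The diagonal operator scaling each word by a scalar. -/
noncomputable def wordDiag (f : List I → k) : Module.End k (List I →₀ k) :=
  Finsupp.linearCombination k fun w => Finsupp.single w (f w)

theorem wordF_single (i : I) (w : List I) (a : k) :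
    wordF k i (Finsupp.single w a) = Finsupp.single (i :: w) a := by
  simp [wordF]

theorem wordDiag_single (f : List I → k) (w : List I) (a : k) :
    wordDiag f (Finsupp.single w a) = f w • Finsupp.single w a := by
  simp [wordDiag, mul_comm]

theorem wordDiag_mul (f g : List I → k) : wordDiag f * wordDiag g = wordDiag (f * g) := by
  ext w : 2
  simp [Module.End.mul_apply, wordDiag_single]

theorem wordDiag_one : wordDiag (1 : List I → k) = 1 := by
  ext w : 2
  simp [wordDiag_single]

/-- The character `x ∏ a_i` of a word. -/
def wordWeight (a : I → k) (x : k) (w : List I) : k := (w.map a).prod * x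

theorem wordDiag_wordF (a : I → k) (x : k) (i : I) :
    QComm (a i) (wordDiag (wordWeight a x)) (wordF k i) := by
  unfold QComm
  ext w : 2
  simp only [LinearMap.comp_apply, Finsupp.lsingle_apply, Module.End.mul_apply, wordF_single,
    wordDiag_single, LinearMap.smul_apply, map_smul, smul_smul]
  rw [wordWeight, wordWeight, List.map_cons, List.prod_cons, mul_assoc]

theorem wordDiag_mul_comm (f g : List I → k) : wordDiag f * wordDiag g = wordDiag g * wordDiag f := by
  rw [wordDiag_mul, wordDiag_mul, mul_comm]

theorem wordWeight_ne_zero {a : I → k} {x : k} (ha : ∀ i, a i ≠ 0) (hx : x ≠ 0) (w : List I) :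
    wordWeight a x w ≠ 0 := by
  refine mul_ne_zero (List.prod_ne_zero ?_) hx
  simp only [List.mem_map, not_exists, not_and]
  exact fun i _ => ha i

theorem wordDiag_mul_inv {f : List I → k} (hf : ∀ w, f w ≠ 0) : wordDiag f * wordDiag f⁻¹ = 1 := by
  rw [wordDiag_mul, ← wordDiag_one]
  congr 1
  ext w
  exact mul_inv_cancel₀ (hf w)

/-- The empty word generates all words under the creation operators, so a q-commuting operator is
determined by its value there. -/
theorem word_end_eq_zero {Z : Module.End k (List I →₀ k)} (h0 : Z (Finsupp.single [] 1) = 0)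
    (h : ∀ i, ∃ s : k, Z * wordF k i = s • (wordF k i * Z)) : Z = 0 := by
  ext w : 2
  simp only [LinearMap.comp_apply, Finsupp.lsingle_apply, LinearMap.zero_apply]
  induction w with
  | nil => exact h0
  | cons i w ih =>
    obtain ⟨s, hs⟩ := h i
    have := congrArg (fun f : Module.End k (List I →₀ k) => f (Finsupp.single w 1)) hs
    simpa [Module.End.mul_apply, wordF_single, ih] using this

variable [Fintype I] [DecidableEq I] (D : CartanDatum I) (q : I → k) (χ : I → k)

/-- The action of `K_i` on words, with `K_i` acting by `χ i` on the empty word. -/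
noncomputable def wordK (i : I) : Module.End k (List I →₀ k) :=
  wordDiag (wordWeight (fun j => (q i ^ D.c i j)⁻¹) (χ i))

/-- The action of `K'_i` on words, with `K'_i` acting by `1` on the empty word. -/
noncomputable def wordK' (i : I) : Module.End k (List I →₀ k) :=
  wordDiag (wordWeight (fun j => q i ^ D.c i j) 1)

/-- The image under `E_i` of a word. -/
noncomputable def wordEAux (i : I) : List I → List I →₀ k
  | [] => 0
  | j :: w => wordF k j (wordEAux i w) + if i = j then (q i - (q i)⁻¹)⁻¹ •
      (wordK D q χ i (Finsupp.single w 1) - wordK' D q i (Finsupp.single w 1)) else 0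

/-- The action of `E_i` on words, killing the empty word. -/
noncomputable def wordE (i : I) : Module.End k (List I →₀ k) :=
  Finsupp.linearCombination k (wordEAux D q χ i)

theorem wordE_nil (i : I) : wordE D q χ i (Finsupp.single [] 1) = 0 := by
  simp [wordE, wordEAux]

theorem wordE_mul_wordF (i j : I) :
    wordE D q χ i * wordF k j = wordF k j * wordE D q χ i +
      if i = j then (q i - (q i)⁻¹)⁻¹ • (wordK D q χ i - wordK' D q i) else 0 := by
  ext w : 2
  simp only [LinearMap.comp_apply, Finsupp.lsingle_apply, Module.End.mul_apply, wordF_single,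
    LinearMap.add_apply, wordE, Finsupp.linearCombination_single, one_smul, wordEAux]
  congr 1
  split <;> rfl

variable {D q}

/-- The relations of K and K' with F hold since the weights are multiplicative, and [E, F] is built
into the recursion for E. For K and E the defect kills the empty word and q-commutes with every
letter, hence is zero. -/
theorem word_preDouble (hq : D.IsParam q) :
    PreDouble D q (wordE D q χ) (wordF k) (wordK D q χ) (wordK' D q) := by
  have key : ∀ (j : I) (a : I → k) (x : k), (∀ l, a l ≠ 0) →
      QComm (a j)⁻¹ (wordDiag (wordWeight a x)) (wordE D q χ j) := by
    intro j a x ha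
    unfold QComm
    rw [← sub_eq_zero]
    refine word_end_eq_zero ?_ fun l => ⟨a l, ?_⟩
    · rw [LinearMap.sub_apply, LinearMap.smul_apply, Module.End.mul_apply, Module.End.mul_apply,
        wordDiag_single, map_smul, wordE_nil, map_zero, smul_zero, smul_zero, sub_zero]
    refine sub_smul_mul_of_intertwine (wordDiag_wordF a x l) (wordE_mul_wordF D q χ j l) ?_ ?_
    · split_ifs
      · exact mul_smul_sub_comm (A := Module.End k (List I →₀ k)) _ (wordDiag_mul_comm _ _)
          (wordDiag_mul_comm _ _)
      · simp
    · split_ifs with hjl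
      · rw [hjl, inv_mul_cancel₀ (ha l), one_smul]
      · simp
  refine ⟨fun i j => ?_, fun i j => ?_, fun i j => ?_, fun i j => ?_, fun i => ?_,
    fun i j hij => ?_⟩
  · exact (key j _ _ fun l => inv_ne_zero (zpow_ne_zero _ (hq.ne_zero i))).congr (inv_inv _)
  · exact wordDiag_wordF _ _ _
  · exact key j _ _ fun l => zpow_ne_zero _ (hq.ne_zero i)
  · exact wordDiag_wordF _ _ _
  · rw [wordE_mul_wordF, if_pos rfl]
  · rw [wordE_mul_wordF, if_neg hij, add_zero]

/-- The Serre element in the E's kills the vacuum and, by the E–F symmetric form of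
`PreDouble.E_mul_serre`, commutes with all F_l. So these relations hold even before the quotient is
taken. -/
theorem word_serre_E (hq : D.IsParam q) {i j : I} (hij : i ≠ j) {N : ℕ} (hN : D.c i j = -N) :
    qAdIter (wordE D q χ i) (D.serreExp q i j) (N + 1) (wordE D q χ j) = 0 := by
  refine word_end_eq_zero ?_ fun l => ⟨1, ?_⟩
  · generalize N + 1 = n
    have : ∀ n, qAdIter (wordE D q χ i) (D.serreExp q i j) n (wordE D q χ j)
        (Finsupp.single [] 1) = 0 := by
      intro n
      induction n with
      | zero => exact wordE_nil D q χ j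
      | succ n ih =>
        rw [qAdIter_succ, LinearMap.sub_apply, LinearMap.smul_apply, Module.End.mul_apply,
          Module.End.mul_apply, ih, wordE_nil, map_zero, map_zero, smul_zero, sub_zero]
    exact this n
  · rw [one_smul]
    exact ((word_preDouble χ hq).swap.E_mul_serre hq hij hN l).symm

variable (D q)

/-- The quantum Serre operator on words. -/
noncomputable def wordSerre (i j : I) : Module.End k (List I →₀ k) :=
  qAdIter (wordF k i) (D.serreExp q i j) ((-D.c i j).toNat + 1) (wordF k j)

/-- The ideal spanned by the Serre elements in the span of words. -/
noncomputable def serreIdeal : Submodule k (List I →₀ k) :=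
  Submodule.span k {x | ∃ (u : List I) (i j : I) (v : List I), i ≠ j ∧
    x = (u.map (wordF k)).prod (wordSerre D q i j (Finsupp.single v 1))}

variable {D q}

theorem wordSerre_eq {i j : I} {N : ℕ} (hN : D.c i j = -N) :
    wordSerre D q i j = qAdIter (wordF k i) (D.serreExp q i j) (N + 1) (wordF k j) := by
  rw [wordSerre, hN, neg_neg, Int.toNat_natCast]

theorem wordSerre_mem {i j : I} (hij : i ≠ j) (u : List I) (x : List I →₀ k) :
    (u.map (wordF k)).prod (wordSerre D q i j x) ∈ serreIdeal D q := by
  induction x using Finsupp.induction_linear with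
  | zero => simp
  | add f g hf hg => rw [map_add, map_add]; exact Submodule.add_mem _ hf hg
  | single w a =>
    rw [← mul_one a, ← smul_eq_mul, ← Finsupp.smul_single, map_smul, map_smul]
    exact Submodule.smul_mem _ _ (Submodule.subset_span ⟨u, i, j, w, hij, rfl⟩)

theorem wordF_mem_serreIdeal (l : I) {x : List I →₀ k} (hx : x ∈ serreIdeal D q) :
    wordF k l x ∈ serreIdeal D q := by
  induction hx using Submodule.span_induction with
  | mem x hx =>
    obtain ⟨u, i, j, v, hij, rfl⟩ := hx
    exact Submodule.subset_span ⟨l :: u, i, j, v, hij, rfl⟩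
  | zero => simp
  | add x y _ _ hx hy => rw [map_add]; exact Submodule.add_mem _ hx hy
  | smul a x _ hx => rw [map_smul]; exact Submodule.smul_mem _ _ hx

/-- Serre elements are homogeneous in the letters, so the spanning vectors of the ideal are weight
vectors. -/
theorem wordDiag_serre (a : I → k) (x : k) (u : List I) (i j : I) (v : List I) :
    ∃ s : k, wordDiag (wordWeight a x) ((u.map (wordF k)).prod
      (wordSerre D q i j (Finsupp.single v 1))) =
      s • (u.map (wordF k)).prod (wordSerre D q i j (Finsupp.single v 1)) := by
  have hS : QComm (a j * a i ^ ((-D.c i j).toNat + 1)) (wordDiag (wordWeight a x))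
      (wordSerre D q i j) :=
    mul_qAdIter (wordDiag_wordF a x i) (wordDiag_wordF a x j) _ _
  have hu : QComm (u.map a).prod (wordDiag (wordWeight a x)) ((u.map (wordF k)).prod) := by
    induction u with
    | nil => simp [QComm]
    | cons l u ih => exact (wordDiag_wordF a x l).mul_right ih
  have := congrArg (fun f : Module.End k (List I →₀ k) => f (Finsupp.single v 1))
    (hu.mul_right hS)
  refine ⟨(u.map a).prod * (a j * a i ^ ((-D.c i j).toNat + 1)) * wordWeight a x v,
    this.trans ?_⟩
  rw [LinearMap.smul_apply, Module.End.mul_apply, wordDiag_single, map_smul, smul_smul]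
  rfl

theorem wordDiag_mem_serreIdeal (a : I → k) (y : k) {x : List I →₀ k} (hx : x ∈ serreIdeal D q) :
    wordDiag (wordWeight a y) x ∈ serreIdeal D q := by
  induction hx using Submodule.span_induction with
  | mem x hx =>
    obtain ⟨u, i, j, v, hij, rfl⟩ := hx
    obtain ⟨s, hs⟩ := wordDiag_serre (D := D) (q := q) a y u i j v
    rw [hs]
    exact Submodule.smul_mem _ _ (wordSerre_mem hij u _)
  | zero => simp
  | add x y _ _ hx hy => rw [map_add]; exact Submodule.add_mem _ hx hy
  | smul a x _ hx => rw [map_smul]; exact Submodule.smul_mem _ _ hx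

/-- E_l commutes with the Serre operator itself; commuting it past the letters to the left produces
only diagonal operators, which preserve the ideal. -/
theorem wordE_mem_serreIdeal (hq : D.IsParam q) (l : I) {x : List I →₀ k}
    (hx : x ∈ serreIdeal D q) : wordE D q χ l x ∈ serreIdeal D q := by
  induction hx using Submodule.span_induction with
  | mem x hx =>
    obtain ⟨u, i, j, v, hij, rfl⟩ := hx
    induction u with
    | nil =>
      obtain ⟨N, hN⟩ := D.exists_c_eq_neg hij
      have := congrArg (fun f : Module.End k (List I →₀ k) => f (Finsupp.single v 1))
        ((word_preDouble χ hq).E_mul_serre hq hij hN l)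
      rw [← wordSerre_eq hN] at this
      have h2 := wordSerre_mem (D := D) (q := q) hij [] (wordE D q χ l (Finsupp.single v 1))
      exact this ▸ h2
    | cons r u ih =>
      have hmem := wordSerre_mem (D := D) (q := q) hij u (Finsupp.single v (1 : k))
      change (wordE D q χ l * wordF k r) ((u.map (wordF k)).prod
        (wordSerre D q i j (Finsupp.single v 1))) ∈ _
      rw [wordE_mul_wordF, LinearMap.add_apply]
      refine Submodule.add_mem _ (wordF_mem_serreIdeal r ih) ?_
      split_ifs
      · exact Submodule.smul_mem _ _ (Submodule.sub_mem _ (wordDiag_mem_serreIdeal _ _ hmem)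
          (wordDiag_mem_serreIdeal _ _ hmem))
      · exact Submodule.zero_mem _
  | zero => simp
  | add x y _ _ hx hy => rw [map_add]; exact Submodule.add_mem _ hx hy
  | smul a x _ hx => rw [map_smul]; exact Submodule.smul_mem _ _ hx

end Verma

/-! ### Quotient by the Serre ideal -/

section VermaQuotient

variable {k : Type*} [Field k] {I : Type*} [Fintype I] [DecidableEq I] {D : CartanDatum I}
  {q : I → k}

/-- The inverse of a character of words is again a character. -/
theorem wordDiag_inv_mem_serreIdeal (a : I → k) (y : k) {x : List I →₀ k}
    (hx : x ∈ serreIdeal D q) : wordDiag (wordWeight a y)⁻¹ x ∈ serreIdeal D q := by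
  have : (wordWeight a y)⁻¹ = wordWeight (fun i => (a i)⁻¹) y⁻¹ := by
    ext w
    have hw : ((w.map a).prod)⁻¹ = (w.map fun i => (a i)⁻¹).prod := by
      induction w with
      | nil => simp
      | cons i w ih => simp [ih, mul_comm]
    rw [Pi.inv_apply, wordWeight, wordWeight, mul_inv, hw]
  rw [this]
  exact wordDiag_mem_serreIdeal _ _ hx

/-- Operators satisfying the relations of the Drinfeld double modulo a stable subspace. -/
theorem exists_quotientOperators {W : Type*} [AddCommGroup W] [Module k W] (J : Submodule k W)
    {E F K K' Ki K'i : I → Module.End k W} (h : PreDouble D q E F K K')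
    (hE : ∀ i, E i ∈ stabilizingEnd J) (hF : ∀ i, F i ∈ stabilizingEnd J)
    (hK : ∀ i, K i ∈ stabilizingEnd J) (hK' : ∀ i, K' i ∈ stabilizingEnd J)
    (hKi : ∀ i, Ki i ∈ stabilizingEnd J) (hK'i : ∀ i, K'i i ∈ stabilizingEnd J)
    (K_K : ∀ i j, K i * K j = K j * K i) (K_K' : ∀ i j, K i * K' j = K' j * K i)
    (K'_K' : ∀ i j, K' i * K' j = K' j * K' i)
    (K_Ki : ∀ i, K i * Ki i = 1) (K'_K'i : ∀ i, K' i * K'i i = 1)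
    (Ki_K : ∀ i, Ki i * K i = 1) (K'i_K' : ∀ i, K'i i * K' i = 1)
    (serre_E : ∀ i j, i ≠ j → ∀ N : ℕ, D.c i j = -N →
      qAdIter (E i) (D.serreExp q i j) (N + 1) (E j) = 0)
    (serre_F : ∀ i j, i ≠ j → ∀ N : ℕ, D.c i j = -N →
      ∀ x, qAdIter (F i) (D.serreExp q i j) (N + 1) (F j) x ∈ J) :
    ∃ E₁ F₁ K₁ K'₁ Ki₁ K'i₁ : I → Module.End k (W ⧸ J),
      DoubleRelations D q E₁ F₁ K₁ K'₁ ∧ (∀ i, K₁ i * Ki₁ i = 1) ∧ (∀ i, K'₁ i * K'i₁ i = 1) ∧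
      (∀ i, Ki₁ i * K₁ i = 1) ∧ (∀ i, K'i₁ i * K'₁ i = 1) ∧
      (∀ i x, E₁ i (Submodule.Quotient.mk x) = Submodule.Quotient.mk (E i x)) ∧
      (∀ i x, F₁ i (Submodule.Quotient.mk x) = Submodule.Quotient.mk (F i x)) ∧
      (∀ i x, K₁ i (Submodule.Quotient.mk x) = Submodule.Quotient.mk (K i x)) ∧
      (∀ i x, K'₁ i (Submodule.Quotient.mk x) = Submodule.Quotient.mk (K' i x)) := by
  let φ := stabilizingEnd.quot J
  have hinj : Function.Injective (stabilizingEnd J).val := Subtype.val_injective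
  have hpre : PreDouble D q (fun i => (⟨E i, hE i⟩ : stabilizingEnd J)) (fun i => ⟨F i, hF i⟩)
    (fun i => ⟨K i, hK i⟩) (fun i => ⟨K' i, hK' i⟩) := PreDouble.of_map hinj h
  have comm : ∀ {x y : stabilizingEnd J}, x.1 * y.1 = y.1 * x.1 → φ x * φ y = φ y * φ x := by
    intro x y hxy
    rw [← map_mul, ← map_mul]
    exact congrArg φ (Subtype.ext hxy)
  have one : ∀ {x y : stabilizingEnd J}, x.1 * y.1 = 1 → φ x * φ y = 1 := by
    intro x y hxy
    rw [← map_mul, ← map_one φ]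
    exact congrArg φ (Subtype.ext hxy)
  refine ⟨fun i => φ ⟨E i, hE i⟩, fun i => φ ⟨F i, hF i⟩, fun i => φ ⟨K i, hK i⟩,
    fun i => φ ⟨K' i, hK' i⟩, fun i => φ ⟨Ki i, hKi i⟩, fun i => φ ⟨K'i i, hK'i i⟩,
    ⟨hpre.map φ, fun i j => .of_eq (comm (K_K i j)), fun i j => .of_eq (comm (K_K' i j)),
      fun i j => .of_eq (comm (K'_K' i j)), ?_, ?_⟩,
    fun i => one (K_Ki i), fun i => one (K'_K'i i), fun i => one (Ki_K i),
    fun i => one (K'i_K' i), fun i x => rfl, fun i x => rfl, fun i x => rfl, fun i x => rfl⟩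
  · intro i j hij N hN
    rw [← map_qAdIter]
    convert map_zero φ using 2
    apply hinj
    rw [map_qAdIter, map_zero]
    exact serre_E i j hij N hN
  · intro i j hij N hN
    rw [← map_qAdIter]
    refine LinearMap.ext fun v => ?_
    obtain ⟨x, rfl⟩ := Submodule.Quotient.mk_surjective _ v
    rw [stabilizingEnd.quot_mk]
    refine (Submodule.Quotient.mk_eq_zero _).2 ?_
    have := map_qAdIter (stabilizingEnd J).val (⟨F i, hF i⟩ : stabilizingEnd J)
      (D.serreExp q i j) (N + 1) ⟨F j, hF j⟩
    change (stabilizingEnd J).val _ x ∈ J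
    rw [this]
    exact serre_F i j hij N hN x

/-- The operators of the Drinfeld double on the Verma module of highest weight `(χ, 1)`. -/
theorem exists_vermaOperators (hq : D.IsParam q) (χ : I → kˣ) :
    ∃ E F K K' Ki K'i : I → Module.End k ((List I →₀ k) ⧸ serreIdeal D q),
      DoubleRelations D q E F K K' ∧ (∀ i, K i * Ki i = 1) ∧ (∀ i, K' i * K'i i = 1) ∧
      (∀ i, Ki i * K i = 1) ∧ (∀ i, K'i i * K' i = 1) ∧
      (∀ i x, E i (Submodule.Quotient.mk x) =
        Submodule.Quotient.mk (wordE D q (fun i => (χ i : k)) i x)) ∧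
      (∀ i x, F i (Submodule.Quotient.mk x) = Submodule.Quotient.mk (wordF k i x)) ∧
      (∀ i x, K i (Submodule.Quotient.mk x) =
        Submodule.Quotient.mk (wordK D q (fun i => (χ i : k)) i x)) ∧
      (∀ i x, K' i (Submodule.Quotient.mk x) = Submodule.Quotient.mk (wordK' D q i x)) := by
  have hneK : ∀ i w, wordWeight (fun j => (q i ^ D.c i j)⁻¹) (χ i : k) w ≠ 0 := fun i =>
    wordWeight_ne_zero (fun j => inv_ne_zero (zpow_ne_zero _ (hq.ne_zero i))) (χ i).ne_zero
  have hneK' : ∀ i w, wordWeight (fun j => q i ^ D.c i j) (1 : k) w ≠ 0 := fun i =>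
    wordWeight_ne_zero (fun j => zpow_ne_zero _ (hq.ne_zero i)) one_ne_zero
  exact exists_quotientOperators (serreIdeal D q) (word_preDouble (fun i => (χ i : k)) hq)
    (fun i _ hx => wordE_mem_serreIdeal _ hq i hx) (fun i _ hx => wordF_mem_serreIdeal i hx)
    (fun i _ hx => wordDiag_mem_serreIdeal _ _ hx) (fun i _ hx => wordDiag_mem_serreIdeal _ _ hx)
    (fun i _ hx => wordDiag_inv_mem_serreIdeal _ _ hx)
    (fun i _ hx => wordDiag_inv_mem_serreIdeal _ _ hx)
    (fun i j => wordDiag_mul_comm _ _) (fun i j => wordDiag_mul_comm _ _)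
    (fun i j => wordDiag_mul_comm _ _) (fun i => wordDiag_mul_inv (hneK i))
    (fun i => wordDiag_mul_inv (hneK' i))
    (fun i => (wordDiag_mul_comm _ _).trans (wordDiag_mul_inv (hneK i)))
    (fun i => (wordDiag_mul_comm _ _).trans (wordDiag_mul_inv (hneK' i)))
    (fun i j hij N hN => word_serre_E _ hq hij hN)
    (fun i j hij N hN x => by rw [← wordSerre_eq hN]; exact wordSerre_mem hij [] x)

end VermaQuotient

/-- The action of the Drinfeld double on the Verma module of highest weight `(χ, 1)`. -/
theorem QDouble.exists_vermaRep (𝕂 : Type*) [Field 𝕂] {I : Type*} [Fintype I] [DecidableEq I]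
    (D : CartanDatum I) (χ : I → (RatFunc 𝕂)ˣ) :
    ∃ ρ : QDouble 𝕂 D →ₐ[RatFunc 𝕂]
        Module.End (RatFunc 𝕂) ((List I →₀ RatFunc 𝕂) ⧸ serreIdeal D (D.qi 𝕂)),
      (∀ i x, ρ (QDouble.E 𝕂 D i) (Submodule.Quotient.mk x) =
        Submodule.Quotient.mk (wordE D (D.qi 𝕂) (fun i => (χ i : RatFunc 𝕂)) i x)) ∧
      (∀ i x, ρ (QDouble.F 𝕂 D i) (Submodule.Quotient.mk x) =
        Submodule.Quotient.mk (wordF (RatFunc 𝕂) i x)) ∧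
      (∀ i x, ρ (QDouble.K 𝕂 D i) (Submodule.Quotient.mk x) =
        Submodule.Quotient.mk (wordK D (D.qi 𝕂) (fun i => (χ i : RatFunc 𝕂)) i x)) ∧
      (∀ i x, ρ (QDouble.K' 𝕂 D i) (Submodule.Quotient.mk x) =
        Submodule.Quotient.mk (wordK' D (D.qi 𝕂) i x)) := by
  obtain ⟨E, F, K, K', Ki, K'i, h, h1, h2, h3, h4, hE, hF, hK, hK'⟩ :=
    exists_vermaOperators (D.isParam_qi 𝕂) χ
  obtain ⟨ρ, rE, rF, rK, rK'⟩ := QDouble.exists_lift 𝕂 h h1 h2 h3 h4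
  refine ⟨ρ, fun i x => ?_, fun i x => ?_, fun i x => ?_, fun i x => ?_⟩
  · rw [rE, hE]
  · rw [rF, hF]
  · rw [rK, hK]
  · rw [rK', hK']

/-! ### Separating coefficients by specialization -/

section Independence

/-- Vector-valued polynomials are determined modulo a subspace by their values at units. -/
theorem mem_of_forall_eval_mem {k I V : Type*} [Field k] [Infinite k] [AddCommGroup V] [Module k V]
    (S : Submodule k V) (t : (I →₀ ℕ) →₀ V)
    (h : ∀ χ : I → kˣ, (t.sum fun a u =>
      MvPolynomial.eval (fun i => (χ i : k)) (MvPolynomial.monomial a 1) • u) ∈ S) (a : I →₀ ℕ) :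
    t a ∈ S := by
  rw [← Submodule.Quotient.mk_eq_zero, ← Module.forall_dual_apply_eq_zero_iff k]
  intro f
  -- A functional vanishing on S reduces the claim to a scalar polynomial vanishing at all points
  -- with nonzero coordinates.
  let g : V →ₗ[k] k := f ∘ₗ S.mkQ
  let p : MvPolynomial I k := t.sum fun a u => MvPolynomial.monomial a (g u)
  have hp : p = 0 := by
    refine MvPolynomial.funext_set (fun _ : I => ({0}ᶜ : Set k))
      (fun _ => (Set.finite_singleton (0 : k)).infinite_compl) fun x hx => ?_
    have hx0 : ∀ i, x i ≠ 0 := fun i => hx i (Set.mem_univ i)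
    have hs := h fun i => Units.mk0 (x i) (hx0 i)
    have hg : g (t.sum fun a u => MvPolynomial.eval x (MvPolynomial.monomial a 1) • u) = 0 := by
      change f (Submodule.Quotient.mk _) = 0
      exact (congrArg f ((Submodule.Quotient.mk_eq_zero S).2 hs)).trans (map_zero f)
    rw [map_zero, ← hg]
    simp only [p, Finsupp.sum, map_sum, map_smul, MvPolynomial.eval_monomial, smul_eq_mul]
    exact Finset.sum_congr rfl fun _ _ => by ring
  have hc : MvPolynomial.coeff a p = g (t a) := by
    classical
    simp only [p, Finsupp.sum, MvPolynomial.coeff_sum, MvPolynomial.coeff_monomial]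
    rw [Finset.sum_ite_eq' t.support a fun b => g (t b)]
    split_ifs with ha
    · rfl
    · rw [Finsupp.notMem_support_iff.1 ha, map_zero]
  rw [hp, MvPolynomial.coeff_zero] at hc
  exact hc.symm

end Independence

/-! ### Length of words -/

section Words

variable {k : Type*} [Field k] {I : Type*}

/-- The span of the words of length less than `n`. -/
def wordLT (k : Type*) [Field k] (I : Type*) (n : ℕ) : Submodule k (List I →₀ k) :=
  Finsupp.supported k k {w | w.length < n}

theorem wordLT_eq_span (n : ℕ) : wordLT k I n =
    Submodule.span k ((fun w => Finsupp.single w 1) '' {w : List I | w.length < n}) :=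
  Finsupp.supported_eq_span_single k _

theorem wordLT_mono {m n : ℕ} (h : m ≤ n) : wordLT k I m ≤ wordLT k I n :=
  Finsupp.supported_mono fun _ hw => lt_of_lt_of_le hw h

theorem single_mem_wordLT {n : ℕ} {w : List I} (h : w.length < n) (a : k) :
    Finsupp.single w a ∈ wordLT k I n :=
  Finsupp.single_mem_supported k a h

/-- A linear map bounds the length of words if it does so on each word. -/
theorem wordLT_le_comap {V : Type*} [AddCommGroup V] [Module k V] {n : ℕ}
    {f : (List I →₀ k) →ₗ[k] V} {S : Submodule k V}
    (h : ∀ w : List I, w.length < n → f (Finsupp.single w 1) ∈ S) {x : List I →₀ k}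
    (hx : x ∈ wordLT k I n) : f x ∈ S := by
  have : wordLT k I n ≤ S.comap f := by
    rw [wordLT_eq_span, Submodule.span_le]
    rintro _ ⟨w, hw, rfl⟩
    exact h w hw
  exact this hx

theorem wordF_mem_wordLT {n : ℕ} (i : I) {x : List I →₀ k} (hx : x ∈ wordLT k I n) :
    wordF k i x ∈ wordLT k I (n + 1) := by
  refine wordLT_le_comap (f := wordF k i) (fun w hw => ?_) hx
  rw [wordF_single]
  exact single_mem_wordLT (by simpa using hw) _

theorem wordDiag_mem_wordLT {n : ℕ} (f : List I → k) {x : List I →₀ k} (hx : x ∈ wordLT k I n) :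
    wordDiag f x ∈ wordLT k I n := by
  refine wordLT_le_comap (f := wordDiag f) (fun w hw => ?_) hx
  rw [wordDiag_single]
  exact Submodule.smul_mem _ _ (single_mem_wordLT hw _)

/-- Not raising the length is all that is needed of E: it makes F_i the leading part of B_i. -/
theorem wordE_mem_wordLT [Fintype I] [DecidableEq I] (D : CartanDatum I) (q χ : I → k) {n : ℕ}
    (i : I) {x : List I →₀ k} (hx : x ∈ wordLT k I n) : wordE D q χ i x ∈ wordLT k I n := by
  refine wordLT_le_comap (f := wordE D q χ i) (fun w hw => wordLT_mono hw ?_) hx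
  rw [wordE, Finsupp.linearCombination_single, one_smul]
  clear hw
  induction w with
  | nil => exact Submodule.zero_mem _
  | cons j w ih =>
    refine Submodule.add_mem _ (wordF_mem_wordLT j ih) ?_
    have hw : Finsupp.single w (1 : k) ∈ wordLT k I ((j :: w).length + 1) :=
      single_mem_wordLT (by simp) _
    split_ifs
    · exact Submodule.smul_mem _ _ (Submodule.sub_mem _ (wordDiag_mem_wordLT _ hw)
        (wordDiag_mem_wordLT _ hw))
    · exact Submodule.zero_mem _

/-- The projection to the span of the words of length `n`. -/
noncomputable def wordProj (k : Type*) [Field k] (I : Type*) (n : ℕ) :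
    Module.End k (List I →₀ k) := wordDiag fun w => if w.length = n then 1 else 0

theorem sub_wordProj_mem {n : ℕ} {x : List I →₀ k} (hx : x ∈ wordLT k I (n + 1)) :
    x - wordProj k I n x ∈ wordLT k I n := by
  refine wordLT_le_comap (f := LinearMap.id - wordProj k I n) (fun w hw => ?_) hx
  rw [LinearMap.sub_apply, LinearMap.id_apply, wordProj, wordDiag_single]
  split_ifs with h
  · simp
  · rw [zero_smul, sub_zero]
    exact single_mem_wordLT (by omega) _

theorem wordProj_of_mem {n d : ℕ} {x : List I →₀ k}
    (hx : x ∈ Finsupp.supported k k {w : List I | w.length = d}) :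
    wordProj k I n x = if d = n then x else 0 := by
  rw [Finsupp.supported_eq_span_single] at hx
  induction hx using Submodule.span_induction with
  | mem x hx =>
    obtain ⟨w, hw, rfl⟩ := hx
    change w.length = d at hw
    rw [wordProj, wordDiag_single, hw]
    split_ifs <;> simp
  | zero => simp
  | add x y _ _ hx hy => rw [map_add, hx, hy]; split_ifs <;> simp
  | smul a x _ hx => rw [map_smul, hx]; split_ifs <;> simp

theorem wordF_mem_homogeneous {d : ℕ} (i : I) {x : List I →₀ k}
    (hx : x ∈ Finsupp.supported k k {w : List I | w.length = d}) :
    wordF k i x ∈ Finsupp.supported k k {w : List I | w.length = d + 1} := by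
  rw [Finsupp.supported_eq_span_single] at hx
  induction hx using Submodule.span_induction with
  | mem x hx =>
    obtain ⟨w, hw, rfl⟩ := hx
    change w.length = d at hw
    rw [wordF_single]
    exact Finsupp.single_mem_supported k _ (by simp [hw])
  | zero => simp
  | add x y _ _ hx hy => rw [map_add]; exact Submodule.add_mem _ hx hy
  | smul a x _ hx => rw [map_smul]; exact Submodule.smul_mem _ _ hx

theorem qAdIter_wordF_mem_homogeneous {d : ℕ} (i j : I) (z : ℕ → k) (n : ℕ) {x : List I →₀ k}
    (hx : x ∈ Finsupp.supported k k {w : List I | w.length = d}) :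
    qAdIter (wordF k i) z n (wordF k j) x ∈
      Finsupp.supported k k {w : List I | w.length = d + n + 1} := by
  induction n generalizing d x with
  | zero => exact wordF_mem_homogeneous j hx
  | succ n ih =>
    rw [qAdIter_succ]
    refine Submodule.sub_mem _ (wordF_mem_homogeneous i (ih hx)) (Submodule.smul_mem _ _ ?_)
    have := ih (wordF_mem_homogeneous i hx)
    rwa [show d + 1 + n + 1 = d + (n + 1) + 1 by ring] at this

theorem map_wordF_prod_mem_homogeneous {d : ℕ} (u : List I) {x : List I →₀ k}
    (hx : x ∈ Finsupp.supported k k {w : List I | w.length = d}) :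
    (u.map (wordF k)).prod x ∈ Finsupp.supported k k {w : List I | w.length = d + u.length} := by
  induction u with
  | nil => exact hx
  | cons i u ih => exact wordF_mem_homogeneous i ih

end Words

/-! ### Filtration by the number of generators, and descent along it -/

section Filtration

variable {k : Type*} [Field k] {I : Type*} {P : Type*} [Ring P] [Algebra k P]

/-- The evaluation of words in an algebra. -/
noncomputable def wordEval (b : I → P) : (List I →₀ k) →ₗ[k] P :=
  Finsupp.linearCombination k fun w => (w.map b).prod

theorem wordEval_single (b : I → P) (w : List I) (a : k) :
    wordEval b (Finsupp.single w a) = a • (w.map b).prod := by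
  simp [wordEval]

theorem wordEval_wordF (b : I → P) (i : I) (x : List I →₀ k) :
    wordEval b (wordF k i x) = b i * wordEval b x := by
  induction x using Finsupp.induction_linear with
  | zero => simp
  | add x y hx hy => rw [map_add, map_add, map_add, hx, hy, mul_add]
  | single w a => rw [wordF_single, wordEval_single, wordEval_single, List.map_cons,
      List.prod_cons, mul_smul_comm]

theorem wordEval_prod (b : I → P) (u : List I) (x : List I →₀ k) :
    wordEval b ((u.map (wordF k)).prod x) = (u.map b).prod * wordEval b x := by
  induction u with
  | nil => simp
  | cons i u ih =>
    rw [List.map_cons, List.prod_cons, Module.End.mul_apply, wordEval_wordF, ih, List.map_cons,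
      List.prod_cons, mul_assoc]

theorem wordEval_qAdIter (b : I → P) (i j : I) (z : ℕ → k) (n : ℕ) (x : List I →₀ k) :
    wordEval b (qAdIter (wordF k i) z n (wordF k j) x) =
      qAdIter (b i) z n (b j) * wordEval b x := by
  induction n generalizing x with
  | zero => exact wordEval_wordF b j x
  | succ n ih =>
    rw [qAdIter_succ, qAdIter_succ, LinearMap.sub_apply, LinearMap.smul_apply,
      Module.End.mul_apply, Module.End.mul_apply, map_sub, map_smul, wordEval_wordF, ih, ih,
      wordEval_wordF, sub_mul, smul_mul_assoc, mul_assoc, mul_assoc]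

variable (b : I → P) (ev : MvPolynomial I k →ₐ[k] P)

/-- The span of the products of fewer than `n` of the elements `b i`, followed by a Cartan part. -/
def filtLT (n : ℕ) : Submodule k P :=
  Submodule.span k {x | ∃ (w : List I) (f : MvPolynomial I k), w.length < n ∧
    x = (w.map b).prod * ev f}

theorem filtLT_zero : filtLT b ev 0 = ⊥ := by
  rw [filtLT, Submodule.span_eq_bot]
  rintro _ ⟨w, f, hw, rfl⟩
  exact absurd hw (Nat.not_lt_zero _)

theorem filtLT_mono {m n : ℕ} (h : m ≤ n) : filtLT b ev m ≤ filtLT b ev n := by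
  refine Submodule.span_mono ?_
  rintro _ ⟨w, f, hw, rfl⟩
  exact ⟨w, f, hw.trans_le h, rfl⟩

theorem filtLT_le_comap {V : Type*} [AddCommGroup V] [Module k V] {n : ℕ} {g : P →ₗ[k] V}
    {S : Submodule k V} (h : ∀ (w : List I) (f : MvPolynomial I k), w.length < n →
      g ((w.map b).prod * ev f) ∈ S) {x : P} (hx : x ∈ filtLT b ev n) : g x ∈ S := by
  have : filtLT b ev n ≤ S.comap g := by
    rw [filtLT, Submodule.span_le]
    rintro _ ⟨w, f, hw, rfl⟩
    exact h w f hw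
  exact this hx

variable {b ev}

theorem prod_mul_mem_filtLT {w : List I} {n : ℕ} (hw : w.length < n) (f : MvPolynomial I k) :
    (w.map b).prod * ev f ∈ filtLT b ev n :=
  Submodule.subset_span ⟨w, f, hw, rfl⟩

theorem gen_mul_mem_filtLT {n : ℕ} {x : P} (i : I) (hx : x ∈ filtLT b ev n) :
    b i * x ∈ filtLT b ev (n + 1) := by
  refine filtLT_le_comap b ev (g := LinearMap.mulLeft k (b i)) (fun w f hw => ?_) hx
  rw [LinearMap.mulLeft_apply, ← mul_assoc, ← List.prod_cons, ← List.map_cons]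
  exact prod_mul_mem_filtLT (by simpa using hw) f

theorem mul_ev_mem_filtLT {n : ℕ} {x : P} (hx : x ∈ filtLT b ev n) (g : MvPolynomial I k) :
    x * ev g ∈ filtLT b ev n := by
  refine filtLT_le_comap b ev (g := LinearMap.mulRight k (ev g)) (fun w f hw => ?_) hx
  rw [LinearMap.mulRight_apply, mul_assoc, ← map_mul]
  exact prod_mul_mem_filtLT hw _

theorem prod_mul_mem_filtLT_add {n : ℕ} {x : P} (u : List I) (hx : x ∈ filtLT b ev n) :
    (u.map b).prod * x ∈ filtLT b ev (n + u.length) := by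
  induction u with
  | nil => simpa using hx
  | cons i u ih =>
    rw [List.map_cons, List.prod_cons, mul_assoc]
    exact gen_mul_mem_filtLT i ih

theorem wordEval_mem_filtLT {n : ℕ} {x : List I →₀ k} (hx : x ∈ wordLT k I n) :
    wordEval b x ∈ filtLT b ev n := by
  refine wordLT_le_comap (f := wordEval b) (fun w hw => ?_) hx
  rw [wordEval_single, one_smul, ← mul_one (List.prod _), ← map_one ev]
  exact prod_mul_mem_filtLT hw 1

/-- Moving a Cartan polynomial past b i rescales its variables, so Cartan parts can always be
collected on the right. -/
theorem exists_ev_of_qComm {κ : I → P} {s : I → I → k} (hX : ∀ i, ev (MvPolynomial.X i) = κ i)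
    (h : ∀ i j, QComm (s i j) (κ i) (b j)) (i : I) (f : MvPolynomial I k) :
    ∃ f', ev f * b i = b i * ev f' := by
  induction f using MvPolynomial.induction_on with
  | C a =>
    refine ⟨MvPolynomial.C a, ?_⟩
    have : ev (MvPolynomial.C a) = algebraMap k P a := ev.commutes a
    rw [this]
    exact Algebra.commutes a (b i)
  | add f g hf hg =>
    obtain ⟨f', hf⟩ := hf
    obtain ⟨g', hg⟩ := hg
    exact ⟨f' + g', by rw [map_add, map_add, add_mul, mul_add, hf, hg]⟩
  | mul_X f j hf =>
    obtain ⟨f', hf⟩ := hf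
    have hj : κ j * b i = s j i • (b i * κ j) := h j i
    refine ⟨s j i • (f' * MvPolynomial.X j), ?_⟩
    rw [map_mul, map_smul, map_mul, hX, mul_assoc, hj, mul_smul_comm, ← mul_assoc, hf,
      mul_smul_comm, mul_assoc]

theorem ev_mul_mem_filtLT (hev : ∀ i f, ∃ f', ev f * b i = b i * ev f') {n : ℕ} {x : P}
    (f : MvPolynomial I k) (hx : x ∈ filtLT b ev n) : ev f * x ∈ filtLT b ev n := by
  have key : ∀ (w : List I) (f : MvPolynomial I k), ∃ f',
      ev f * (w.map b).prod = (w.map b).prod * ev f' := by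
    intro w
    induction w with
    | nil => exact fun f => ⟨f, by simp⟩
    | cons i w ih =>
      intro f
      obtain ⟨f₁, h₁⟩ := hev i f
      obtain ⟨f₂, h₂⟩ := ih f₁
      exact ⟨f₂, by rw [List.map_cons, List.prod_cons, ← mul_assoc, h₁, mul_assoc, h₂, mul_assoc]⟩
  refine filtLT_le_comap b ev (g := LinearMap.mulLeft k (ev f)) (fun w g hw => ?_) hx
  obtain ⟨f', hf'⟩ := key w f
  rw [LinearMap.mulLeft_apply, ← mul_assoc, hf', mul_assoc, ← map_mul]
  exact prod_mul_mem_filtLT hw _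

theorem mul_gen_mem_filtLT (hev : ∀ i f, ∃ f', ev f * b i = b i * ev f') {n : ℕ} {x : P}
    (hx : x ∈ filtLT b ev n) (i : I) : x * b i ∈ filtLT b ev (n + 1) := by
  refine filtLT_le_comap b ev (g := LinearMap.mulRight k (b i)) (fun w f hw => ?_) hx
  obtain ⟨f', hf'⟩ := hev i f
  have : (w.map b).prod * b i = ((w ++ [i]).map b).prod := by simp
  rw [LinearMap.mulRight_apply, mul_assoc, hf', ← mul_assoc, this]
  exact prod_mul_mem_filtLT (by simpa using hw) _

theorem mul_prod_mem_filtLT (hev : ∀ i f, ∃ f', ev f * b i = b i * ev f') {n : ℕ} {x : P}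
    (hx : x ∈ filtLT b ev n) (v : List I) : x * (v.map b).prod ∈ filtLT b ev (n + v.length) := by
  induction v generalizing n x with
  | nil => simpa using hx
  | cons i v ih =>
    rw [List.map_cons, List.prod_cons, ← mul_assoc, List.length_cons, ← add_assoc, add_right_comm]
    exact ih (mul_gen_mem_filtLT hev hx i)

theorem gen_mem_filtLT (i : I) : b i ∈ filtLT b ev 2 := by
  have : b i = ([i].map b).prod * ev 1 := by simp
  rw [this]
  exact prod_mul_mem_filtLT (by simp) 1

theorem triIter_mem_filtLT (hev : ∀ i f, ∃ f', ev f * b i = b i * ev f') (i j : I)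
    (f : MvPolynomial I k) (z β : ℕ → k) (n : ℕ) :
    triIter (b i) (ev f) z β n (b j) ∈ filtLT b ev (n + 2) := by
  induction n using Nat.twoStepInduction with
  | zero => exact gen_mem_filtLT j
  | one =>
    rw [triIter_one]
    exact Submodule.sub_mem _ (gen_mul_mem_filtLT i (gen_mem_filtLT j))
      (Submodule.smul_mem _ _ (mul_gen_mem_filtLT hev (gen_mem_filtLT j) i))
  | more n h₀ h₁ =>
    rw [triIter_add_two]
    exact Submodule.sub_mem _ (Submodule.sub_mem _ (gen_mul_mem_filtLT i h₁)
      (Submodule.smul_mem _ _ (mul_gen_mem_filtLT hev h₁ i)))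
      (Submodule.smul_mem _ _ (filtLT_mono b ev (by omega) (mul_ev_mem_filtLT h₀ f)))

/-- The correction terms replace two factors b i by one κ, which does not count for the filtration.
-/
theorem qAdIter_sub_triIter_mem_filtLT (hev : ∀ i f, ∃ f', ev f * b i = b i * ev f') (i j : I)
    (f : MvPolynomial I k) (z β : ℕ → k) (n : ℕ) :
    qAdIter (b i) z n (b j) - triIter (b i) (ev f) z β n (b j) ∈ filtLT b ev (n + 1) := by
  induction n using Nat.twoStepInduction with
  | zero => rw [qAdIter_zero, triIter_zero, sub_self]; exact Submodule.zero_mem _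
  | one =>
    rw [qAdIter_succ, qAdIter_zero, triIter_one, sub_self]
    exact Submodule.zero_mem _
  | more n h₀ h₁ =>
    have h : qAdIter (b i) z (n + 2) (b j) - triIter (b i) (ev f) z β (n + 2) (b j) =
        b i * (qAdIter (b i) z (n + 1) (b j) - triIter (b i) (ev f) z β (n + 1) (b j)) -
        z (n + 1) • ((qAdIter (b i) z (n + 1) (b j) -
          triIter (b i) (ev f) z β (n + 1) (b j)) * b i) +
        β (n + 1) • (triIter (b i) (ev f) z β n (b j) * ev f) := by
      rw [qAdIter_succ, triIter_add_two, mul_sub, sub_mul, smul_sub]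
      abel
    rw [h]
    exact Submodule.add_mem _ (Submodule.sub_mem _ (gen_mul_mem_filtLT i h₁)
      (Submodule.smul_mem _ _ (mul_gen_mem_filtLT hev h₁ i)))
      (Submodule.smul_mem _ _ (filtLT_mono b ev (by omega)
        (mul_ev_mem_filtLT (triIter_mem_filtLT hev i j f z β n) f)))

/-- Elements of the filtration in terms of polynomials with coefficients in the span of words. -/
theorem exists_polynomial_of_mem_filtLT {n : ℕ} {x : P} (hx : x ∈ filtLT b ev n) :
    ∃ t : (I →₀ ℕ) →₀ (List I →₀ k), (∀ a, t a ∈ wordLT k I n) ∧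
      x = t.sum fun a u => wordEval b u * ev (MvPolynomial.monomial a 1) := by
  let Ψ : ((I →₀ ℕ) →₀ (List I →₀ k)) →ₗ[k] P := Finsupp.lsum k fun a =>
    LinearMap.mulRight k (ev (MvPolynomial.monomial a 1)) ∘ₗ wordEval b
  -- The admissible coefficient families form a subspace, so it suffices to hit each spanning
  -- product of the filtration.
  let R : Submodule k ((I →₀ ℕ) →₀ (List I →₀ k)) :=
    ⨅ a, (wordLT k I n).comap (Finsupp.lapply a)
  have key : x ∈ R.map Ψ := by
    refine filtLT_le_comap b ev (g := LinearMap.id) (fun w f hw => ?_) hx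
    rw [LinearMap.id_apply, f.as_sum, map_sum, Finset.mul_sum]
    refine Submodule.sum_mem _ fun a _ => ?_
    refine ⟨Finsupp.single a (Finsupp.single w (f.coeff a)), ?_, ?_⟩
    · simp only [R, SetLike.mem_coe, Submodule.mem_iInf, Submodule.mem_comap]
      intro a'
      classical
      rw [Finsupp.lapply_apply, Finsupp.single_apply]
      split_ifs
      · exact single_mem_wordLT hw _
      · exact Submodule.zero_mem _
    · have : MvPolynomial.monomial a (f.coeff a) = f.coeff a • MvPolynomial.monomial a (1 : k) := by
        rw [MvPolynomial.smul_monomial, smul_eq_mul, mul_one]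
      rw [Finsupp.lsum_single, LinearMap.comp_apply, LinearMap.mulRight_apply, wordEval_single,
        this, map_smul, mul_smul_comm, smul_mul_assoc]
  obtain ⟨t, ht, rfl⟩ := key
  refine ⟨t, fun a => ?_, rfl⟩
  exact (Submodule.mem_iInf _).1 ht a

section Descent

variable [Fintype I] [DecidableEq I] {D : CartanDatum I} {q : I → k}

/-- Spanning vectors of the Serre ideal are homogeneous, so the projection keeps or kills them. A
kept one evaluates to a Serre element in the b's between two words, and `hS` puts that element
strictly below its formal degree. -/
theorem wordEval_wordProj_mem_filtLT (hev : ∀ i f, ∃ f', ev f * b i = b i * ev f')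
    (hS : ∀ i j, i ≠ j → ∀ N : ℕ, D.c i j = -N →
      qAdIter (b i) (D.serreExp q i j) (N + 1) (b j) ∈ filtLT b ev (N + 2)) (n : ℕ)
    {x : List I →₀ k} (hx : x ∈ serreIdeal D q) :
    wordEval b (wordProj k I n x) ∈ filtLT b ev n := by
  induction hx using Submodule.span_induction with
  | mem x hx =>
    obtain ⟨u, i, j, v, hij, rfl⟩ := hx
    obtain ⟨N, hN⟩ := D.exists_c_eq_neg hij
    have hv : Finsupp.single v (1 : k) ∈ Finsupp.supported k k {w : List I | w.length = v.length} :=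
      Finsupp.single_mem_supported k _ rfl
    rw [wordSerre_eq hN, wordProj_of_mem (map_wordF_prod_mem_homogeneous u
      (qAdIter_wordF_mem_homogeneous i j (D.serreExp q i j) (N + 1) hv))]
    split_ifs with h
    · rw [wordEval_prod, wordEval_qAdIter, wordEval_single, one_smul]
      have := prod_mul_mem_filtLT_add u (mul_prod_mem_filtLT hev (hS i j hij N hN) v)
      exact filtLT_mono b ev (by omega) this
    · rw [map_zero]
      exact Submodule.zero_mem _
  | zero => rw [map_zero, map_zero]; exact Submodule.zero_mem _
  | add x y _ _ hx hy => rw [map_add, map_add]; exact Submodule.add_mem _ hx hy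
  | smul a x _ hx => rw [map_smul, map_smul]; exact Submodule.smul_mem _ _ hx

end Descent

/-- An element of the filtration is zero if it is killed by sufficiently many functionals with
triangular values on the words. -/
theorem eq_zero_of_mem_filtLT [Infinite k] {J : Submodule k (List I →₀ k)}
    (hproj : ∀ n, ∀ x ∈ J, wordEval b (wordProj k I n x) ∈ filtLT b ev n)
    (v : (I → kˣ) → P →ₗ[k] (List I →₀ k) ⧸ J)
    (hv : ∀ χ (w : List I) (f : MvPolynomial I k), v χ ((w.map b).prod * ev f) -
      MvPolynomial.eval (fun i => (χ i : k)) f • J.mkQ (Finsupp.single w 1) ∈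
      (wordLT k I w.length).map J.mkQ) {n : ℕ} {x : P} (hx : x ∈ filtLT b ev n)
    (h0 : ∀ χ, v χ x = 0) : x = 0 := by
  induction n with
  | zero => simpa [filtLT_zero] using hx
  | succ n ih =>
    -- It suffices to lower the filtration degree by one.
    refine ih ?_
    obtain ⟨t, ht, rfl⟩ := exists_polynomial_of_mem_filtLT hx
    -- Up to shorter words, applying v χ gives the value at χ of the polynomial with coefficients t
    -- a. It vanishes for every χ, so each coefficient is short modulo J.
    have hmem : ∀ a, J.mkQ (t a) ∈ (wordLT k I n).map J.mkQ := by
      intro a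
      have := mem_of_forall_eval_mem ((wordLT k I n).map J.mkQ)
        (t.mapRange J.mkQ (map_zero _)) (fun χ => ?_) a
      · rwa [Finsupp.mapRange_apply] at this
      rw [Finsupp.sum_mapRange_index (fun _ => smul_zero _)]
      have hd : ∀ a, v χ (wordEval b (t a) * ev (MvPolynomial.monomial a 1)) -
          MvPolynomial.eval (fun i => (χ i : k)) (MvPolynomial.monomial a 1) • J.mkQ (t a) ∈
          (wordLT k I n).map J.mkQ := by
        intro a
        refine wordLT_le_comap (f := v χ ∘ₗ LinearMap.mulRight k (ev (MvPolynomial.monomial a 1)) ∘ₗ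
          wordEval b - MvPolynomial.eval (fun i => (χ i : k)) (MvPolynomial.monomial a 1) • J.mkQ)
          (fun w hw => ?_) (ht a)
        rw [LinearMap.sub_apply, LinearMap.comp_apply, LinearMap.comp_apply,
          LinearMap.mulRight_apply, wordEval_single, one_smul, LinearMap.smul_apply]
        exact Submodule.map_mono (wordLT_mono (Nat.lt_succ_iff.1 hw)) (hv χ w _)
      have hsum := Submodule.sum_mem _ fun a (_ : a ∈ t.support) => hd a
      rw [Finset.sum_sub_distrib, ← map_sum] at hsum
      have h00 := h0 χ
      rw [Finsupp.sum] at h00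
      rw [h00, zero_sub] at hsum
      exact (Submodule.neg_mem_iff _).1 hsum
    refine Submodule.sum_mem _ fun a _ => mul_ev_mem_filtLT ?_ _
    -- Split t a into a short part l and an element of J. The latter has a top component of length
    -- n, whose evaluation drops by `hproj`, and a remainder that is short already.
    obtain ⟨l, hl, hlt⟩ := hmem a
    have hJ : t a - l ∈ J := (Submodule.Quotient.eq J).1 hlt.symm
    have hj : t a - l ∈ wordLT k I (n + 1) :=
      Submodule.sub_mem _ (ht a) (wordLT_mono (Nat.le_succ n) hl)
    have e : t a = l + ((t a - l - wordProj k I n (t a - l)) + wordProj k I n (t a - l)) := by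
      rw [sub_add_cancel, add_sub_cancel]
    rw [e, map_add, map_add]
    exact Submodule.add_mem _ (wordEval_mem_filtLT hl) (Submodule.add_mem _
      (wordEval_mem_filtLT (sub_wordProj_mem hj)) (hproj n _ hJ))


/-- Left multiplication by a generator raises the degree by at most one; products are then applied
to 1. -/
theorem exists_mem_filtLT (hev : ∀ i f, ∃ f', ev f * b i = b i * ev f') {κ : I → P}
    (hX : ∀ i, ev (MvPolynomial.X i) = κ i) {x : P}
    (hx : x ∈ Algebra.adjoin k (Set.range b ∪ Set.range κ)) : ∃ n, x ∈ filtLT b ev n := by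
  have hone : (1 : P) ∈ filtLT b ev 1 := by
    have := prod_mul_mem_filtLT (b := b) (ev := ev) (w := []) (n := 1) (by simp) 1
    simpa using this
  suffices h : ∀ n, ∀ y ∈ filtLT b ev n, ∃ m, x * y ∈ filtLT b ev m by
    simpa using h 1 1 hone
  induction hx using Algebra.adjoin_induction with
  | mem x hx =>
    rintro n y hy
    rcases hx with ⟨i, rfl⟩ | ⟨i, rfl⟩
    · exact ⟨n + 1, gen_mul_mem_filtLT i hy⟩
    · exact ⟨n, hX i ▸ ev_mul_mem_filtLT hev _ hy⟩
  | algebraMap r =>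
    intro n y hy
    refine ⟨n, ?_⟩
    rw [← Algebra.smul_def]
    exact Submodule.smul_mem _ _ hy
  | add x x' _ _ hx hx' =>
    intro n y hy
    obtain ⟨m, hm⟩ := hx n y hy
    obtain ⟨m', hm'⟩ := hx' n y hy
    refine ⟨max m m', ?_⟩
    rw [add_mul]
    exact Submodule.add_mem _ (filtLT_mono b ev (le_max_left _ _) hm)
      (filtLT_mono b ev (le_max_right _ _) hm')
  | mul x x' _ _ hx hx' =>
    intro n y hy
    obtain ⟨m', hm'⟩ := hx' n y hy
    obtain ⟨m, hm⟩ := hx m' _ hm'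
    exact ⟨m, by rwa [mul_assoc]⟩

open scoped IsMulCommutative in
/-- Commuting elements of an algebra extend to a homomorphism from polynomials. -/
theorem exists_evalHom {κ : I → P} (h : ∀ i j, κ i * κ j = κ j * κ i) :
    ∃ ev : MvPolynomial I k →ₐ[k] P, ∀ i, ev (MvPolynomial.X i) = κ i := by
  have hc : ∀ x ∈ Set.range κ, ∀ y ∈ Set.range κ, x * y = y * x := by
    rintro _ ⟨i, rfl⟩ _ ⟨j, rfl⟩
    exact h i j
  have := Algebra.isMulCommutative_adjoin k hc
  let κ' : I → Algebra.adjoin k (Set.range κ) := fun i => ⟨κ i, Algebra.subset_adjoin ⟨i, rfl⟩⟩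
  refine ⟨(Algebra.adjoin k (Set.range κ)).val.comp (MvPolynomial.aeval (R := k) κ'), fun i => ?_⟩
  simp [κ']

end Filtration

theorem vacuum_eval {k I V P : Type*} [Field k] [AddCommGroup V] [Module k V] [Ring P] [Algebra k P]
    (ρ : P →ₐ[k] Module.End k V) (ev : MvPolynomial I k →ₐ[k] P) (χ : I → k) (v : V)
    (h : ∀ i, ρ (ev (MvPolynomial.X i)) v = χ i • v) (f : MvPolynomial I k) :
    ρ (ev f) v = MvPolynomial.eval χ f • v := by
  induction f using MvPolynomial.induction_on with
  | C a =>
    have : ev (MvPolynomial.C a) = algebraMap k P a := ev.commutes a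
    rw [this, AlgHom.commutes, MvPolynomial.eval_C]
    rfl
  | add f g hf hg =>
    rw [map_add, map_add, LinearMap.add_apply, hf, hg, map_add, add_smul]
  | mul_X f j hf =>
    rw [map_mul, map_mul, Module.End.mul_apply, h, map_smul, hf, map_mul, MvPolynomial.eval_X,
      smul_smul, mul_comm]

theorem wordWeight_nil {k I : Type*} [Field k] (a : I → k) (x : k) : wordWeight a x [] = x :=
  one_mul x

namespace DiagramInvolution

/-! ### Injectivity of the first projection on pairs -/

section Faithful

variable {k : Type*} [Field k] {I : Type*} [Fintype I] [DecidableEq I] {D : CartanDatum I}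
  {q : I → k} {A : Type*} [Ring A] [Algebra k A] {E F K K' : I → A} (T : DiagramInvolution D)

/-- In each of the three relations the iterated commutator, formally of degree N + 2, equals terms
with at most N + 1 factors B: the lower terms of a continuant if τ i = i, B_i^N times a Cartan
element if τ i = j, zero otherwise. -/
theorem pair_serre_mem_filtLT (h : DoubleRelations D q E F K K') (hq : T.IsParam q)
    {ev : MvPolynomial I k →ₐ[k] A × Aᵐᵒᵖ} (hX : ∀ i, ev (MvPolynomial.X i) = T.pairK K K' i)
    {i j : I} (hij : i ≠ j) {N : ℕ} (hN : D.c i j = -N) :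
    qAdIter (T.pairB E F K' i) (D.serreExp q i j) (N + 1) (T.pairB E F K' j) ∈
      filtLT (T.pairB E F K') ev (N + 2) := by
  by_cases hi : T.τ i = i
  · have hd := qAdIter_sub_triIter_mem_filtLT (exists_ev_of_qComm hX (T.pairK_pairB h hq)) i j
      (MvPolynomial.X i) (D.serreExp q i j) (D.diagCoeff q i j) (N + 1)
    rwa [hX, T.pair_serreRelation_fixed h hq hij hi hN, sub_zero] at hd
  by_cases hj : T.τ i = j
  · subst hj
    have hmem : ∀ l, T.pairB E F K' i ^ N * T.pairK K K' l ∈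
        filtLT (T.pairB E F K') ev (N + 2) := by
      intro l
      have := prod_mul_mem_filtLT (b := T.pairB E F K') (ev := ev) (w := List.replicate N i)
        (n := N + 2) (by simp) (MvPolynomial.X l)
      rwa [List.map_replicate, List.prod_replicate, hX] at this
    rw [T.pair_serreRelation_tau h hq hi hN]
    exact Submodule.smul_mem _ _ (Submodule.sub_mem _ (Submodule.smul_mem _ _ (hmem _))
      (Submodule.smul_mem _ _ (hmem _)))
  · rw [T.pair_serreRelation_of_ne h hq hij hi hj hN]
    exact Submodule.zero_mem _

/-- The values on the vacuum of products of the elements `B_i` are triangular. -/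
theorem vacuum_iB_prod {V : Type*} [AddCommGroup V] [Module k V] (ρ : A →ₐ[k] Module.End k V)
    (χ : I → k) (π : (List I →₀ k) →ₗ[k] V)
    (hE : ∀ i x, ρ (E i) (π x) = π (wordE D q χ i x)) (hF : ∀ i x, ρ (F i) (π x) = π (wordF k i x))
    (hK' : ∀ i x, ρ (K' i) (π x) = π (wordK' D q i x)) (w : List I) :
    ρ (w.map (T.iB E F K')).prod (π (Finsupp.single [] 1)) - π (Finsupp.single w 1) ∈
      (wordLT k I w.length).map π := by
  induction w with
  | nil => simp
  | cons i w ih =>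
    obtain ⟨l, hl, hlw⟩ := ih
    have hB : ∀ x, ρ (T.iB E F K' i) (π x) =
        π (wordF k i x + wordE D q χ (T.τ i) (wordK' D q i x)) := by
      intro x
      rw [iB, map_add, map_mul, LinearMap.add_apply, Module.End.mul_apply, hF, hK', hE, map_add]
    rw [← eq_sub_iff_add_eq.2 (sub_add_cancel _ _)] at hlw
    have hw : ρ (w.map (T.iB E F K')).prod (π (Finsupp.single [] 1)) =
        π (l + Finsupp.single w 1) := by rw [map_add, hlw, sub_add_cancel]
    refine ⟨wordF k i l + wordE D q χ (T.τ i) (wordK' D q i (l + Finsupp.single w 1)), ?_, ?_⟩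
    · refine Submodule.add_mem _ (wordF_mem_wordLT i hl) (wordE_mem_wordLT _ _ _ _
        (wordDiag_mem_wordLT _ (Submodule.add_mem _ (wordLT_mono (Nat.le_succ _) hl)
          (single_mem_wordLT (Nat.lt_succ_self _) _))))
    · rw [List.map_cons, List.prod_cons, map_mul, Module.End.mul_apply, hw, hB,
        map_add (wordF k i), wordF_single, ← map_sub]
      congr 1
      abel

/-- The first projection is injective on the algebra generated by the pairs, provided that the
Verma modules are representations. -/
theorem eq_zero_of_mem_adjoin_pair [Infinite k] (h : DoubleRelations D q E F K K')
    (hq : T.IsParam q)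
    (hρ : ∀ χ : I → kˣ, ∃ ρ : A →ₐ[k] Module.End k ((List I →₀ k) ⧸ serreIdeal D q),
      (∀ i x, ρ (E i) (Submodule.Quotient.mk x) =
        Submodule.Quotient.mk (wordE D q (fun i => (χ i : k)) i x)) ∧
      (∀ i x, ρ (F i) (Submodule.Quotient.mk x) = Submodule.Quotient.mk (wordF k i x)) ∧
      (∀ i x, ρ (K i) (Submodule.Quotient.mk x) =
        Submodule.Quotient.mk (wordK D q (fun i => (χ i : k)) i x)) ∧
      (∀ i x, ρ (K' i) (Submodule.Quotient.mk x) = Submodule.Quotient.mk (wordK' D q i x)))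
    {x : A × Aᵐᵒᵖ}
    (hx : x ∈ Algebra.adjoin k (Set.range (T.pairB E F K') ∪ Set.range (T.pairK K K')))
    (h1 : x.1 = 0) : x = 0 := by
  obtain ⟨ev, hX⟩ := exists_evalHom (k := k) (T.pairK_pairK h)
  have hev := exists_ev_of_qComm hX (T.pairK_pairB h hq)
  obtain ⟨n, hn⟩ := exists_mem_filtLT hev hX hx
  choose ρ hE hF hK hK' using hρ
  let vac : (List I →₀ k) ⧸ serreIdeal D q := (serreIdeal D q).mkQ (Finsupp.single [] 1)
  refine eq_zero_of_mem_filtLT (J := serreIdeal D q)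
    (fun n x hx => wordEval_wordProj_mem_filtLT hev
      (fun i j hij N hN => T.pair_serre_mem_filtLT h hq hX hij hN) n hx)
    (fun χ => LinearMap.applyₗ vac ∘ₗ
      ((ρ χ).comp (AlgHom.fst k A Aᵐᵒᵖ)).toLinearMap) ?_ hn ?_
  · intro χ w f
    have hk : ∀ i, (ρ χ).comp (AlgHom.fst k A Aᵐᵒᵖ) (ev (MvPolynomial.X i)) vac =
        (χ i : k) • vac := by
      intro i
      rw [hX]
      -- On the vacuum K' acts by 1 and K_i by χ_i, so the k_i take arbitrary nonzero values
      -- independently.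
      change ρ χ (K i * K' (T.τ i)) (Submodule.Quotient.mk _) = _
      rw [map_mul, Module.End.mul_apply, hK', hK, wordK', wordK, wordDiag_single, map_smul,
        wordDiag_single, wordWeight_nil, wordWeight_nil, one_smul]
      rfl
    have he := vacuum_eval ((ρ χ).comp (AlgHom.fst k A Aᵐᵒᵖ)) ev (fun i => (χ i : k)) vac hk f
    have hfst : ((w.map (T.pairB E F K')).prod).1 = (w.map (T.iB E F K')).prod := by
      induction w with
      | nil => rfl
      | cons i w ih => simp only [List.map_cons, List.prod_cons, Prod.fst_mul, ih]; rfl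
    have := T.vacuum_iB_prod (ρ χ) (fun i => (χ i : k)) (serreIdeal D q).mkQ (hE χ) (hF χ) (hK' χ) w
    change (ρ χ).comp (AlgHom.fst k A Aᵐᵒᵖ) ((w.map (T.pairB E F K')).prod * ev f) vac - _ ∈ _
    rw [map_mul, Module.End.mul_apply, he, map_smul, ← smul_sub]
    refine Submodule.smul_mem _ _ ?_
    rw [← hfst] at this
    exact this
  · intro χ
    change ρ χ x.1 vac = 0
    rw [h1, map_zero]
    rfl

end Faithful

/-! ### Construction of the anti-involution -/

section AntiInvolution

open MulOpposite

variable {k : Type*} [Field k] {I : Type*} {S : Type*} [Ring S] [Algebra k S]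

/-- An anti-involution given on generators by a subalgebra of pairs on which the first projection
is injective. -/
theorem existsUnique_antiInvolution {B κ : I → S} {τ : I → I} (hτ : ∀ i, τ (τ i) = i)
    (htop : Algebra.adjoin k (Set.range B ∪ Set.range κ) = ⊤)
    (hinj : ∀ x ∈ Algebra.adjoin k (Set.range (fun i => ((B i, op (B i)) : S × Sᵐᵒᵖ)) ∪
      Set.range (fun i => ((κ i, op (κ (τ i))) : S × Sᵐᵒᵖ))), x.1 = 0 → x = 0) :
    ∃! σ : S →ₐ[k] Sᵐᵒᵖ, (∀ x, (σ (σ x).unop).unop = x) ∧ (∀ i, (σ (B i)).unop = B i) ∧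
      ∀ i, (σ (κ i)).unop = κ (τ i) := by
  set Γ := Algebra.adjoin k (Set.range (fun i => ((B i, op (B i)) : S × Sᵐᵒᵖ)) ∪
      Set.range (fun i => ((κ i, op (κ (τ i))) : S × Sᵐᵒᵖ)))
  let b : I → Γ := fun i => ⟨(B i, op (B i)), Algebra.subset_adjoin (Or.inl ⟨i, rfl⟩)⟩
  let c : I → Γ := fun i => ⟨(κ i, op (κ (τ i))), Algebra.subset_adjoin (Or.inr ⟨i, rfl⟩)⟩
  let p : Γ →ₐ[k] S := (AlgHom.fst k S Sᵐᵒᵖ).comp Γ.val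
  have hp : Function.Bijective p := by
    constructor
    · rw [injective_iff_map_eq_zero]
      exact fun x hx => Subtype.ext (hinj x.1 x.2 hx)
    · rw [← AlgHom.range_eq_top, eq_top_iff, ← htop, Algebra.adjoin_le_iff]
      rintro _ (⟨i, rfl⟩ | ⟨i, rfl⟩)
      · exact ⟨b i, rfl⟩
      · exact ⟨c i, rfl⟩
  let e : Γ ≃ₐ[k] S := AlgEquiv.ofBijective p hp
  -- The subalgebra of pairs is the graph of the map sought.
  let σ : S →ₐ[k] Sᵐᵒᵖ := ((AlgHom.snd k S Sᵐᵒᵖ).comp Γ.val).comp e.symm.toAlgHom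
  have hB : ∀ i, (σ (B i)).unop = B i := by
    intro i
    have : e.symm (B i) = b i := (AlgEquiv.symm_apply_eq e).2 rfl
    change ((e.symm (B i)).1.2).unop = B i
    rw [this]; rfl
  have hκ : ∀ i, (σ (κ i)).unop = κ (τ i) := by
    intro i
    have : e.symm (κ i) = c i := (AlgEquiv.symm_apply_eq e).2 rfl
    change ((e.symm (κ i)).1.2).unop = κ (τ i)
    rw [this]; rfl
  have hinv : ∀ x, (σ (σ x).unop).unop = x := by
    intro x
    have hx : x ∈ Algebra.adjoin k (Set.range B ∪ Set.range κ) := htop ▸ Algebra.mem_top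
    induction hx using Algebra.adjoin_induction with
    | mem x hx =>
      rcases hx with ⟨i, rfl⟩ | ⟨i, rfl⟩
      · rw [hB, hB]
      · rw [hκ, hκ, hτ]
    | algebraMap r => simp
    | add x y _ _ hx hy => rw [map_add, unop_add, map_add, unop_add, hx, hy]
    | mul x y _ _ hx hy => rw [map_mul, unop_mul, map_mul, unop_mul, hx, hy]
  refine ⟨σ, ⟨hinv, hB, hκ⟩, ?_⟩
  rintro σ' ⟨-, hB', hκ'⟩
  refine AlgHom.ext_of_adjoin_eq_top htop ?_
  rintro _ (⟨i, rfl⟩ | ⟨i, rfl⟩)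
  · exact unop_injective ((hB' i).trans (hB i).symm)
  · exact unop_injective ((hκ' i).trans (hκ i).symm)

/-- The inclusion of U × Uᵐᵒᵖ into A × Aᵐᵒᵖ is injective and carries generating pairs to generating
pairs, so the question may be settled in the ambient algebra. -/
theorem eq_zero_of_mem_adjoin_pair_subalgebra {A : Type*} [Ring A] [Algebra k A]
    (U : Subalgebra k A) {B κ : I → U} {τ : I → I}
    (hinj : ∀ x ∈ Algebra.adjoin k (Set.range (fun i => (((B i : A), op (B i : A)) : A × Aᵐᵒᵖ)) ∪
      Set.range (fun i => (((κ i : A), op (κ (τ i) : A)) : A × Aᵐᵒᵖ))), x.1 = 0 → x = 0)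
    {x : U × Uᵐᵒᵖ} (hx : x ∈ Algebra.adjoin k (Set.range (fun i => ((B i, op (B i)) : U × Uᵐᵒᵖ)) ∪
      Set.range (fun i => ((κ i, op (κ (τ i))) : U × Uᵐᵒᵖ)))) (h1 : x.1 = 0) : x = 0 := by
  let φ : U × Uᵐᵒᵖ →ₐ[k] A × Aᵐᵒᵖ := AlgHom.prodMap U.val (AlgHom.op U.val)
  have hφ : φ x = 0 := by
    refine hinj _ ?_ (congrArg U.val h1 |>.trans (map_zero _))
    have h : Algebra.adjoin k (Set.range (fun i => ((B i, op (B i)) : U × Uᵐᵒᵖ)) ∪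
        Set.range (fun i => ((κ i, op (κ (τ i))) : U × Uᵐᵒᵖ))) ≤ (Algebra.adjoin k
        (Set.range (fun i => (((B i : A), op (B i : A)) : A × Aᵐᵒᵖ)) ∪
        Set.range (fun i => (((κ i : A), op (κ (τ i) : A)) : A × Aᵐᵒᵖ)))).comap φ := by
      rw [Algebra.adjoin_le_iff]
      rintro _ (⟨i, rfl⟩ | ⟨i, rfl⟩)
      · exact Algebra.subset_adjoin (Or.inl ⟨i, rfl⟩)
      · exact Algebra.subset_adjoin (Or.inr ⟨i, rfl⟩)
    exact h hx
  refine Prod.ext h1 (unop_injective (Subtype.ext ?_))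
  exact congrArg (fun y : A × Aᵐᵒᵖ => y.2.unop) hφ

theorem adjoin_subalgebra_eq_top {A : Type*} [Ring A] [Algebra k A] (U : Subalgebra k A)
    {b c : I → A} (hU : U = Algebra.adjoin k (Set.range b ∪ Set.range c)) {B κ : I → U}
    (hB : ∀ i, (B i : A) = b i) (hκ : ∀ i, (κ i : A) = c i) :
    Algebra.adjoin k (Set.range B ∪ Set.range κ) = ⊤ := by
  subst hU
  rw [← Algebra.adjoin_adjoin_coe_preimage]
  congr 1
  ext x
  constructor
  · rintro (⟨i, rfl⟩ | ⟨i, rfl⟩)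
    · exact Or.inl ⟨i, (hB i).symm⟩
    · exact Or.inr ⟨i, (hκ i).symm⟩
  · rintro (⟨i, hi⟩ | ⟨i, hi⟩)
    · exact Or.inl ⟨i, Subtype.ext ((hB i).trans hi)⟩
    · exact Or.inr ⟨i, Subtype.ext ((hκ i).trans hi)⟩

/-- The anti-involution of the subalgebra generated by the elements `B_i` and `k_i`, provided that
the Verma modules are representations. -/
theorem existsUnique_antiInvolution_subalgebra [Fintype I] [DecidableEq I] {D : CartanDatum I}
    {q : I → k} {A : Type*} [Ring A] [Algebra k A] {E F K K' : I → A} (T : DiagramInvolution D)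
    [Infinite k] (h : DoubleRelations D q E F K K') (hq : T.IsParam q)
    (hρ : ∀ χ : I → kˣ, ∃ ρ : A →ₐ[k] Module.End k ((List I →₀ k) ⧸ serreIdeal D q),
      (∀ i x, ρ (E i) (Submodule.Quotient.mk x) =
        Submodule.Quotient.mk (wordE D q (fun i => (χ i : k)) i x)) ∧
      (∀ i x, ρ (F i) (Submodule.Quotient.mk x) = Submodule.Quotient.mk (wordF k i x)) ∧
      (∀ i x, ρ (K i) (Submodule.Quotient.mk x) =
        Submodule.Quotient.mk (wordK D q (fun i => (χ i : k)) i x)) ∧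
      (∀ i x, ρ (K' i) (Submodule.Quotient.mk x) = Submodule.Quotient.mk (wordK' D q i x)))
    (U : Subalgebra k A)
    (hU : U = Algebra.adjoin k (Set.range (T.iB E F K') ∪ Set.range (T.ik K K'))) {B κ : I → U}
    (hB : ∀ i, (B i : A) = T.iB E F K' i) (hκ : ∀ i, (κ i : A) = T.ik K K' i) :
    ∃! σ : U →ₐ[k] Uᵐᵒᵖ, (∀ x, (σ (σ x).unop).unop = x) ∧ (∀ i, (σ (B i)).unop = B i) ∧
      ∀ i, (σ (κ i)).unop = κ (T.τ i) := by
  refine existsUnique_antiInvolution T.invol (adjoin_subalgebra_eq_top U hU hB hκ) fun x hx =>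
    eq_zero_of_mem_adjoin_pair_subalgebra U (fun y hy => ?_) hx
  simp only [hB, hκ] at hy
  exact T.eq_zero_of_mem_adjoin_pair h hq hρ hy

end AntiInvolution

end DiagramInvolution

/-! ### Higher Serre sums: recursion and closed coefficients -/

section HigherSerre

variable {k : Type*} [Field k]

/-- Halved exponents are compared through their differences, so that their evenness never has to be
shown. -/
theorem half_add_of_eq {a b y : ℤ} (h : a = b + 2 * y) : a / 2 = b / 2 + y := by omega

theorem QGeneric.zpow_sub_zpow_neg {q : k} (hq : QGeneric q) (n : ℤ) :
    q ^ n - q ^ (-n) = (q - q⁻¹) * qInt q n := by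
  rw [qInt, mul_div_cancel₀ _ hq.sub_inv_ne_zero']

theorem QGeneric.zpow_sub_zpow {q : k} (hq : QGeneric q) {a b s n : ℤ} (ha : a = s + n)
    (hb : b = s - n) : q ^ a - q ^ b = q ^ s * ((q - q⁻¹) * qInt q n) := by
  rw [← hq.zpow_sub_zpow_neg, mul_sub, ← zpow_add₀ hq.ne_zero, ← zpow_add₀ hq.ne_zero, ha, hb,
    sub_eq_add_neg s]

/-- The product of `u - Q ^ (2 j - c - 2 m + 2)` over `0 ≤ j ≤ c + m - 2`. -/
def twistProd (Q u : k) (c : ℤ) (m : ℕ) : k :=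
  ∏ j ∈ Finset.range (c + m - 1).toNat, (-Q ^ (2 * (j : ℤ) - c - 2 * m + 2) + u)

variable {c : ℤ} {N : ℕ}

theorem twistProd_base (Q u : k) (hc : c = -N) : twistProd Q u c (N + 1) = 1 := by
  rw [twistProd, show (c + (N + 1 : ℕ) - 1).toNat = 0 by omega, Finset.prod_range_zero]

/-- The new factor sits at j = 0; the others are the old ones with j shifted by one. -/
theorem twistProd_succ (Q u : k) (hc : c = -N) {m : ℕ} (hm : N + 1 ≤ m) :
    twistProd Q u c (m + 1) = twistProd Q u c m * (u - Q ^ (-c - 2 * m)) := by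
  rw [twistProd, twistProd, show (c + (m + 1 : ℕ) - 1).toNat = (c + m - 1).toNat + 1 by omega,
    Finset.prod_range_succ']
  congr 1
  · refine Finset.prod_congr rfl fun j _ => ?_
    congr 3
    push_cast
    ring
  · rw [neg_add_eq_sub]
    congr 2
    push_cast
    ring

/-- The factor at j = c + m - 2 is u - Q^{c-2}. It is present as soon as m > 1 - c, being the factor
gained in the first step of the recursion. -/
theorem twistProd_eq_zero (Q : k) {u : k} (hc : c = -N) {m : ℕ} (hm : N + 1 < m)
    (hu : u = Q ^ (c - 2)) : twistProd Q u c m = 0 := by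
  refine Finset.prod_eq_zero (i := (c + m - 2).toNat) (Finset.mem_range.2 (by omega)) ?_
  rw [hu, neg_add_eq_zero]
  congr 1
  omega

/-- Each factor is q^{-(l+2)}(q - q⁻¹)[l+2]. -/
theorem prod_one_sub_inv_pow {q : k} (hq : QGeneric q) (N : ℕ) :
    ∏ l ∈ Finset.range N, (1 - ((q ^ 2)⁻¹) ^ (l + 2)) =
      q ^ ((-(N : ℤ) ^ 2 - 3 * N) / 2) * (q - q⁻¹) ^ N * qFact q (N + 1) := by
  induction N with
  | zero => simp [qFact_succ, qFact_zero, qInt_one hq]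
  | succ N ih =>
    have e : (1 : k) - ((q ^ 2)⁻¹) ^ (N + 2) =
        q ^ (-(N + 2 : ℤ)) * ((q - q⁻¹) * qInt q (N + 2 : ℕ)) := by
      have h := hq.zpow_sub_zpow (a := 0) (b := -2 * (N + 2)) (s := -(N + 2)) (n := (N + 2 : ℕ))
        (by push_cast; ring) (by push_cast; ring)
      rw [← h, zpow_zero, zpow_mul, zpow_neg]
      norm_cast
    rw [Finset.prod_range_succ, ih, e, half_add_of_eq (a := -((N + 1 : ℕ) : ℤ) ^ 2 - 3 * (N + 1 : ℕ))
      (b := -(N : ℤ) ^ 2 - 3 * N)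
      (y := -(N + 2)) (by push_cast; ring), zpow_add₀ hq.ne_zero, qFact_succ q (N + 1)]
    ring

/-- Each factor is -q^{l+2}(q - q⁻¹)[l+2]; the prefactor q^{-N} is the q_i^c of the base relation.
-/
theorem prod_one_sub_pow {q : k} (hq : QGeneric q) (N : ℕ) :
    q ^ (-(N : ℤ)) * ∏ l ∈ Finset.range N, (1 - (q ^ 2) ^ (l + 2)) =
      (-1) ^ N * q ^ (((N : ℤ) ^ 2 + N) / 2) * (q - q⁻¹) ^ N * qFact q (N + 1) := by
  induction N with
  | zero => simp [qFact_succ, qFact_zero, qInt_one hq]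
  | succ N ih =>
    have e : (1 : k) - (q ^ 2) ^ (N + 2) =
        -(q ^ (N + 2 : ℤ) * ((q - q⁻¹) * qInt q (N + 2 : ℕ))) := by
      have h := hq.zpow_sub_zpow (b := 0) (a := 2 * (N + 2)) (s := N + 2) (n := (N + 2 : ℕ))
        (by push_cast; ring) (by push_cast; ring)
      rw [← h, neg_sub, zpow_zero, zpow_mul]
      norm_cast
    rw [Finset.prod_range_succ, ← mul_assoc, show (-((N + 1 : ℕ) : ℤ)) = -(N : ℤ) + -1 by
      push_cast; ring, zpow_add₀ hq.ne_zero, mul_right_comm (q ^ (-(N : ℤ))), ih, e,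
      half_add_of_eq (a := ((N + 1 : ℕ) : ℤ) ^ 2 + (N + 1 : ℕ)) (b := (N : ℤ) ^ 2 + N) (y := N + 1) (by push_cast; ring),
      zpow_add₀ hq.ne_zero _ (N + 1 : ℤ), qFact_succ q (N + 1),
      show (N + 2 : ℤ) = (N + 1) + 1 by ring, zpow_add_one₀ hq.ne_zero, zpow_neg_one]
    have hqq := mul_inv_cancel₀ hq.ne_zero
    generalize q - q⁻¹ = d
    linear_combination (-((-1) ^ N * q ^ (((N : ℤ) ^ 2 + N) / 2) * q ^ (N + 1 : ℤ) * d ^ (N + 1) *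
      qFact q (N + 1) * qInt q (N + 1 + 1 : ℕ))) * hqq

/-- The closed form of the coefficient at `B_i^{(m-1)} k_{τ i}` for `e = 1`. -/
theorem twistProd_closed {q : k} (hq : QGeneric q) (hc : c = -N) {m : ℕ} (hm : N + 1 ≤ m) :
    qFact q (N + 1) * (q - q⁻¹) ^ (-c - 1) * twistProd q (q ^ (2 - c)) c m *
        q ^ ((c ^ 2 - c) / 2) =
      qFact q m * (q - q⁻¹) ^ ((m : ℤ) - 2) * q ^ ((1 - (m : ℤ)) * ((m : ℤ) - 2 + 2 * c) / 2) := by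
  induction m, hm using Nat.le_induction with
  | base =>
    rw [twistProd_base q _ hc, mul_one]
    congr 3
    · push_cast; rw [hc]; ring
    · push_cast; rw [hc]; ring
  | succ m hm ih =>
    have e := hq.zpow_sub_zpow (a := 2 - c) (b := -c - 2 * m) (s := 1 - c - m) (n := (m + 1 : ℕ))
        (by push_cast; ring) (by push_cast; ring)
    have hx : ((m + 1 : ℕ) : ℤ) - 2 = ((m : ℤ) - 2) + 1 := by push_cast; ring
    rw [twistProd_succ q _ hc hm, e, half_add_of_eq
      (a := (1 - ((m + 1 : ℕ) : ℤ)) * (((m + 1 : ℕ) : ℤ) - 2 + 2 * c)) (b := (1 - (m : ℤ)) * ((m : ℤ) - 2 + 2 * c))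
      (y := 1 - c - m) (by push_cast; ring), zpow_add₀ hq.ne_zero, qFact_succ q m, hx,
      zpow_add_one₀ hq.sub_inv_ne_zero']
    linear_combination (q ^ (1 - c - m) * ((q - q⁻¹) * qInt q (m + 1 : ℕ))) * ih

/-- The closed form of the coefficient at `B_i^{(m-1)} k_i` for `e = -1`. -/
theorem twistProd_inv_closed {q : k} (hq : QGeneric q) (hc : c = -N) {m : ℕ} (hm : N + 1 ≤ m) :
    qFact q (N + 1) * (q - q⁻¹) ^ (-c - 1) * twistProd q⁻¹ (q ^ (c - 2)) c m *
        q ^ ((-c ^ 2 + 3 * c) / 2) =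
      (-1) ^ ((m : ℤ) + c + 1) * qFact q m * (q - q⁻¹) ^ ((m : ℤ) - 2) *
        q ^ (((m : ℤ) - 1) * ((m : ℤ) - 2 + 2 * c) / 2 + c) := by
  induction m, hm using Nat.le_induction with
  | base =>
    rw [twistProd_base _ _ hc, mul_one, show ((N + 1 : ℕ) : ℤ) + c + 1 = 2 by push_cast; omega,
      show (-1 : k) ^ (2 : ℤ) = 1 by norm_num, one_mul, ← half_add_of_eq (a := -c ^ 2 + 3 * c)
      (b := (((N + 1 : ℕ) : ℤ) - 1) * (((N + 1 : ℕ) : ℤ) - 2 + 2 * c)) (by push_cast; rw [hc]; ring)]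
    congr 3
    push_cast; rw [hc]; ring
  | succ m hm ih =>
    have e : q ^ (c - 2) - q⁻¹ ^ (-c - 2 * m) =
        -(q ^ (c + m - 1) * ((q - q⁻¹) * qInt q (m + 1 : ℕ))) := by
      rw [← hq.zpow_sub_zpow (a := c + 2 * m) (b := c - 2) (by push_cast; ring)
        (by push_cast; ring), neg_sub, inv_zpow']
      congr 2
      ring
    have hx : ((m + 1 : ℕ) : ℤ) - 2 = ((m : ℤ) - 2) + 1 := by push_cast; ring
    have hs : ((m + 1 : ℕ) : ℤ) + c + 1 = ((m : ℤ) + c + 1) + 1 := by push_cast; ring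
    rw [twistProd_succ _ _ hc hm, e, half_add_of_eq
      (a := (((m + 1 : ℕ) : ℤ) - 1) * (((m + 1 : ℕ) : ℤ) - 2 + 2 * c)) (b := ((m : ℤ) - 1) * ((m : ℤ) - 2 + 2 * c))
      (y := c + m - 1) (by push_cast; ring), add_right_comm (_ / 2), zpow_add₀ hq.ne_zero _ (c + m - 1),
      qFact_succ q m, hx, hs, zpow_add_one₀ hq.sub_inv_ne_zero', zpow_add_one₀ (by simp)]
    linear_combination (-(q ^ (c + m - 1) * ((q - q⁻¹) * qInt q (m + 1 : ℕ)))) * ih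

variable {S : Type*} [Ring S] [Algebra k S]

/-- The higher Serre sums are determined by the Serre sum for `m = 1 - c`. -/
theorem qSerre_higher {Q : k} (hQ : QGeneric Q) (hc : c = -N) {b x κ κ' : S} {u u' a a' : k}
    (hκ : QComm u κ b) (hκ' : QComm u' κ' b)
    (h0 : qSerre Q b x 1 (N + 1) = a • (divPow Q b N * κ) + a' • (divPow Q b N * κ'))
    {m : ℕ} (hm : N + 1 ≤ m) :
    qSerre Q b x (Q ^ (1 - c - m)) m = (qInt Q (N + 1 : ℕ) / qInt Q m) •
      ((a * twistProd Q u c m) • (divPow Q b (m - 1) * κ) +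
        (a' * twistProd Q u' c m) • (divPow Q b (m - 1) * κ')) := by
  have hQ0 := hQ.ne_zero
  induction m, hm using Nat.le_induction with
  | base =>
    rw [show 1 - c - (N + 1 : ℕ) = 0 by push_cast; omega, zpow_zero, h0, twistProd_base _ _ hc,
      twistProd_base _ _ hc, mul_one, mul_one, div_self (hQ.qInt_ne_zero N.succ_pos), one_smul,
      Nat.add_sub_cancel]
  | succ m hm ih =>
    obtain ⟨r, rfl⟩ : ∃ r, m = r + 1 := ⟨m - 1, by omega⟩
    have hm0 : qInt Q ((r + 1 : ℕ) : ℤ) ≠ 0 := hQ.qInt_ne_zero r.succ_pos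
    have hm1 : qInt Q ((r + 1 + 1 : ℕ) : ℤ) ≠ 0 := hQ.qInt_ne_zero (r + 1).succ_pos
    have hrec := qSerre_succ hQ b x (Q ^ (1 - c - (r + 1 + 1 : ℕ))) (r + 1)
    rw [show Q ^ (1 - c - (r + 1 + 1 : ℕ)) * Q = Q ^ (1 - c - (r + 1 : ℕ)) by
        rw [← zpow_add_one₀ hQ0]; congr 1; push_cast; ring,
      show Q ^ (1 - c - (r + 1 + 1 : ℕ)) * Q ^ (-(r + 1 : ℕ) : ℤ) =
        Q ^ (-c - 2 * (r + 1 : ℕ)) by rw [← zpow_add₀ hQ0]; congr 1; push_cast; ring, ih] at hrec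
    -- Multiplying B^{(r)}y by B on either side gives [r+1]B^{(r+1)}y, with an extra scalar v on the
    -- right. The q-commutator thus contributes the factor v - Q^{-c-2m}, and [r+1] cancels the
    -- denominator [m].
    have right : ∀ {y : S} {v : k}, QComm v y b → divPow Q b r * y * b =
        (v * qInt Q (r + 1 : ℕ)) • (divPow Q b (r + 1) * y) := by
      intro y v hy
      have hy : y * b = v • (b * y) := hy
      rw [mul_assoc, hy, mul_smul_comm, ← mul_assoc, ← divPow_succ hQ, smul_mul_assoc, smul_smul]
    have left : ∀ y : S, b * (divPow Q b r * y) = qInt Q (r + 1 : ℕ) • (divPow Q b (r + 1) * y) := by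
      intro y
      rw [← mul_assoc, ← divPow_succ' hQ, smul_mul_assoc]
    rw [← inv_smul_smul₀ hm1 (qSerre Q b x _ (r + 1 + 1)), hrec, twistProd_succ _ _ hc hm,
      twistProd_succ _ _ hc hm]
    simp only [Nat.add_sub_cancel, smul_mul_assoc, mul_smul_comm, add_mul, mul_add, right hκ,
      right hκ', left]
    have hm0' : qInt Q ((r : ℤ) + 1) ≠ 0 := by exact_mod_cast hm0
    match_scalars
    · field_simp
    · field_simp

/-- Divided powers do not see the difference between q and q⁻¹, so e enters through q^e only. -/
theorem serreSum_eq_qSerre (q : k) (b x : S) (c e : ℤ) (m : ℕ) (he : e = 1 ∨ e = -1) :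
    ∑ p ∈ Finset.HasAntidiagonal.antidiagonal m,
      ((-1 : k) ^ ((p.1 : ℤ) + c) * q ^ (e * (p.1 : ℤ) * (1 - c - (m : ℤ)))) •
        (divPow q b p.1 * x * divPow q b p.2) =
      (-1 : k) ^ c • qSerre (q ^ e) b x ((q ^ e) ^ (1 - c - m)) m := by
  have h : qSerre (q ^ e) b x ((q ^ e) ^ (1 - c - m)) m =
      qSerre q b x ((q ^ e) ^ (1 - c - m)) m := by
    rcases he with rfl | rfl
    · rw [zpow_one]
    · rw [zpow_neg_one, qSerre_inv]
  rw [h, qSerre, Finset.smul_sum]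
  refine Finset.sum_congr rfl fun p _ => ?_
  rw [smul_smul]
  congr 1
  rw [zpow_add₀ (by simp), zpow_natCast, neg_pow (_ ^ (1 - c - (m : ℤ))), ← zpow_natCast (_ ^ _) p.1, ← zpow_mul,
    ← zpow_mul, show e * (p.1 : ℤ) * (1 - c - m) = e * (1 - c - m) * p.1 by ring]
  ring_nf

end HigherSerre

/-! ### Explicit form of the higher Serre relations -/

section HigherSerreClosed

variable {k : Type*} [Field k] {c : ℤ} {N : ℕ} {S : Type*} [Ring S] [Algebra k S]

/-- The Serre sum for `m = 1 - c` in terms of divided powers. -/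
theorem CartanDatum.IsParam.qSerre_of_tauRelation {I : Type*} [Fintype I] [DecidableEq I]
    {D : CartanDatum I} {q : I → k} (hq : D.IsParam q) {i j : I} (hN : D.c i j = -N)
    {b x κ κ' : S}
    (h : qAdIter b (D.serreExp q i j) (N + 1) x = (q i - (q i)⁻¹)⁻¹ •
      ((q i ^ D.c i j * ∏ l ∈ Finset.range N, (1 - (q i ^ 2) ^ (l + 2))) • (b ^ N * κ') -
        (∏ l ∈ Finset.range N, (1 - ((q i ^ 2)⁻¹) ^ (l + 2))) • (b ^ N * κ))) :
    qSerre (q i) b x 1 (N + 1) =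
      ((-1) ^ N * (qFact (q i) (N + 1) / qInt (q i) (N + 1 : ℕ) *
        (q i - (q i)⁻¹) ^ (-D.c i j - 1) * q i ^ ((-D.c i j ^ 2 + 3 * D.c i j) / 2))) •
          (divPow (q i) b N * κ) +
      (-(qFact (q i) (N + 1) / qInt (q i) (N + 1 : ℕ) *
        (q i - (q i)⁻¹) ^ (-D.c i j - 1) * q i ^ ((D.c i j ^ 2 - D.c i j) / 2))) •
          (divPow (q i) b N * κ') := by
  have hg := hq.generic i
  have hd := hg.sub_inv_ne_zero'
  have hf := hg.qFact_ne_zero N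
  have hn := hg.qInt_ne_zero N.succ_pos
  have hb : b ^ N = qFact (q i) N • divPow (q i) b N := by
    rw [divPow, smul_smul, mul_inv_cancel₀ hf, one_smul]
  have e1 : (-D.c i j ^ 2 + 3 * D.c i j) / 2 = (-(N : ℤ) ^ 2 - 3 * N) / 2 := by
    rw [hN]; congr 1; ring
  have e2 : (D.c i j ^ 2 - D.c i j) / 2 = ((N : ℤ) ^ 2 + N) / 2 := by
    rw [hN]; congr 1; ring
  have e3 : (q i - (q i)⁻¹) ^ (-D.c i j - 1) = (q i - (q i)⁻¹) ^ N * (q i - (q i)⁻¹)⁻¹ := by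
    rw [hN, neg_neg, zpow_sub_one₀ hd, zpow_natCast]
  rw [hq.qSerre_one hN, h, e1, e2, e3, hN, prod_one_sub_pow hg, prod_one_sub_inv_pow hg, hb,
    qFact_succ]
  have hpm : ((-1 : k) ^ N) * (-1) ^ N = 1 := by rw [← mul_pow]; simp
  generalize (q i - (q i)⁻¹) = d at *
  generalize qInt (q i) (N + 1 : ℕ) = n at *
  generalize q i ^ ((-(N : ℤ) ^ 2 - 3 * N) / 2) = α
  generalize q i ^ (((N : ℤ) ^ 2 + N) / 2) = β
  simp only [smul_mul_assoc, smul_sub, smul_smul, pow_succ]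
  rw [sub_eq_neg_add, ← neg_smul]
  congr 2
  · field_simp
  · field_simp
    linear_combination (-β) * hpm

variable {q : k} {b x κ κ' : S}

/-- The higher Serre sums in terms of divided powers. -/
theorem serreSum_eq (hq : QGeneric q) (hc : c = -N) (hκ : QComm (q ^ (c - 2)) κ b)
    (hκ' : QComm (q ^ (2 - c)) κ' b)
    (h0 : qSerre q b x 1 (N + 1) =
      ((-1) ^ N * (qFact q (N + 1) / qInt q (N + 1 : ℕ) * (q - q⁻¹) ^ (-c - 1) *
        q ^ ((-c ^ 2 + 3 * c) / 2))) • (divPow q b N * κ) +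
      (-(qFact q (N + 1) / qInt q (N + 1 : ℕ) * (q - q⁻¹) ^ (-c - 1) *
        q ^ ((c ^ 2 - c) / 2))) • (divPow q b N * κ'))
    {m : ℕ} (hm : 1 - c ≤ (m : ℤ)) {e : ℤ} (he : e = 1 ∨ e = -1) :
    ∑ p ∈ Finset.HasAntidiagonal.antidiagonal m,
      ((-1 : k) ^ ((p.1 : ℤ) + c) * q ^ (e * (p.1 : ℤ) * (1 - c - (m : ℤ)))) •
        (divPow q b p.1 * x * divPow q b p.2) =
    (qFact q (1 - c).toNat / qInt q m * (q - q⁻¹) ^ (-c - 1)) •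
      (((∏ j ∈ Finset.range (c + m - 1).toNat,
            (-q ^ (e * (2 * (j : ℤ) - c - 2 * m + 2)) + q ^ (c - 2))) *
          q ^ ((-c ^ 2 + 3 * c) / 2)) • (divPow q b (m - 1) * κ) -
        ((-1 : k) ^ c *
          (∏ j ∈ Finset.range (c + m - 1).toNat,
            (-q ^ (e * (2 * (j : ℤ) - c - 2 * m + 2)) + q ^ (2 - c))) *
          q ^ ((c ^ 2 - c) / 2)) • (divPow q b (m - 1) * κ')) := by
  have hm' : N + 1 ≤ m := by omega
  have hn := hq.qInt_ne_zero N.succ_pos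
  have hprod : ∀ u, ∏ j ∈ Finset.range (c + m - 1).toNat,
      (-q ^ (e * (2 * (j : ℤ) - c - 2 * m + 2)) + u) = twistProd (q ^ e) u c m := by
    intro u
    simp only [twistProd, zpow_mul]
  have hsign : (-1 : k) ^ c = (-1) ^ N := by
    rw [hc, zpow_neg, zpow_natCast, ← inv_pow, inv_neg, inv_one]
  have hpm : ((-1 : k) ^ N) * (-1) ^ N = 1 := by rw [← mul_pow]; simp
  -- The recursion is run in q^e. Divided powers, quantum integers and the base Serre sum are
  -- unchanged, and the commutation scalars q^{±(2-c)} stay fixed.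
  have hQ : QGeneric (q ^ e) := by
    rcases he with rfl | rfl
    · rwa [zpow_one]
    · rw [zpow_neg_one]; exact hq.inv
  have hdiv : ∀ n, divPow (q ^ e) b n = divPow q b n := by
    intro n
    rcases he with rfl | rfl
    · rw [zpow_one]
    · rw [zpow_neg_one, divPow_inv]
  have hInt : ∀ n, qInt (q ^ e) n = qInt q n := by
    intro n
    rcases he with rfl | rfl
    · rw [zpow_one]
    · rw [zpow_neg_one, qInt_inv]
  have hS : qSerre (q ^ e) b x 1 (N + 1) = qSerre q b x 1 (N + 1) := by
    rcases he with rfl | rfl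
    · rw [zpow_one]
    · rw [zpow_neg_one, qSerre_inv]
  have key := qSerre_higher hQ hc hκ hκ' (hS.trans (by rw [h0, hdiv])) hm'
  rw [serreSum_eq_qSerre q b x c e m he, hprod, hprod, key, hdiv, hInt, hInt, hsign,
    show (1 - c).toNat = N + 1 by omega]
  generalize (q - q⁻¹) ^ (-c - 1) = d at *
  generalize q ^ ((-c ^ 2 + 3 * c) / 2) = α
  generalize q ^ ((c ^ 2 - c) / 2) = β
  generalize qInt q (N + 1 : ℕ) = n at *
  simp only [smul_smul, smul_add, smul_sub]
  rw [sub_eq_add_neg (_ • _), ← neg_smul]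
  congr 2
  · field_simp
    linear_combination (qFact q (N + 1) * d * α * twistProd (q ^ e) (q ^ (c - 2)) c m /
      qInt q m) * hpm
  · field_simp

/-- The closed form of the higher Serre sums for `e = 1`. -/
theorem serreSum_closed (hq : QGeneric q) (hc : c = -N) (hκ : QComm (q ^ (c - 2)) κ b)
    (hκ' : QComm (q ^ (2 - c)) κ' b)
    (h0 : qSerre q b x 1 (N + 1) =
      ((-1) ^ N * (qFact q (N + 1) / qInt q (N + 1 : ℕ) * (q - q⁻¹) ^ (-c - 1) *
        q ^ ((-c ^ 2 + 3 * c) / 2))) • (divPow q b N * κ) +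
      (-(qFact q (N + 1) / qInt q (N + 1 : ℕ) * (q - q⁻¹) ^ (-c - 1) *
        q ^ ((c ^ 2 - c) / 2))) • (divPow q b N * κ'))
    {m : ℕ} (hm : 1 - c < (m : ℤ)) :
    ∑ p ∈ Finset.HasAntidiagonal.antidiagonal m,
      ((-1 : k) ^ ((p.1 : ℤ) + c) * q ^ (1 * (p.1 : ℤ) * (1 - c - (m : ℤ)))) •
        (divPow q b p.1 * x * divPow q b p.2) =
    ((-1 : k) ^ (1 - c) * qFact q (m - 1) * (q - q⁻¹) ^ (m - 2) *
      q ^ ((1 - (m : ℤ)) * ((m : ℤ) - 2 + 2 * c) / 2)) • (divPow q b (m - 1) * κ') := by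
  obtain ⟨r, rfl⟩ : ∃ r, m = r + 2 := ⟨m - 2, by omega⟩
  have hn : qInt q ((r + 2 : ℕ) : ℤ) ≠ 0 := hq.qInt_ne_zero (by omega)
  -- The scalar q^{c-2} of k_i is the one that makes the product vanish, so only k_{τi} survives.
  have hz := twistProd_eq_zero q hc (m := r + 2) (by omega) rfl
  have hcl := twistProd_closed hq hc (m := r + 2) (by omega)
  rw [show ((r + 2 : ℕ) : ℤ) - 2 = (r : ℕ) by push_cast; ring, zpow_natCast] at hcl
  rw [twistProd] at hz hcl
  rw [serreSum_eq hq hc hκ hκ' h0 hm.le (Or.inl rfl)]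
  simp only [one_mul]
  rw [hz, zero_mul, zero_smul, zero_sub, ← neg_smul, smul_smul,
    show (1 - c).toNat = N + 1 by omega, show r + 2 - 1 = r + 1 by omega, Nat.add_sub_cancel,
    show ((r + 2 : ℕ) : ℤ) - 2 = (r : ℕ) by push_cast; ring]
  congr 1
  rw [qFact_succ q (r + 1)] at hcl
  have hsign : (-1 : k) ^ (1 - c) = -(-1) ^ c := by
    rw [hc, sub_neg_eq_add, zpow_add₀ (by simp), zpow_neg, zpow_natCast, ← inv_pow, inv_neg,
      inv_one, zpow_one, neg_one_mul]
  rw [hsign, div_mul_eq_mul_div, div_mul_eq_mul_div, div_eq_iff hn]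
  linear_combination (-(-1 : k) ^ c) * hcl

/-- The closed form of the higher Serre sums for `e = -1`. -/
theorem serreSum_neg_closed (hq : QGeneric q) (hc : c = -N) (hκ : QComm (q ^ (c - 2)) κ b)
    (hκ' : QComm (q ^ (2 - c)) κ' b)
    (h0 : qSerre q b x 1 (N + 1) =
      ((-1) ^ N * (qFact q (N + 1) / qInt q (N + 1 : ℕ) * (q - q⁻¹) ^ (-c - 1) *
        q ^ ((-c ^ 2 + 3 * c) / 2))) • (divPow q b N * κ) +
      (-(qFact q (N + 1) / qInt q (N + 1 : ℕ) * (q - q⁻¹) ^ (-c - 1) *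
        q ^ ((c ^ 2 - c) / 2))) • (divPow q b N * κ'))
    {m : ℕ} (hm : 1 - c < (m : ℤ)) :
    ∑ p ∈ Finset.HasAntidiagonal.antidiagonal m,
      ((-1 : k) ^ ((p.1 : ℤ) + c) * q ^ (-1 * (p.1 : ℤ) * (1 - c - (m : ℤ)))) •
        (divPow q b p.1 * x * divPow q b p.2) =
    ((-1 : k) ^ ((m : ℤ) + c + 1) * qFact q (m - 1) * (q - q⁻¹) ^ (m - 2) *
      q ^ (((m : ℤ) - 1) * ((m : ℤ) - 2 + 2 * c) / 2 + c)) • (divPow q b (m - 1) * κ) := by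
  obtain ⟨r, rfl⟩ : ∃ r, m = r + 2 := ⟨m - 2, by omega⟩
  have hn : qInt q ((r + 2 : ℕ) : ℤ) ≠ 0 := hq.qInt_ne_zero (by omega)
  -- For the base q⁻¹ the vanishing value is (q⁻¹)^{c-2} = q^{2-c}, the scalar of k_{τi}; here k_i
  -- survives.
  have hz := twistProd_eq_zero q⁻¹ (u := q ^ (2 - c)) hc (m := r + 2) (by omega)
    (by rw [inv_zpow', neg_sub])
  have hcl := twistProd_inv_closed hq hc (m := r + 2) (by omega)
  rw [show ((r + 2 : ℕ) : ℤ) - 2 = (r : ℕ) by push_cast; ring, zpow_natCast] at hcl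
  rw [twistProd] at hz hcl
  simp only [← zpow_neg_one q, ← zpow_mul] at hz
  simp only [inv_zpow', ← neg_one_mul (_ + 2 : ℤ)] at hcl
  rw [serreSum_eq hq hc hκ hκ' h0 hm.le (Or.inr rfl), hz, mul_zero, zero_mul, zero_smul, sub_zero,
    smul_smul, show (1 - c).toNat = N + 1 by omega, show r + 2 - 1 = r + 1 by omega,
    Nat.add_sub_cancel, show ((r + 2 : ℕ) : ℤ) - 2 = (r : ℕ) by push_cast; ring]
  congr 1
  rw [qFact_succ q (r + 1)] at hcl
  rw [div_mul_eq_mul_div, div_mul_eq_mul_div, div_eq_iff hn]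
  linear_combination hcl

end HigherSerreClosed

/-! ### Specialization to the ıquantum group -/

namespace DiagramInvolution

section TauRelation

variable {k : Type*} [Field k] {I : Type*} [Fintype I] [DecidableEq I] {D : CartanDatum I}
  {q : I → k} {A : Type*} [Ring A] [Algebra k A] {E F K K' : I → A} (T : DiagramInvolution D)

theorem kWeight_self (hq : T.IsParam q) (i : I) : T.kWeight q i i = q i ^ (D.c i (T.τ i) - 2) := by
  rw [kWeight, D.diag, zpow_sub₀ (hq.ne_zero i), div_eq_mul_inv, mul_comm]

/-- The relations between `B_i`, `B_{τ i}`, `k_i` and `k_{τ i}` in a subalgebra. -/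
theorem tauRelations (h : DoubleRelations D q E F K K') (hq : T.IsParam q) {i : I}
    (hi : T.τ i ≠ i) {N : ℕ} (hN : D.c i (T.τ i) = -N) (U : Subalgebra k A) {B κ : I → U}
    (hB : ∀ i, (B i : A) = T.iB E F K' i) (hκ : ∀ i, (κ i : A) = T.ik K K' i) :
    QComm (q i ^ (D.c i (T.τ i) - 2)) (κ i) (B i) ∧
    QComm (q i ^ (2 - D.c i (T.τ i))) (κ (T.τ i)) (B i) ∧
    qSerre (q i) (B i) (B (T.τ i)) 1 (N + 1) =
      ((-1) ^ N * (qFact (q i) (N + 1) / qInt (q i) (N + 1 : ℕ) *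
        (q i - (q i)⁻¹) ^ (-D.c i (T.τ i) - 1) *
        q i ^ ((-D.c i (T.τ i) ^ 2 + 3 * D.c i (T.τ i)) / 2))) •
          (divPow (q i) (B i) N * κ i) +
      (-(qFact (q i) (N + 1) / qInt (q i) (N + 1 : ℕ) *
        (q i - (q i)⁻¹) ^ (-D.c i (T.τ i) - 1) *
        q i ^ ((D.c i (T.τ i) ^ 2 - D.c i (T.τ i)) / 2))) •
          (divPow (q i) (B i) N * κ (T.τ i)) := by
  have hinj : Function.Injective U.val := Subtype.val_injective
  refine ⟨.of_map hinj ?_, .of_map hinj ?_, hq.qSerre_of_tauRelation hN (hinj ?_)⟩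
  · rw [U.val_apply, U.val_apply, hB, hκ, ← T.kWeight_self hq]
    exact T.ik_iB h hq i i
  · rw [U.val_apply, U.val_apply, hB, hκ]
    refine (T.ik_iB h hq (T.τ i) i).congr ?_
    rw [T.kWeight_map hq, T.kWeight_self hq, ← zpow_neg, neg_sub]
  · rw [map_qAdIter]
    simp only [map_smul, map_sub, map_mul, map_pow]
    simp only [U.val_apply, hB, hκ]
    exact T.serreRelation_tau h hq hi hN

end TauRelation

section Sigma

variable (𝕂 : Type*) [Field 𝕂] {I : Type*} [Fintype I] [DecidableEq I] {D : CartanDatum I}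
  (T : DiagramInvolution D)

theorem isParam_qi : T.IsParam (D.qi 𝕂) where
  toIsParam := D.isParam_qi 𝕂
  map i := by rw [CartanDatum.qi, CartanDatum.qi, T.ε_map]

theorem existsUnique_isSigma :
    ∃! σ : T.Ui 𝕂 →ₐ[RatFunc 𝕂] (T.Ui 𝕂)ᵐᵒᵖ, T.IsSigma 𝕂 σ := by
  have : Infinite (RatFunc 𝕂) := Infinite.of_injective _ (RatFunc.algebraMap_injective 𝕂)
  have hρ := QDouble.exists_vermaRep 𝕂 D
  have h := QDouble.doubleRelations 𝕂 D
  obtain ⟨σ, ⟨h1, h2, h3⟩, huniq⟩ := T.existsUnique_antiInvolution_subalgebra h (T.isParam_qi 𝕂) hρ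
    (T.Ui 𝕂) rfl (B := T.B 𝕂) (κ := T.k 𝕂) (fun _ => rfl) (fun _ => rfl)
  exact ⟨σ, ⟨h1, h2, h3⟩, fun σ' h' => huniq σ' ⟨h'.invol, h'.map_B, h'.map_k⟩⟩

end Sigma

end DiagramInvolution

theorem theorem3p2 (𝕂 : Type*) [Field 𝕂] [CharZero 𝕂] {I : Type*} [Fintype I] [DecidableEq I]
    (D : CartanDatum I) (T : DiagramInvolution D) :
    (∃! σ : T.Ui 𝕂 →ₐ[RatFunc 𝕂] (T.Ui 𝕂)ᵐᵒᵖ, T.IsSigma 𝕂 σ) ∧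
    ∀ σ : T.Ui 𝕂 →ₐ[RatFunc 𝕂] (T.Ui 𝕂)ᵐᵒᵖ, T.IsSigma 𝕂 σ →
    ∀ i : I, T.τ i ≠ i →
      (∀ m : ℕ, 1 - D.c i (T.τ i) ≤ (m : ℤ) → ∀ e : ℤ, e = 1 ∨ e = -1 →
        T.yElt 𝕂 i m e = 0 ∧ T.yElt' 𝕂 σ i m e = 0) ∧
      (∀ m : ℕ, 1 - D.c i (T.τ i) < (m : ℤ) →
        T.serreSum 𝕂 i m 1 =
          ((-1 : RatFunc 𝕂) ^ (1 - D.c i (T.τ i)) * qFact (D.qi 𝕂 i) (m - 1) *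
            (D.qi 𝕂 i - (D.qi 𝕂 i)⁻¹) ^ (m - 2) *
            D.qi 𝕂 i ^ ((1 - (m : ℤ)) * ((m : ℤ) - 2 + 2 * D.c i (T.τ i)) / 2)) •
            (T.Bdiv 𝕂 i (m - 1) * T.k 𝕂 (T.τ i)) ∧
        T.serreSum 𝕂 i m (-1) =
          ((-1 : RatFunc 𝕂) ^ ((m : ℤ) + D.c i (T.τ i) + 1) * qFact (D.qi 𝕂 i) (m - 1) *
            (D.qi 𝕂 i - (D.qi 𝕂 i)⁻¹) ^ (m - 2) *
            D.qi 𝕂 i ^ (((m : ℤ) - 1) * ((m : ℤ) - 2 + 2 * D.c i (T.τ i)) / 2 +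
              D.c i (T.τ i))) •
            (T.Bdiv 𝕂 i (m - 1) * T.k 𝕂 i)) := by
  refine ⟨T.existsUnique_isSigma 𝕂, fun σ _ i hi => ?_⟩
  obtain ⟨N, hN⟩ := D.exists_c_eq_neg hi.symm
  obtain ⟨h1, h2, h3⟩ := T.tauRelations (QDouble.doubleRelations 𝕂 D) (T.isParam_qi 𝕂) hi hN
    (T.Ui 𝕂) (B := T.B 𝕂) (κ := T.k 𝕂) (fun _ => rfl) (fun _ => rfl)
  have hg := (T.isParam_qi 𝕂).generic i
  refine ⟨fun m hm e he => ?_, fun m hm => ⟨?_, ?_⟩⟩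
  · have hy : T.yElt 𝕂 i m e = 0 := sub_eq_zero.2 (serreSum_eq hg hN h1 h2 h3 hm he)
    -- The primed relation is the image of 0 under σ.
    exact ⟨hy, by rw [DiagramInvolution.yElt', hy, map_zero, MulOpposite.unop_zero]⟩
  · exact serreSum_closed hg hN h1 h2 h3 hm
  · exact serreSum_neg_closed hg hN h1 h2 h3 hm
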